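/- For each $n\ge 1$ let $p=p_n\in\mathbb N$ and let $X_1,\dots,X_n$ be i.i.d. random vectors in $\mathbb R^{p}$ with finite second moments, mean vector $\mu$ and covariance matrix $\Sigma=(\sigma_{ij})$; here $p$, $\mu$, $\Sigma$, the law of $X_1$ and the underlying probability space may all depend on $n$ in an arbitrary way (in particular $p$ may be fixed or divergent). Put $N=\lfloor n/2\rfloor$, $\mathbf 1=(1,\dots,1)^T\in\mathbb R^p$, $Y_i=(X_i-\mu)(X_i-\mu)^T$ and, for a $p\times p$ matrix $S$ and $1\le i\le N$, $$e_i(S)=\operatorname{tr}\big((Y_i-S)(Y_{i+N}-S)\big),\qquad v_i(S)=\mathbf 1^T(Y_i+Y_{i+N}-2S)\mathbf 1,\qquad R_i(S)=(e_i(S),v_i(S))^T .$$ Let $\bar X^1=\frac1N\sum_{i=1}^N X_i$, $\bar X^2=\frac1N\sum_{i=N+1}^{2N}X_i$, and for $1\le i\le N$ let $Y^*_i=(X_i-\bar X^1)(X_i-\bar X^1)^T$, $Y^*_{N+i}=(X_{N+i}-\bar X^2)(X_{N+i}-\bar X^2)^T$, $$e^*_i(S)=\operatorname{tr}\Big(\big(Y^*_i-\tfrac{N-1}{N}S\big)\big(Y^*_{i+N}-\tfrac{N-1}{N}S\big)\Big),\qquad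 v^*_i(S)=\mathbf 1^T\Big(Y^*_i+Y^*_{i+N}-\tfrac{2(N-1)}{N}S\Big)\mathbf 1,$$ and $R^*_i(S)=(e^*_i(S),v^*_i(S))^T$. Define $$L_1(S)=\sup\Big\{\prod_{i=1}^N (Nw_i):\ w_i\ge0,\ \sum_{i=1}^N w_i=1,\ \sum_{i=1}^N w_iR_i(S)=0\Big\}$$ (with $\sup\emptyset=0$ and $-2\log 0=+\infty$), and let $L_2(S)$ be defined in the same way with $R^*_i(S)$ in place of $R_i(S)$. Let $\delta>0$. Suppose that for all sufficiently large $n$ the random variables $e_1(\Sigma)$ and $v_1(\Sigma)$ have finite absolute moments of order $2+\delta$ and $\mathrm E[v_1^2(\Sigma)]>0$, and that, as $n\to\infty$, $$\max\left\{\frac{\mathrm E|e_1(\Sigma)|^{2+\delta}}{(\mathrm E[e_1^2(\Sigma)])^{(2+\delta)/2}},\ \frac{\mathrm E|v_1(\Sigma)|^{2+\delta}}{(\mathrm E[v_1^2(\Sigma)])^{(2+\delta)/2}}\right\}=o\big(N^{(\delta+\min\{2,\delta\})/4}\big).$$ Let $\Sigma_0=\Sigma_{0,n}$ be given $p\times p$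 matrices. Then, under $H_0:\Sigma=\Sigma_0$ (for every $n$), $-2\log L_1(\Sigma_0)$ converges in distribution, as $n\to\infty$, to a chi-square distribution with two degrees of freedom. If in addition, as $n\to\infty$, $$(\operatorname{tr}(\Sigma^2))^2=o\big(N^2\,\mathrm E[e_1^2(\Sigma)]\big)\quad\text{and}\quad\Big(\sum_{i=1}^p\sum_{j=1}^p\sigma_{ij}\Big)^2=o\big(N\,\mathrm E[v_1^2(\Sigma)]\big),$$ then, under $H_0$, $-2\log L_2(\Sigma_0)$ also converges in distribution to a chi-square distribution with two degrees of freedom. -/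

import Mathlib

open MeasureTheory ProbabilityTheory Filter Topology Matrix Asymptotics

noncomputable section

namespace CovEL

/-- The first `n` vectors `X 0, …, X (n - 1)` form an i.i.d. sample in `ℝᵖ` with finite second
moments, mean vector `u` and covariance matrix `S`. (Only the indices below `n` matter.) -/
structure IsSample {Ω : Type*} [MeasurableSpace Ω] (P : Measure Ω) (n p : ℕ)
    (X : ℕ → Ω → Fin p → ℝ) (u : Fin p → ℝ) (S : Matrix (Fin p) (Fin p) ℝ) : Prop where
  aemeasurable : ∀ i < n, AEMeasurable (X i) P
  indep : iIndepFun (fun i : Fin n => X i) P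
  identDistrib : ∀ i < n, ∀ j < n, IdentDistrib (X i) (X j) P P
  memLp_two : ∀ i < n, ∀ a, MemLp (fun ω => X i ω a) 2 P
  mean : ∀ i < n, ∀ a, ∫ ω, X i ω a ∂P = u a
  cov : ∀ i < n, ∀ a b, cov[fun ω => X i ω a, fun ω => X i ω b; P] = S a b

variable {p : ℕ}

/-- The matrix `(x - u)(x - u)ᵀ`. -/
def outer (x u : Fin p → ℝ) : Matrix (Fin p) (Fin p) ℝ := vecMulVec (x - u) (x - u)

/-- `1ᵀ A 1`, the sum of all entries of `A`. -/
def oneForm (A : Matrix (Fin p) (Fin p) ℝ) : ℝ := (1 : Fin p → ℝ) ⬝ᵥ (A *ᵥ (1 : Fin p → ℝ))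

/-- `e_i(S) = tr((Y_i - S)(Y_{i+N} - S))` with `Y_i = (x_i - u)(x_i - u)ᵀ`;
indices start at `0`, so the first half-sample is `x 0, …, x (N - 1)` and the second
is `x N, …, x (2N - 1)`. -/
def e (N : ℕ) (u : Fin p → ℝ) (S : Matrix (Fin p) (Fin p) ℝ) (x : ℕ → Fin p → ℝ) (i : ℕ) : ℝ :=
  trace ((outer (x i) u - S) * (outer (x (i + N)) u - S))

/-- `v_i(S) = 1ᵀ (Y_i + Y_{i+N} - 2 S) 1`. -/
def v (N : ℕ) (u : Fin p → ℝ) (S : Matrix (Fin p) (Fin p) ℝ) (x : ℕ → Fin p → ℝ) (i : ℕ) : ℝ :=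
  oneForm (outer (x i) u + outer (x (i + N)) u - (2 : ℝ) • S)

/-- Sample mean of the first half-sample. -/
def mean₁ (N : ℕ) (x : ℕ → Fin p → ℝ) : Fin p → ℝ :=
  (1 / (N : ℝ)) • ∑ i ∈ Finset.range N, x i

/-- Sample mean of the second half-sample. -/
def mean₂ (N : ℕ) (x : ℕ → Fin p → ℝ) : Fin p → ℝ :=
  (1 / (N : ℝ)) • ∑ i ∈ Finset.range N, x (i + N)

/-- `e*_i(S)`: the mean vector is replaced by the sample mean of the respective half-sample and
`S` by `((N - 1) / N) S`. -/
def eStar (N : ℕ) (S : Matrix (Fin p) (Fin p) ℝ) (x : ℕ → Fin p → ℝ) (i : ℕ) : ℝ :=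
  trace ((outer (x i) (mean₁ N x) - (((N : ℝ) - 1) / N) • S) *
    (outer (x (i + N)) (mean₂ N x) - (((N : ℝ) - 1) / N) • S))

/-- `v*_i(S)`. -/
def vStar (N : ℕ) (S : Matrix (Fin p) (Fin p) ℝ) (x : ℕ → Fin p → ℝ) (i : ℕ) : ℝ :=
  oneForm (outer (x i) (mean₁ N x) + outer (x (i + N)) (mean₂ N x)
    - (2 * ((N : ℝ) - 1) / N) • S)

/-- The empirical likelihood ratio
`sup {∏ (N w_i) : w_i ≥ 0, ∑ w_i = 1, ∑ w_i R_i = 0}` of `R_1, …, R_N ∈ ℝ²`.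
The set is bounded above by `1`; the supremum is `0` when no weight vector is admissible. -/
def elRatio {N : ℕ} (R : Fin N → Fin 2 → ℝ) : ℝ :=
  sSup {r : ℝ | ∃ w : Fin N → ℝ, (∀ i, 0 ≤ w i) ∧ ∑ i, w i = 1 ∧ ∑ i, w i • R i = 0 ∧
    r = ∏ i, ((N : ℝ) * w i)}

/-- `L₁(S)`: the empirical likelihood ratio of `R_i(S) = (e_i(S), v_i(S))`, mean `u` known. -/
def L₁ (N : ℕ) (u : Fin p → ℝ) (S : Matrix (Fin p) (Fin p) ℝ) (x : ℕ → Fin p → ℝ) : ℝ :=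
  elRatio (fun i : Fin N => ![e N u S x i, v N u S x i])

/-- `L₂(S)`: the empirical likelihood ratio of `R*_i(S) = (e*_i(S), v*_i(S))`, mean unknown. -/
def L₂ (N : ℕ) (S : Matrix (Fin p) (Fin p) ℝ) (x : ℕ → Fin p → ℝ) : ℝ :=
  elRatio (fun i : Fin N => ![eStar N S x i, vStar N S x i])

/-- `-2 log L` for `L ≥ 0`, as an extended real; it is `+∞` at `L = 0`. -/
def negTwoLog (L : ℝ) : EReal := -2 * ENNReal.log (ENNReal.ofReal L)

/-- The chi-square distribution with `k` degrees of freedom: the law of the sum of squares of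
`k` independent standard normal variables. -/
def chiSquare (k : ℕ) : Measure ℝ :=
  (Measure.pi (fun _ : Fin k => gaussianReal 0 1)).map (fun z => ∑ i, z i ^ 2)

instance chiSquare_isProbabilityMeasure (k : ℕ) : IsProbabilityMeasure (chiSquare k) :=
  Measure.isProbabilityMeasure_map
    (Finset.measurable_fun_sum _ fun i _ => (measurable_pi_apply i).pow_const 2).aemeasurable

end CovEL

end

noncomputable section

namespace CovEL

section LogBounds

theorem one_add_le_exp_quadratic {t d : ℝ} (h : |t| ≤ d) (hd : d ≤ 1 / 2) :
    Real.exp (t - (1 / 2 + 2 * d) * t ^ 2) ≤ 1 + t := by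
  have h1 := abs_le.mp h
  have hpos : 0 < 1 + t := by linarith
  rw [← Real.le_log_iff_exp_le hpos]
  have key := Real.abs_log_sub_add_sum_range_le (x := -t) (by rw [abs_neg]; linarith) 2
  simp only [Finset.sum_range_succ, Finset.sum_range_zero, abs_neg] at key
  norm_num at key
  have hd0 : 0 ≤ d := (abs_nonneg t).trans h
  have h2 : |t| ^ 3 / (1 - |t|) ≤ 2 * (d * t ^ 2) := by
    rw [div_le_iff₀ (by linarith)]
    have h3 : |t| ^ 3 ≤ d * t ^ 2 := by
      rw [pow_succ, sq_abs, mul_comm]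
      exact mul_le_mul_of_nonneg_right h (sq_nonneg t)
    have : 0 ≤ d * t ^ 2 := by positivity
    nlinarith
  have h3 := (abs_le.mp key).1
  nlinarith

end LogBounds

section ELRatio

variable {N : ℕ}

/-- The values of the empirical likelihood at admissible weights. -/
def elSet (R : Fin N → Fin 2 → ℝ) : Set ℝ :=
  {r : ℝ | ∃ w : Fin N → ℝ, (∀ i, 0 ≤ w i) ∧ ∑ i, w i = 1 ∧ ∑ i, w i • R i = 0 ∧
    r = ∏ i, ((N : ℝ) * w i)}

theorem elRatio_eq_sSup (R : Fin N → Fin 2 → ℝ) : elRatio R = sSup (elSet R) := rfl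

theorem prod_mul_weights_le_exp {w c : Fin N → ℝ} (hw : ∀ i, 0 ≤ w i) (hc : ∀ i, 0 ≤ c i) :
    (∏ i, ((N : ℝ) * w i)) * ∏ i, c i ≤ Real.exp (∑ i, ((N : ℝ) * w i * c i - 1)) := by
  rw [← Finset.prod_mul_distrib, Real.exp_sum]
  refine Finset.prod_le_prod (fun i _ => ?_) fun i _ => ?_
  · have := hw i; have := hc i; positivity
  · have := Real.add_one_le_exp ((N : ℝ) * w i * c i - 1)
    linarith

theorem le_one_of_mem_elSet {R : Fin N → Fin 2 → ℝ} {r : ℝ} (h : r ∈ elSet R) : r ≤ 1 := by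
  obtain ⟨w, hw, hs, -, rfl⟩ := h
  have := prod_mul_weights_le_exp (c := fun _ => 1) hw (fun _ => zero_le_one)
  simpa [Finset.sum_sub_distrib, ← Finset.mul_sum, hs] using this

theorem bddAbove_elSet (R : Fin N → Fin 2 → ℝ) : BddAbove (elSet R) :=
  ⟨1, fun _ h => le_one_of_mem_elSet h⟩

theorem nonneg_of_mem_elSet {R : Fin N → Fin 2 → ℝ} {r : ℝ} (h : r ∈ elSet R) : 0 ≤ r := by
  obtain ⟨w, hw, -, -, rfl⟩ := h
  exact Finset.prod_nonneg fun i _ => mul_nonneg (Nat.cast_nonneg _) (hw i)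

theorem elRatio_nonneg (R : Fin N → Fin 2 → ℝ) : 0 ≤ elRatio R :=
  Real.sSup_nonneg fun _ => nonneg_of_mem_elSet

theorem sum_smul_eq_zero_iff (w : Fin N → ℝ) (x y : Fin N → ℝ) :
    ∑ i, w i • (![x i, y i] : Fin 2 → ℝ) = 0 ↔ ∑ i, w i * x i = 0 ∧ ∑ i, w i * y i = 0 := by
  rw [funext_iff, Fin.forall_fin_two]
  simp [Finset.sum_apply]

theorem elRatio_scale (x y : Fin N → ℝ) {α β : ℝ} (hα : α ≠ 0) (hβ : β ≠ 0) :
    elRatio (fun i => ![α * x i, β * y i]) = elRatio (fun i => ![x i, y i]) := by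
  unfold elRatio
  simp_rw [sum_smul_eq_zero_iff, mul_left_comm, ← Finset.mul_sum, mul_eq_zero, hα, hβ, false_or]

theorem elRatio_le_exp {x y : Fin N → ℝ} {a b d : ℝ} (hd : d ≤ 1 / 2)
    (h : ∀ i, |a * x i + b * y i| ≤ d) :
    elRatio (fun i => ![x i, y i]) ≤ Real.exp (-(∑ i, (a * x i + b * y i)
      - (1 / 2 + 2 * d) * ∑ i, (a * x i + b * y i) ^ 2)) := by
  refine Real.sSup_le ?_ (Real.exp_nonneg _)
  rintro r ⟨w, hw, hs, h0, rfl⟩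
  rw [sum_smul_eq_zero_iff] at h0
  have hc : ∀ i, 0 ≤ 1 + (a * x i + b * y i) := fun i => by
    have := (abs_le.mp (h i)).1; linarith
  have h1 := prod_mul_weights_le_exp hw hc
  have h2 : ∑ i, ((N : ℝ) * w i * (1 + (a * x i + b * y i)) - 1) = 0 := by
    have : ∀ i, (N : ℝ) * w i * (1 + (a * x i + b * y i)) - 1
        = N * w i + N * a * (w i * x i) + N * b * (w i * y i) - 1 := fun i => by ring
    simp_rw [this, Finset.sum_sub_distrib, Finset.sum_add_distrib, ← Finset.mul_sum, hs, h0]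
    simp
  rw [h2, Real.exp_zero] at h1
  have h3 : Real.exp (∑ i, (a * x i + b * y i) - (1 / 2 + 2 * d) * ∑ i, (a * x i + b * y i) ^ 2)
      ≤ ∏ i, (1 + (a * x i + b * y i)) := by
    rw [Finset.mul_sum, ← Finset.sum_sub_distrib, Real.exp_sum]
    exact Finset.prod_le_prod (fun i _ => Real.exp_nonneg _)
      fun i _ => one_add_le_exp_quadratic (h i) hd
  rw [Real.exp_neg, ← one_div, le_div_iff₀ (Real.exp_pos _)]
  exact (mul_le_mul_of_nonneg_left h3
    (Finset.prod_nonneg fun i _ => mul_nonneg (Nat.cast_nonneg _) (hw i))).trans h1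

theorem exp_le_elRatio (hN : 0 < N) {x y t : Fin N → ℝ} {d : ℝ} (hd : d ≤ 1 / 2)
    (ht : ∀ i, |t i| ≤ d) (ht0 : ∑ i, t i = 0) (htx : ∑ i, t i * x i = -∑ i, x i)
    (hty : ∑ i, t i * y i = -∑ i, y i) :
    Real.exp (-((1 / 2 + 2 * d) * ∑ i, t i ^ 2)) ≤ elRatio (fun i => ![x i, y i]) := by
  have hN' : (N : ℝ) ≠ 0 := by positivity
  have hmem : ∏ i, (1 + t i) ∈ elSet (fun i => ![x i, y i]) := by
    refine ⟨fun i => (1 + t i) / N, fun i => ?_, ?_, ?_, ?_⟩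
    · have := (abs_le.mp (ht i)).1
      exact div_nonneg (by linarith) (Nat.cast_nonneg _)
    · rw [← Finset.sum_div, Finset.sum_add_distrib, ht0]
      simp [hN']
    · rw [sum_smul_eq_zero_iff]
      simp_rw [div_mul_eq_mul_div, ← Finset.sum_div, add_mul, one_mul, Finset.sum_add_distrib,
        htx, hty]
      simp
    · refine Finset.prod_congr rfl fun i _ => ?_
      field_simp
  refine le_trans ?_ (le_csSup (bddAbove_elSet _) hmem)
  have : -((1 / 2 + 2 * d) * ∑ i, t i ^ 2) = ∑ i, (t i - (1 / 2 + 2 * d) * t i ^ 2) := by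
    rw [Finset.sum_sub_distrib, ht0, Finset.mul_sum, zero_sub]
  rw [this, Real.exp_sum]
  exact Finset.prod_le_prod (fun i _ => Real.exp_nonneg _)
    fun i _ => one_add_le_exp_quadratic (ht i) hd

/-- The weights of the Euclidean likelihood give a lower bound on the empirical likelihood. -/
theorem exp_le_elRatio_of_solution (hN : 0 < N) {x y : Fin N → ℝ} {μ ν d : ℝ} (hd : d ≤ 1 / 2)
    (ht : ∀ i, |μ * (x i - (∑ j, x j) / N) + ν * (y i - (∑ j, y j) / N)| ≤ d)
    (hx : μ * (∑ i, x i ^ 2 - (∑ i, x i) ^ 2 / N)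
      + ν * (∑ i, x i * y i - (∑ i, x i) * (∑ i, y i) / N) = -∑ i, x i)
    (hy : μ * (∑ i, x i * y i - (∑ i, x i) * (∑ i, y i) / N)
      + ν * (∑ i, y i ^ 2 - (∑ i, y i) ^ 2 / N) = -∑ i, y i) :
    Real.exp ((1 / 2 + 2 * d) * (μ * ∑ i, x i + ν * ∑ i, y i))
      ≤ elRatio (fun i => ![x i, y i]) := by
  have hN' : (N : ℝ) ≠ 0 := by positivity
  set a := ∑ i, x i with ha
  set b := ∑ i, y i with hb
  have ht0 : ∑ i, (μ * (x i - a / N) + ν * (y i - b / N)) = 0 := by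
    simp_rw [Finset.sum_add_distrib, ← Finset.mul_sum, Finset.sum_sub_distrib, ← ha, ← hb]
    simp
    field_simp
    ring
  have htx : ∑ i, (μ * (x i - a / N) + ν * (y i - b / N)) * x i = -a := by
    have : ∀ i, (μ * (x i - a / N) + ν * (y i - b / N)) * x i
        = μ * x i ^ 2 - (μ * a / N) * x i + ν * (x i * y i) - (ν * b / N) * x i := fun i => by ring
    simp_rw [this, Finset.sum_sub_distrib, Finset.sum_add_distrib, Finset.sum_sub_distrib,
      ← Finset.mul_sum, ← ha]
    rw [← hx]
    ring
  have hty : ∑ i, (μ * (x i - a / N) + ν * (y i - b / N)) * y i = -b := by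
    have : ∀ i, (μ * (x i - a / N) + ν * (y i - b / N)) * y i
        = μ * (x i * y i) - (μ * a / N) * y i + ν * y i ^ 2 - (ν * b / N) * y i := fun i => by ring
    simp_rw [this, Finset.sum_sub_distrib, Finset.sum_add_distrib, Finset.sum_sub_distrib,
      ← Finset.mul_sum, ← hb]
    rw [← hy]
    ring
  have htt : ∑ i, (μ * (x i - a / N) + ν * (y i - b / N)) ^ 2 = -(μ * a + ν * b) := by
    have : ∀ i, (μ * (x i - a / N) + ν * (y i - b / N)) ^ 2
        = μ * ((μ * (x i - a / N) + ν * (y i - b / N)) * x i)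
          + ν * ((μ * (x i - a / N) + ν * (y i - b / N)) * y i)
          - (μ * a / N + ν * b / N) * (μ * (x i - a / N) + ν * (y i - b / N)) := fun i => by ring
    rw [Finset.sum_congr rfl fun i _ => this i, Finset.sum_sub_distrib, Finset.sum_add_distrib,
      ← Finset.mul_sum, ← Finset.mul_sum, ← Finset.mul_sum, htx, hty, ht0]
    ring
  have := exp_le_elRatio hN hd ht ht0 htx hty
  rw [htt] at this
  convert this using 2
  ring

theorem isClosed_exists_le_prod (c : ℝ) :
    IsClosed {R : Fin N → Fin 2 → ℝ | ∃ r ∈ elSet R, c ≤ r} := by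
  let K : Set (Fin N → ℝ) := stdSimplex ℝ (Fin N)
  have hK : IsCompact K := isCompact_stdSimplex ℝ (Fin N)
  have : CompactSpace K := isCompact_iff_compactSpace.mp hK
  have hC : IsClosed {q : K × (Fin N → Fin 2 → ℝ) |
      ∑ i, q.1.1 i • q.2 i = 0 ∧ c ≤ ∏ i, ((N : ℝ) * q.1.1 i)} := by
    have hw : ∀ i, Continuous fun q : K × (Fin N → Fin 2 → ℝ) => q.1.1 i := fun i =>
      (continuous_apply i).comp (continuous_subtype_val.comp continuous_fst)
    have hR : ∀ i, Continuous fun q : K × (Fin N → Fin 2 → ℝ) => q.2 i := fun i =>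
      (continuous_apply i).comp continuous_snd
    exact IsClosed.and
      (isClosed_eq (continuous_finsetSum _ fun i _ => (hw i).smul (hR i)) continuous_const)
      (isClosed_le continuous_const
        (continuous_finsetProd _ fun i _ => continuous_const.mul (hw i)))
  convert isClosedMap_snd_of_compactSpace _ hC using 1
  ext R
  constructor
  · rintro ⟨r, ⟨w, hw, hs, h0, rfl⟩, hr⟩
    exact ⟨(⟨w, hw, hs⟩, R), ⟨h0, hr⟩, rfl⟩
  · rintro ⟨⟨⟨w, hw, hs⟩, R'⟩, ⟨h0, hr⟩, rfl⟩
    exact ⟨_, ⟨w, hw, hs, h0, rfl⟩, hr⟩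

theorem measurable_elRatio : Measurable (elRatio (N := N)) := by
  refine measurable_of_Ioi fun c => ?_
  rcases lt_or_ge c 0 with hc | hc
  · convert MeasurableSet.univ
    ext R
    simpa using hc.trans_le (elRatio_nonneg R)
  · have : elRatio ⁻¹' Set.Ioi c = ⋃ k : ℕ,
        {R : Fin N → Fin 2 → ℝ | ∃ r ∈ elSet R, c + 1 / ((k : ℝ) + 1) ≤ r} := by
      ext R
      simp only [Set.mem_preimage, Set.mem_Ioi, Set.mem_iUnion, Set.mem_ofPred_eq]
      constructor
      · intro h
        have hne : (elSet R).Nonempty := by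
          by_contra hne
          rw [Set.not_nonempty_iff_eq_empty] at hne
          rw [elRatio_eq_sSup, hne, Real.sSup_empty] at h
          linarith
        obtain ⟨r, hr, hcr⟩ := exists_lt_of_lt_csSup hne h
        obtain ⟨k, hk⟩ := exists_nat_one_div_lt (sub_pos.mpr hcr)
        exact ⟨k, r, hr, by linarith⟩
      · rintro ⟨k, r, hr, hcr⟩
        have : 0 < 1 / ((k : ℝ) + 1) := by positivity
        exact lt_of_lt_of_le (by linarith) (le_csSup (bddAbove_elSet R) hr)
    rw [this]
    exact MeasurableSet.iUnion fun k => (isClosed_exists_le_prod _).measurableSet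

theorem measurable_negTwoLog : Measurable negTwoLog := by
  unfold negTwoLog
  have h1 : Measurable fun L : ℝ => ENNReal.log (ENNReal.ofReal L) :=
    ENNReal.measurable_log.comp ENNReal.measurable_ofReal
  exact measurable_const.mul h1

theorem negTwoLog_of_pos {L : ℝ} (hL : 0 < L) : negTwoLog L = ((-2 * Real.log L : ℝ) : EReal) := by
  unfold negTwoLog
  rw [ENNReal.log_ofReal_of_pos hL, EReal.coe_mul]
  rfl

end ELRatio

section Expansion

theorem abs_le_pi_norm {m : ℕ} (x : Fin m → ℝ) (i : Fin m) : |x i| ≤ ‖x‖ := norm_le_pi_norm x i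

variable {α : Type*} {G : Filter α} {N : α → ℕ} {x y : ∀ q, Fin (N q) → ℝ}

theorem tendsto_negTwoLog_of_tendsto_sum (hN : Tendsto N G atTop)
    (hx : Tendsto (fun q => ‖x q‖) G (𝓝 0)) (hy : Tendsto (fun q => ‖y q‖) G (𝓝 0))
    (hxx : Tendsto (fun q => ∑ i, x q i ^ 2) G (𝓝 1))
    (hxy : Tendsto (fun q => ∑ i, x q i * y q i) G (𝓝 0))
    (hyy : Tendsto (fun q => ∑ i, y q i ^ 2) G (𝓝 1))
    {a₀ b₀ : ℝ} (ha : Tendsto (fun q => ∑ i, x q i) G (𝓝 a₀))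
    (hb : Tendsto (fun q => ∑ i, y q i) G (𝓝 b₀)) :
    (∀ᶠ q in G, 0 < elRatio (fun i => ![x q i, y q i])) ∧
    Tendsto (fun q => -2 * Real.log (elRatio (fun i => ![x q i, y q i]))) G
      (𝓝 (a₀ ^ 2 + b₀ ^ 2)) := by
  set a : α → ℝ := fun q => ∑ i, x q i with ha'
  set b : α → ℝ := fun q => ∑ i, y q i with hb'
  have hNi : Tendsto (fun q => (N q : ℝ)⁻¹) G (𝓝 0) :=
    tendsto_inv_atTop_zero.comp (tendsto_natCast_atTop_atTop.comp hN)
  set cxx : α → ℝ := fun q => ∑ i, x q i ^ 2 - a q ^ 2 / N q with hcxx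
  set cxy : α → ℝ := fun q => ∑ i, x q i * y q i - a q * b q / N q with hcxy
  set cyy : α → ℝ := fun q => ∑ i, y q i ^ 2 - b q ^ 2 / N q with hcyy
  have tcxx : Tendsto cxx G (𝓝 1) := by
    simpa [hcxx, div_eq_mul_inv] using hxx.sub ((ha.pow 2).mul hNi)
  have tcxy : Tendsto cxy G (𝓝 0) := by
    simpa [hcxy, div_eq_mul_inv] using hxy.sub ((ha.mul hb).mul hNi)
  have tcyy : Tendsto cyy G (𝓝 1) := by
    simpa [hcyy, div_eq_mul_inv] using hyy.sub ((hb.pow 2).mul hNi)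
  set D : α → ℝ := fun q => cxx q * cyy q - cxy q ^ 2 with hD
  have tD : Tendsto D G (𝓝 1) := by simpa [hD] using (tcxx.mul tcyy).sub (tcxy.pow 2)
  set μ : α → ℝ := fun q => (-(a q) * cyy q + b q * cxy q) / D q with hμ
  set ν : α → ℝ := fun q => (-(b q) * cxx q + a q * cxy q) / D q with hν
  have tμ : Tendsto μ G (𝓝 (-a₀)) := by
    have := ((ha.neg.mul tcyy).add (hb.mul tcxy)).div tD one_ne_zero
    rwa [mul_one, mul_zero, add_zero, div_one] at this
  have tν : Tendsto ν G (𝓝 (-b₀)) := by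
    have := ((hb.neg.mul tcxx).add (ha.mul tcxy)).div tD one_ne_zero
    rwa [mul_one, mul_zero, add_zero, div_one] at this
  set dU : α → ℝ := fun q => |a q| * ‖x q‖ + |b q| * ‖y q‖ with hdU
  have tdU : Tendsto dU G (𝓝 0) := by
    simpa using (ha.abs.mul hx).add (hb.abs.mul hy)
  set dL : α → ℝ := fun q => |μ q| * (‖x q‖ + |a q| * (N q : ℝ)⁻¹)
    + |ν q| * (‖y q‖ + |b q| * (N q : ℝ)⁻¹) with hdL
  have tdL : Tendsto dL G (𝓝 0) := by
    simpa using (tμ.abs.mul (hx.add (ha.abs.mul hNi))).add (tν.abs.mul (hy.add (hb.abs.mul hNi)))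
  have hU : ∀ᶠ q in G, elRatio (fun i => ![x q i, y q i]) ≤
      Real.exp (-((a q ^ 2 + b q ^ 2) - (1 / 2 + 2 * dU q) *
        (a q ^ 2 * ∑ i, x q i ^ 2 + 2 * a q * b q * ∑ i, x q i * y q i
          + b q ^ 2 * ∑ i, y q i ^ 2))) := by
    filter_upwards [tdU.eventually_le_const (show (0 : ℝ) < 1 / 2 by norm_num)] with q hq
    have h := elRatio_le_exp (x := x q) (y := y q) (a := a q) (b := b q) hq fun i => by
      refine (abs_add_le _ _).trans (add_le_add ?_ ?_) <;> rw [abs_mul] <;>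
      exact mul_le_mul_of_nonneg_left (abs_le_pi_norm _ i) (abs_nonneg _)
    convert h using 4
    · rw [Finset.sum_add_distrib, ← Finset.mul_sum, ← Finset.mul_sum]
      simp only [ha', hb']
      ring
    · have h2 : ∀ i, (a q * x q i + b q * y q i) ^ 2 = a q ^ 2 * x q i ^ 2
          + 2 * a q * b q * (x q i * y q i) + b q ^ 2 * y q i ^ 2 := fun i => by ring
      rw [Finset.sum_congr rfl fun i _ => h2 i, Finset.sum_add_distrib, Finset.sum_add_distrib,
        ← Finset.mul_sum, ← Finset.mul_sum, ← Finset.mul_sum]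
  have hL : ∀ᶠ q in G, Real.exp ((1 / 2 + 2 * dL q) * (μ q * a q + ν q * b q)) ≤
      elRatio (fun i => ![x q i, y q i]) := by
    filter_upwards [tdL.eventually_le_const (show (0 : ℝ) < 1 / 2 by norm_num),
      tD.eventually_ne one_ne_zero, hN.eventually_gt_atTop 0] with q hq hDq hNq
    refine exp_le_elRatio_of_solution hNq hq (fun i => ?_) ?_ ?_
    · refine (abs_add_le _ _).trans (add_le_add ?_ ?_) <;> rw [abs_mul] <;>
      refine mul_le_mul_of_nonneg_left ((abs_sub _ _).trans ?_) (abs_nonneg _) <;>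
      refine add_le_add (abs_le_pi_norm _ i) (le_of_eq ?_) <;>
      rw [abs_div, Nat.abs_cast, div_eq_mul_inv]
    · change μ q * cxx q + ν q * cxy q = -a q
      simp only [hμ, hν]
      field_simp
      simp only [hD]
      ring
    · change μ q * cxy q + ν q * cyy q = -b q
      simp only [hμ, hν]
      field_simp
      simp only [hD]
      ring
  have hpos : ∀ᶠ q in G, 0 < elRatio (fun i => ![x q i, y q i]) :=
    hL.mono fun q hq => (Real.exp_pos _).trans_le hq
  refine ⟨hpos, ?_⟩
  have tl : Tendsto (fun q => 2 * ((a q ^ 2 + b q ^ 2) - (1 / 2 + 2 * dU q) *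
        (a q ^ 2 * ∑ i, x q i ^ 2 + 2 * a q * b q * ∑ i, x q i * y q i
          + b q ^ 2 * ∑ i, y q i ^ 2))) G (𝓝 (a₀ ^ 2 + b₀ ^ 2)) := by
    have := ((((ha.pow 2).add (hb.pow 2)).sub (((tdU.const_mul 2).const_add (1 / 2)).mul
      ((((ha.pow 2).mul hxx).add (((ha.const_mul 2).mul hb).mul hxy)).add
        ((hb.pow 2).mul hyy)))).const_mul 2)
    convert this using 2
    ring
  have tu : Tendsto (fun q => -2 * ((1 / 2 + 2 * dL q) * (μ q * a q + ν q * b q))) G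
      (𝓝 (a₀ ^ 2 + b₀ ^ 2)) := by
    have := (((tdL.const_mul 2).const_add (1 / 2)).mul ((tμ.mul ha).add (tν.mul hb))).const_mul (-2)
    convert this using 2
    ring
  refine tendsto_of_tendsto_of_tendsto_of_le_of_le' tl tu ?_ ?_
  · filter_upwards [hU, hpos] with q h1 h2
    have := (Real.log_le_iff_le_exp h2).mpr h1
    linarith
  · filter_upwards [hL, hpos] with q h1 h2
    have := (Real.le_log_iff_exp_le h2).mpr h1
    linarith

/-- Wilks' expansion of the empirical likelihood ratio of a bivariate array. -/
theorem tendsto_negTwoLog_sub (hN : Tendsto N G atTop)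
    (hx : Tendsto (fun q => ‖x q‖) G (𝓝 0)) (hy : Tendsto (fun q => ‖y q‖) G (𝓝 0))
    (hxx : Tendsto (fun q => ∑ i, x q i ^ 2) G (𝓝 1))
    (hxy : Tendsto (fun q => ∑ i, x q i * y q i) G (𝓝 0))
    (hyy : Tendsto (fun q => ∑ i, y q i ^ 2) G (𝓝 1))
    {K : ℝ} (hK : ∀ᶠ q in G, |∑ i, x q i| ≤ K ∧ |∑ i, y q i| ≤ K) :
    (∀ᶠ q in G, 0 < elRatio (fun i => ![x q i, y q i])) ∧
    Tendsto (fun q => -2 * Real.log (elRatio (fun i => ![x q i, y q i]))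
      - ((∑ i, x q i) ^ 2 + (∑ i, y q i) ^ 2)) G (𝓝 0) := by
  have key : ∀ U : Ultrafilter α, ↑U ≤ G →
      (∀ᶠ q in (U : Filter α), 0 < elRatio (fun i => ![x q i, y q i])) ∧
      Tendsto (fun q => -2 * Real.log (elRatio (fun i => ![x q i, y q i]))
        - ((∑ i, x q i) ^ 2 + (∑ i, y q i) ^ 2)) U (𝓝 0) := by
    intro U hU
    have lim : ∀ f : α → ℝ, (∀ᶠ q in (U : Filter α), |f q| ≤ K) → ∃ c, Tendsto f U (𝓝 c) := by
      intro f hf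
      obtain ⟨c, -, hc⟩ := (isCompact_Icc (a := -K) (b := K)).ultrafilter_le_nhds (U.map f)
        (by
          rw [Ultrafilter.coe_map, le_principal_iff, mem_map]
          filter_upwards [hf] with q hq using abs_le.mp hq)
      exact ⟨c, hc⟩
    obtain ⟨a₀, ha⟩ := lim (fun q => ∑ i, x q i) ((hK.filter_mono hU).mono fun _ h => h.1)
    obtain ⟨b₀, hb⟩ := lim (fun q => ∑ i, y q i) ((hK.filter_mono hU).mono fun _ h => h.2)
    obtain ⟨h1, h2⟩ := tendsto_negTwoLog_of_tendsto_sum (hN.mono_left hU) (hx.mono_left hU)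
      (hy.mono_left hU) (hxx.mono_left hU) (hxy.mono_left hU) (hyy.mono_left hU) ha hb
    refine ⟨h1, ?_⟩
    simpa using h2.sub ((ha.pow 2).add (hb.pow 2))
  refine ⟨?_, (tendsto_iff_ultrafilter _ _ _).mpr fun U hU => (key U hU).2⟩
  exact mem_iff_ultrafilter.mpr fun U hU => (key U hU).1

end Expansion

section ProbFilter

variable {Ω : ℕ → Type*} [∀ n, MeasurableSpace (Ω n)]

/-- The filter of events whose probability tends to one; convergence along it is convergence
in probability. -/
def probFilter (P : ∀ n, Measure (Ω n)) : Filter (Σ n, Ω n) where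
  sets := {A | Tendsto (fun n => P n {ω | (⟨n, ω⟩ : Σ n, Ω n) ∉ A}) atTop (𝓝 0)}
  univ_sets := by simp
  sets_of_superset := by
    intro A B hA hAB
    exact tendsto_of_tendsto_of_tendsto_of_le_of_le tendsto_const_nhds hA (fun _ => zero_le)
      fun n => measure_mono fun ω hω hA => hω (hAB hA)
  inter_sets := by
    intro A B hA hB
    have h := Tendsto.add (show Tendsto _ _ _ from hA) (show Tendsto _ _ _ from hB)
    rw [add_zero] at h
    refine tendsto_of_tendsto_of_tendsto_of_le_of_le tendsto_const_nhds h (fun _ => zero_le)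
      fun n => (measure_mono ?_).trans (measure_union_le _ _)
    intro ω hω
    by_cases h1 : (⟨n, ω⟩ : Σ n, Ω n) ∈ A
    · exact Or.inr fun h2 => hω ⟨h1, h2⟩
    · exact Or.inl h1

variable {P : ∀ n, Measure (Ω n)}

theorem eventually_probFilter {p : (Σ n, Ω n) → Prop} :
    (∀ᶠ q in probFilter P, p q) ↔ Tendsto (fun n => P n {ω | ¬ p ⟨n, ω⟩}) atTop (𝓝 0) := Iff.rfl

theorem tendsto_fst_probFilter : Tendsto (fun q : Σ n, Ω n => q.1) (probFilter P) atTop := by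
  refine tendsto_atTop.mpr fun m => eventually_probFilter.mpr ?_
  refine tendsto_const_nhds.congr' ?_
  filter_upwards [eventually_ge_atTop m] with n hn
  simp [hn]

theorem tendsto_probFilter_zero_iff {f : ∀ n, Ω n → ℝ} :
    Tendsto (fun q : Σ n, Ω n => f q.1 q.2) (probFilter P) (𝓝 0) ↔
      ∀ ε > 0, Tendsto (fun n => P n {ω | ε ≤ |f n ω|}) atTop (𝓝 0) := by
  rw [Metric.tendsto_nhds]
  refine forall₂_congr fun ε hε => ?_
  rw [eventually_probFilter]
  simp

/-- Markov's inequality: convergence to zero in mean implies convergence in probability. -/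
theorem tendsto_probFilter_of_integral {f : ∀ n, Ω n → ℝ} (hf : ∀ᶠ n in atTop, 0 ≤ f n)
    (hi : ∀ᶠ n in atTop, Integrable (f n) (P n))
    (h : Tendsto (fun n => ∫ ω, f n ω ∂P n) atTop (𝓝 0)) :
    Tendsto (fun q : Σ n, Ω n => f q.1 q.2) (probFilter P) (𝓝 0) := by
  refine tendsto_probFilter_zero_iff.mpr fun ε hε => ?_
  have h' : Tendsto (fun n => ENNReal.ofReal ((∫ ω, f n ω ∂P n) / ε)) atTop (𝓝 0) := by
    have := ENNReal.tendsto_ofReal (h.div_const ε)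
    simpa using this
  refine tendsto_of_tendsto_of_tendsto_of_le_of_le' tendsto_const_nhds h'
    (Eventually.of_forall fun _ => zero_le) ?_
  filter_upwards [hf, hi] with n h1 h2
  have h3 : {ω | ε ≤ |f n ω|} = {ω | ENNReal.ofReal ε ≤ ENNReal.ofReal (f n ω)} := by
    ext ω
    rw [Set.mem_ofPred_eq, Set.mem_ofPred_eq, abs_of_nonneg (h1 ω),
      ENNReal.ofReal_le_ofReal_iff (h1 ω)]
  rw [h3, ENNReal.ofReal_div_of_pos hε, ofReal_integral_eq_lintegral_ofReal h2 (ae_of_all _ h1)]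
  exact meas_ge_le_lintegral_div h2.aestronglyMeasurable.aemeasurable.ennreal_ofReal
    (by simpa using hε) ENNReal.ofReal_ne_top

/-- Convergence to zero in mean square implies convergence in probability. -/
theorem tendsto_probFilter_of_integral_sq {f : ∀ n, Ω n → ℝ}
    (hi : ∀ᶠ n in atTop, MemLp (f n) 2 (P n))
    (h : Tendsto (fun n => ∫ ω, f n ω ^ 2 ∂P n) atTop (𝓝 0)) :
    Tendsto (fun q : Σ n, Ω n => f q.1 q.2) (probFilter P) (𝓝 0) := by
  have := (tendsto_probFilter_of_integral (f := fun n ω => f n ω ^ 2)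
    (Eventually.of_forall fun n ω => sq_nonneg _) (hi.mono fun n h => h.integrable_sq) h).sqrt
  rw [Real.sqrt_zero] at this
  simp_rw [Real.sqrt_sq_eq_abs] at this
  exact (tendsto_zero_iff_abs_tendsto_zero _).mpr this

/-- To show that an event has probability tending to one, it suffices to do so on the events `B K`,
which have uniformly large probability as `K` varies. -/
theorem eventually_probFilter_of_tight {B : ℝ → Set (Σ n, Ω n)}
    (hB : ∀ ε : ENNReal, 0 < ε → ∃ K : ℝ, ∀ᶠ n in atTop,
      P n {ω | (⟨n, ω⟩ : Σ n, Ω n) ∉ B K} ≤ ε) {p : (Σ n, Ω n) → Prop}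
    (hp : ∀ K : ℝ, ∀ᶠ q in probFilter P ⊓ 𝓟 (B K), p q) : ∀ᶠ q in probFilter P, p q := by
  rw [eventually_probFilter, ENNReal.tendsto_nhds_zero]
  intro ε hε
  obtain ⟨K, hK⟩ := hB (ε / 2) (ENNReal.half_pos hε.ne')
  have h1 := hp K
  rw [eventually_inf_principal, eventually_probFilter, ENNReal.tendsto_nhds_zero] at h1
  filter_upwards [hK, h1 (ε / 2) (ENNReal.half_pos hε.ne')] with n h2 h3
  refine (measure_mono ?_).trans ((measure_union_le _ _).trans
    ((add_le_add h2 h3).trans (ENNReal.add_halves ε).le))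
  intro ω hω
  by_cases hb : (⟨n, ω⟩ : Σ n, Ω n) ∈ B K
  · exact Or.inr fun h => hω (h hb)
  · exact Or.inl hb

theorem tendsto_mul_of_tight {f g : ∀ n, Ω n → ℝ}
    (hf : ∀ ε : ENNReal, 0 < ε → ∃ K : ℝ, ∀ᶠ n in atTop, P n {ω | ¬ |f n ω| ≤ K} ≤ ε)
    (hg : Tendsto (fun q : Σ n, Ω n => g q.1 q.2) (probFilter P) (𝓝 0)) :
    Tendsto (fun q : Σ n, Ω n => f q.1 q.2 * g q.1 q.2) (probFilter P) (𝓝 0) := by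
  rw [Metric.tendsto_nhds]
  intro ε hε
  refine eventually_probFilter_of_tight (B := fun K => {q | |f q.1 q.2| ≤ K}) hf fun K => ?_
  refine Metric.tendsto_nhds.mp ?_ ε hε
  refine isBoundedUnder_le_mul_tendsto_zero ⟨K, ?_⟩ (hg.mono_left inf_le_left)
  rw [eventually_map]
  exact mem_inf_of_right (mem_principal_self _)

variable [∀ n, IsProbabilityMeasure (P n)]

theorem tendstoInDistribution_iff {E Ω' : Type*} [TopologicalSpace E] [MeasurableSpace E]
    [BorelSpace E] [MeasurableSpace Ω'] {P' : Measure Ω'} [IsProbabilityMeasure P']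
    {X : ∀ n, Ω n → E} {Z : Ω' → E} (hX : ∀ n, AEMeasurable (X n) (P n)) (hZ : AEMeasurable Z P') :
    TendstoInDistribution X atTop Z P P' ↔ ∀ f : BoundedContinuousFunction E ℝ,
      Tendsto (fun n => ∫ ω, f (X n ω) ∂P n) atTop (𝓝 (∫ ω, f (Z ω) ∂P')) := by
  have hmapX : ∀ (f : BoundedContinuousFunction E ℝ) n,
      ∫ z, f z ∂(P n).map (X n) = ∫ ω, f (X n ω) ∂P n := fun f n =>
    integral_map (hX n) f.continuous.measurable.aestronglyMeasurable
  have hmapZ : ∀ f : BoundedContinuousFunction E ℝ, ∫ z, f z ∂P'.map Z = ∫ ω, f (Z ω) ∂P' :=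
    fun f => integral_map hZ f.continuous.measurable.aestronglyMeasurable
  constructor
  · intro h f
    have := ProbabilityMeasure.tendsto_iff_forall_integral_tendsto.mp h.tendsto f
    simp only [ProbabilityMeasure.coe_mk] at this
    rw [hmapZ] at this
    simpa only [hmapX] using this
  · intro h
    refine ⟨hX, hZ, ProbabilityMeasure.tendsto_iff_forall_integral_tendsto.mpr fun f => ?_⟩
    simp only [ProbabilityMeasure.coe_mk]
    rw [hmapZ]
    simpa only [hmapX] using h f

theorem tendstoInDistribution_of_measurePreserving_sub {Ω' Ωc : Type*} [MeasurableSpace Ω']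
    [MeasurableSpace Ωc] {Q : Measure Ωc} [IsProbabilityMeasure Q]
    {P' : Measure Ω'} [IsProbabilityMeasure P'] {π : ∀ n, Ωc → Ω n}
    (mp : ∀ n, MeasurePreserving (π n) Q (P n)) {X Y : ∀ n, Ω n → ℝ} {Z : Ω' → ℝ}
    (hX : TendstoInDistribution X atTop Z P P') (hY : ∀ n, AEMeasurable (Y n) (P n))
    (h : Tendsto (fun q : Σ n, Ω n => Y q.1 q.2 - X q.1 q.2) (probFilter P) (𝓝 0)) :
    TendstoInDistribution Y atTop Z P P' := by
  have hm : ∀ W : ∀ n, Ω n → ℝ, (∀ n, AEMeasurable (W n) (P n)) → ∀ n,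
      AEMeasurable (fun ω => W n (π n ω)) Q := fun W hW n =>
    (hW n).comp_quasiMeasurePreserving (mp n).quasiMeasurePreserving
  have hint : ∀ W : ∀ n, Ω n → ℝ, (∀ n, AEMeasurable (W n) (P n)) → ∀ n,
      ∀ f : BoundedContinuousFunction ℝ ℝ,
      ∫ ω, f (W n (π n ω)) ∂Q = ∫ ω, f (W n ω) ∂P n := fun W hW n f => by
    have h1 : AEStronglyMeasurable (fun ω => f (W n ω)) (P n) :=
      (f.continuous.measurable.comp_aemeasurable (hW n)).aestronglyMeasurable
    rw [← (mp n).map_eq] at h1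
    have h2 := integral_map (mp n).aemeasurable h1
    rw [(mp n).map_eq] at h2
    exact h2.symm
  have hX' := hX.forall_aemeasurable
  have hXQ : TendstoInDistribution (fun n ω => X n (π n ω)) atTop Z (fun _ => Q) P' := by
    refine (tendstoInDistribution_iff (P := fun _ => Q) (X := fun n ω => X n (π n ω)) (hm X hX')
      hX.aemeasurable_limit).mpr fun f => ?_
    exact ((tendstoInDistribution_iff hX' hX.aemeasurable_limit).mp hX f).congr
      fun n => (hint X hX' n f).symm
  have hM : TendstoInMeasure Q ((fun n ω => Y n (π n ω)) - (fun n ω => X n (π n ω))) atTop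
      (0 : Ωc → ℝ) := by
    rw [tendstoInMeasure_iff_norm]
    intro ε hε
    refine ((tendsto_probFilter_zero_iff (f := fun n ω => Y n ω - X n ω)).mp h ε hε).congr
      fun n => ?_
    have hs : NullMeasurableSet {ω | ε ≤ |Y n ω - X n ω|} (P n) :=
      nullMeasurableSet_le aemeasurable_const
        (continuous_abs.measurable.comp_aemeasurable ((hY n).sub (hX' n)))
    rw [← (mp n).measure_preimage hs]
    simp [Real.norm_eq_abs]
  have hYQ : TendstoInDistribution (fun n ω => Y n (π n ω)) atTop Z (fun _ => Q) P' :=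
    tendstoInDistribution_of_tendstoInMeasure_sub (E := ℝ) (X := fun n ω => X n (π n ω))
      (fun n ω => Y n (π n ω)) Z hXQ hM (hm Y hY)
  refine (tendstoInDistribution_iff hY hX.aemeasurable_limit).mpr fun f => ?_
  refine ((tendstoInDistribution_iff (P := fun _ => Q) (X := fun n ω => Y n (π n ω)) (hm Y hY)
    hX.aemeasurable_limit).mp hYQ f).congr fun n => ?_
  exact hint Y hY n f

/-- **Slutsky's theorem** for real random variables on varying probability spaces. -/
theorem tendstoInDistribution_of_probFilter_sub {Ω' : Type*} [MeasurableSpace Ω']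
    {P' : Measure Ω'} [IsProbabilityMeasure P'] {X Y : ∀ n, Ω n → ℝ} {Z : Ω' → ℝ}
    (hX : TendstoInDistribution X atTop Z P P') (hY : ∀ n, AEMeasurable (Y n) (P n))
    (h : Tendsto (fun q : Σ n, Ω n => Y q.1 q.2 - X q.1 q.2) (probFilter P) (𝓝 0)) :
    TendstoInDistribution Y atTop Z P P' :=
  tendstoInDistribution_of_measurePreserving_sub (measurePreserving_eval_infinitePi P) hX hY h

/-- Random variables that agree with probability tending to one have the same distributional
limit. -/
theorem tendstoInDistribution_of_eventually_eq {E : Type*} [TopologicalSpace E]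
    [MeasurableSpace E] [BorelSpace E] {Ω' : Type*} [MeasurableSpace Ω']
    {P' : Measure Ω'} [IsProbabilityMeasure P'] {X Y : ∀ n, Ω n → E} {Z : Ω' → E}
    (hX : TendstoInDistribution X atTop Z P P') (hY : ∀ n, AEMeasurable (Y n) (P n))
    (h : ∀ᶠ q in probFilter P, X q.1 q.2 = Y q.1 q.2) :
    TendstoInDistribution Y atTop Z P P' := by
  refine (tendstoInDistribution_iff hY hX.aemeasurable_limit).mpr fun f => ?_
  have h1 := (tendstoInDistribution_iff hX.forall_aemeasurable hX.aemeasurable_limit).mp hX f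
  have h0 : Tendsto (fun n => 2 * ‖f‖ * (P n).real {ω | ¬ X n ω = Y n ω}) atTop (𝓝 0) := by
    have := (ENNReal.tendsto_toReal ENNReal.zero_ne_top).comp (eventually_probFilter.mp h)
    rw [← mul_zero (2 * ‖f‖), ← ENNReal.toReal_zero]
    exact this.const_mul (2 * ‖f‖)
  have hd : ∀ n, |∫ ω, f (Y n ω) ∂P n - ∫ ω, f (X n ω) ∂P n| ≤
      2 * ‖f‖ * (P n).real {ω | ¬ X n ω = Y n ω} := by
    intro n
    have hint : ∀ W : Ω n → E, AEMeasurable W (P n) → Integrable (fun ω => f (W ω)) (P n) :=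
      fun W hW => Integrable.of_bound
        (f.continuous.measurable.comp_aemeasurable hW).aestronglyMeasurable ‖f‖
        (ae_of_all _ fun ω => f.norm_coe_le_norm _)
    rw [← integral_sub (hint _ (hY n)) (hint _ (hX.forall_aemeasurable n))]
    set B := toMeasurable (P n) {ω | ¬ X n ω = Y n ω} with hB
    have hBm : MeasurableSet B := measurableSet_toMeasurable _ _
    have hbd : ∀ ω, ‖f (Y n ω) - f (X n ω)‖ ≤ B.indicator (fun _ => 2 * ‖f‖) ω := by
      intro ω
      by_cases hω : ω ∈ B
      · rw [Set.indicator_of_mem hω, two_mul]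
        exact (norm_sub_le _ _).trans
          (add_le_add (f.norm_coe_le_norm _) (f.norm_coe_le_norm _))
      · have : X n ω = Y n ω := by
          by_contra hne
          exact hω (subset_toMeasurable _ _ hne)
        rw [Set.indicator_of_notMem hω, this, sub_self, norm_zero]
    refine (norm_integral_le_of_norm_le ((integrable_const _).indicator hBm)
      (ae_of_all _ hbd)).trans (le_of_eq ?_)
    rw [integral_indicator_const _ hBm, smul_eq_mul, mul_comm, Measure.real, hB,
      measure_toMeasurable]
    rfl
  have h2 : Tendsto (fun n => ∫ ω, f (Y n ω) ∂P n - ∫ ω, f (X n ω) ∂P n) atTop (𝓝 0) :=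
    squeeze_zero_norm hd h0
  simpa using h2.add h1

/-- If a random array satisfies the law of large numbers for its second moments, is uniformly
negligible and its sums have an asymptotic law, then its empirical likelihood ratio has the
limit law of the squared norm of the sums. -/
theorem tendstoInDistribution_negTwoLog {Ω' : Type*} [MeasurableSpace Ω']
    {P' : Measure Ω'} [IsProbabilityMeasure P'] {N : ℕ → ℕ} {Z : Ω' → ℝ}
    {x y : ∀ n, Ω n → Fin (N n) → ℝ} {R : ∀ n, Ω n → Fin (N n) → Fin 2 → ℝ} {Q : ∀ n, Ω n → ℝ}
    (hR : ∀ n, AEMeasurable (R n) (P n))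
    (hRx : ∀ᶠ n in atTop, ∀ ω, elRatio (R n ω) = elRatio (fun i => ![x n ω i, y n ω i]))
    (hN : Tendsto N atTop atTop)
    (hx : Tendsto (fun q : Σ n, Ω n => ‖x q.1 q.2‖) (probFilter P) (𝓝 0))
    (hy : Tendsto (fun q : Σ n, Ω n => ‖y q.1 q.2‖) (probFilter P) (𝓝 0))
    (hxx : Tendsto (fun q : Σ n, Ω n => ∑ i, x q.1 q.2 i ^ 2) (probFilter P) (𝓝 1))
    (hxy : Tendsto (fun q : Σ n, Ω n => ∑ i, x q.1 q.2 i * y q.1 q.2 i) (probFilter P) (𝓝 0))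
    (hyy : Tendsto (fun q : Σ n, Ω n => ∑ i, y q.1 q.2 i ^ 2) (probFilter P) (𝓝 1))
    (htight : ∀ ε : ENNReal, 0 < ε → ∃ K : ℝ, ∀ᶠ n in atTop,
      P n {ω | ¬ (|∑ i, x n ω i| ≤ K ∧ |∑ i, y n ω i| ≤ K)} ≤ ε)
    (hQ : TendstoInDistribution Q atTop Z P P')
    (hQx : Tendsto (fun q : Σ n, Ω n => Q q.1 q.2
      - ((∑ i, x q.1 q.2 i) ^ 2 + (∑ i, y q.1 q.2 i) ^ 2)) (probFilter P) (𝓝 0)) :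
    TendstoInDistribution (fun n ω => negTwoLog (elRatio (R n ω))) atTop
      (fun ω => (Z ω : EReal)) P P' := by
  have key : ∀ p : (Σ n, Ω n) → Prop,
      (∀ K : ℝ, ∀ᶠ q in probFilter P ⊓
        𝓟 {q : Σ n, Ω n | |∑ i, x q.1 q.2 i| ≤ K ∧ |∑ i, y q.1 q.2 i| ≤ K}, p q) →
      ∀ᶠ q in probFilter P, p q := fun p hp => eventually_probFilter_of_tight htight hp
  have hexp : ∀ K : ℝ, _ := fun K =>
    tendsto_negTwoLog_sub (G := probFilter P ⊓
        𝓟 {q : Σ n, Ω n | |∑ i, x q.1 q.2 i| ≤ K ∧ |∑ i, y q.1 q.2 i| ≤ K})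
      (N := fun q => N q.1) (x := fun q => x q.1 q.2) (y := fun q => y q.1 q.2)
      ((hN.comp tendsto_fst_probFilter).mono_left inf_le_left) (hx.mono_left inf_le_left)
      (hy.mono_left inf_le_left) (hxx.mono_left inf_le_left) (hxy.mono_left inf_le_left)
      (hyy.mono_left inf_le_left) (K := K) (mem_inf_of_right (mem_principal_self _))
  have hRx' : ∀ᶠ q in probFilter P,
      elRatio (R q.1 q.2) = elRatio (fun i => ![x q.1 q.2 i, y q.1 q.2 i]) :=
    (tendsto_fst_probFilter.eventually hRx).mono fun q h => h q.2
  have hpos : ∀ᶠ q in probFilter P, 0 < elRatio (R q.1 q.2) := by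
    filter_upwards [hRx', key _ fun K => (hexp K).1] with q h1 h2
    rw [h1]
    exact h2
  have hsub : Tendsto (fun q : Σ n, Ω n => -2 * Real.log (elRatio (R q.1 q.2)) - Q q.1 q.2)
      (probFilter P) (𝓝 0) := by
    have h1 : Tendsto (fun q : Σ n, Ω n =>
        -2 * Real.log (elRatio (fun i => ![x q.1 q.2 i, y q.1 q.2 i]))
          - ((∑ i, x q.1 q.2 i) ^ 2 + (∑ i, y q.1 q.2 i) ^ 2)) (probFilter P) (𝓝 0) := by
      rw [Metric.tendsto_nhds]
      exact fun ε hε => key _ fun K => (Metric.tendsto_nhds.mp (hexp K).2) ε hε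
    have h2 := h1.sub hQx
    rw [sub_zero] at h2
    refine h2.congr' ?_
    filter_upwards [hRx'] with q hq
    rw [hq]
    ring
  have hmeas : ∀ n, AEMeasurable (fun ω => elRatio (R n ω)) (P n) := fun n =>
    measurable_elRatio.comp_aemeasurable (hR n)
  have hreal := tendstoInDistribution_of_probFilter_sub
    (Y := fun n ω => -2 * Real.log (elRatio (R n ω))) hQ
    (fun n => (Real.measurable_log.comp_aemeasurable (hmeas n)).const_mul _) hsub
  refine tendstoInDistribution_of_eventually_eq
    (hreal.continuous_comp (g := fun r : ℝ => (r : EReal)) continuous_coe_real_ereal)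
    (fun n => measurable_negTwoLog.comp_aemeasurable (hmeas n)) ?_
  filter_upwards [hpos] with q hq
  exact (negTwoLog_of_pos hq).symm

end ProbFilter

section TruncSq

/-- The square of `s` where `|s|` exceeds `η`. -/
def truncSq (η s : ℝ) : ℝ := if η < |s| then s ^ 2 else 0

theorem truncSq_nonneg (η s : ℝ) : 0 ≤ truncSq η s := by
  unfold truncSq; split_ifs <;> positivity

theorem truncSq_le (η s : ℝ) : truncSq η s ≤ s ^ 2 := by
  unfold truncSq; split_ifs
  · exact le_rfl
  · positivity

theorem sq_sub_truncSq_le {η : ℝ} (s : ℝ) : s ^ 2 - truncSq η s ≤ η ^ 2 := by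
  unfold truncSq; split_ifs with h
  · rw [sub_self]; positivity
  · rw [sub_zero, ← sq_abs]
    exact pow_le_pow_left₀ (abs_nonneg s) (not_lt.mp h) 2

theorem measurable_truncSq (η : ℝ) : Measurable (truncSq η) := by
  unfold truncSq
  exact Measurable.ite (measurableSet_lt measurable_const continuous_abs.measurable)
    (by fun_prop) measurable_const

theorem truncSq_add_le (η a b : ℝ) :
    truncSq η (a + b) ≤ 4 * (truncSq (η / 2) a + truncSq (η / 2) b) := by
  have ha := truncSq_nonneg (η / 2) a
  have hb := truncSq_nonneg (η / 2) b
  by_cases h : η < |a + b|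
  · rw [truncSq, if_pos h]
    have h1 := abs_add_le a b
    rcases le_total |a| |b| with hab | hab
    · have : truncSq (η / 2) b = b ^ 2 := if_pos (by linarith)
      rw [this]
      have h2 : |a + b| ^ 2 ≤ (2 * |b|) ^ 2 :=
        pow_le_pow_left₀ (abs_nonneg _) (by linarith) 2
      rw [sq_abs, mul_pow, sq_abs] at h2
      linarith
    · have : truncSq (η / 2) a = a ^ 2 := if_pos (by linarith)
      rw [this]
      have h2 : |a + b| ^ 2 ≤ (2 * |a|) ^ 2 :=
        pow_le_pow_left₀ (abs_nonneg _) (by linarith) 2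
      rw [sq_abs, mul_pow, sq_abs] at h2
      linarith
  · rw [truncSq, if_neg h]
    positivity

theorem truncSq_le_rpow {η δ : ℝ} (hη : 0 < η) (hδ : 0 ≤ δ) (s : ℝ) :
    truncSq η s ≤ η ^ (-δ) * |s| ^ (2 + δ) := by
  unfold truncSq; split_ifs with h
  · have hs : 0 < |s| := hη.trans h
    rw [Real.rpow_add hs, Real.rpow_neg hη.le, ← sq_abs]
    have h1 : η ^ δ ≤ |s| ^ δ := Real.rpow_le_rpow hη.le h.le hδ
    have h2 : 0 < η ^ δ := Real.rpow_pos_of_pos hη δ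
    rw [Real.rpow_two, inv_mul_eq_div, le_div_iff₀ h2]
    exact mul_le_mul_of_nonneg_left h1 (sq_nonneg _)
  · exact mul_nonneg (Real.rpow_nonneg hη.le _) (Real.rpow_nonneg (abs_nonneg _) _)

end TruncSq

section Taylor

theorem norm_cexp_sub_quadratic_le {η : ℝ} (hη : 0 ≤ η) (hη1 : η ≤ 1) (x : ℝ) :
    ‖Complex.exp (x * Complex.I) - (1 + x * Complex.I - (x : ℂ) ^ 2 / 2)‖
      ≤ η * x ^ 2 + 3 * truncSq η x := by
  by_cases h : |x| ≤ 1
  · have hn : ‖(x : ℂ) * Complex.I‖ = |x| := by simp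
    have := Complex.exp_bound (x := x * Complex.I) (by rwa [hn]) (n := 3) (by norm_num)
    simp only [Finset.sum_range_succ, Finset.sum_range_zero, hn] at this
    norm_num [Nat.factorial] at this
    have h1 : ((x : ℂ) * Complex.I) ^ 2 = -(x : ℂ) ^ 2 := by
      rw [mul_pow, Complex.I_sq]; ring
    rw [h1] at this
    have h2 : |x| ^ 3 ≤ η * x ^ 2 + truncSq η x := by
      rw [pow_succ, sq_abs, truncSq]
      have h4 := sq_nonneg x
      split_ifs with h3
      · nlinarith [mul_le_mul_of_nonneg_left h h4, mul_nonneg hη h4]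
      · nlinarith [mul_le_mul_of_nonneg_left (not_lt.mp h3) h4]
    have h3 : Complex.exp (x * Complex.I) - (1 + x * Complex.I - (x : ℂ) ^ 2 / 2)
        = Complex.exp (x * Complex.I) - (1 + x * Complex.I + -(x : ℂ) ^ 2 / 2) := by ring
    rw [h3]
    have h4 := truncSq_nonneg η x
    have h5 : 0 ≤ |x| ^ 3 := by positivity
    linarith
  · have hx : 1 < |x| := not_le.mp h
    rw [truncSq, if_pos (hη1.trans_lt hx)]
    have h1 := @Real.norm_exp_I_mul_ofReal_sub_one_le x
    rw [mul_comm] at h1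
    have h3 : Complex.exp (x * Complex.I) - (1 + x * Complex.I - (x : ℂ) ^ 2 / 2)
        = (Complex.exp (x * Complex.I) - 1) + (-(x * Complex.I) + (x : ℂ) ^ 2 / 2) := by ring
    have h6 : ‖-((x : ℂ) * Complex.I)‖ = |x| := by simp
    have h7 : ‖(x : ℂ) ^ 2 / 2‖ = x ^ 2 / 2 := by simp
    rw [h3]
    refine (norm_add_le _ _).trans ?_
    have h8 := norm_add_le (-((x : ℂ) * Complex.I)) ((x : ℂ) ^ 2 / 2)
    rw [h6, h7] at h8
    rw [Real.norm_eq_abs] at h1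
    have h9 : |x| ≤ x ^ 2 := by rw [← sq_abs]; nlinarith
    have := mul_nonneg hη (sq_nonneg x)
    linarith

theorem abs_exp_neg_sub_le {u : ℝ} (hu : 0 ≤ u) : |Real.exp (-u) - (1 - u)| ≤ u ^ 2 := by
  by_cases h : u ≤ 1
  · have := Real.abs_exp_sub_one_sub_id_le (x := -u) (by rw [abs_neg, abs_of_nonneg hu]; exact h)
    rw [neg_sq] at this
    convert this using 2
    ring
  · have h1 : Real.exp (-u) ≤ 1 := Real.exp_le_one_iff.mpr (by linarith)
    have h2 := Real.add_one_le_exp (-u)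
    rw [abs_le]
    constructor <;> nlinarith

theorem norm_prod_sub_prod_le {ι : Type*} (s : Finset ι) {f g : ι → ℂ} (hf : ∀ i, ‖f i‖ ≤ 1)
    (hg : ∀ i, ‖g i‖ ≤ 1) : ‖∏ i ∈ s, f i - ∏ i ∈ s, g i‖ ≤ ∑ i ∈ s, ‖f i - g i‖ := by
  classical
  induction s using Finset.induction_on with
  | empty => simp
  | insert a s ha ih =>
    rw [Finset.prod_insert ha, Finset.prod_insert ha, Finset.sum_insert ha]
    have : f a * ∏ i ∈ s, f i - g a * ∏ i ∈ s, g i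
        = (f a - g a) * ∏ i ∈ s, f i + g a * (∏ i ∈ s, f i - ∏ i ∈ s, g i) := by ring
    rw [this]
    refine (norm_add_le _ _).trans (add_le_add ?_ ?_)
    · rw [norm_mul, norm_prod]
      exact mul_le_of_le_one_right (norm_nonneg _)
        (Finset.prod_le_one (fun i _ => norm_nonneg _) fun i _ => hf i)
    · rw [norm_mul]
      exact (mul_le_of_le_one_left (norm_nonneg _) (hg a)).trans ih

end Taylor


section Moments

variable {Ω : Type*} [MeasurableSpace Ω] {P : Measure Ω}

theorem integral_sq_sum {ι : Type*} {I : Finset ι} {h : ι → Ω → ℝ} (hh : ∀ i, MemLp (h i) 2 P) :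
    ∫ ω, (∑ i ∈ I, h i ω) ^ 2 ∂P = ∑ i ∈ I, ∑ j ∈ I, ∫ ω, h i ω * h j ω ∂P := by
  have hint : ∀ i j, Integrable (fun ω => h i ω * h j ω) P := fun i j =>
    (hh i).integrable_mul (hh j)
  simp_rw [sq, Finset.sum_mul_sum]
  rw [integral_finsetSum _ fun i _ => integrable_finsetSum _ fun j _ => hint i j]
  exact Finset.sum_congr rfl fun i _ => integral_finsetSum _ fun j _ => hint i j

theorem integral_sq_sum_of_indep {ι : Type*} [Fintype ι] {h : ι → Ω → ℝ}
    (hh : ∀ i, MemLp (h i) 2 P) (hi : Pairwise fun i j => IndepFun (h i) (h j) P)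
    (h0 : ∀ i, ∫ ω, h i ω ∂P = 0) :
    ∫ ω, (∑ i, h i ω) ^ 2 ∂P = ∑ i, ∫ ω, h i ω ^ 2 ∂P := by
  rw [integral_sq_sum hh]
  refine Finset.sum_congr rfl fun i _ => ?_
  rw [Finset.sum_eq_single i]
  · simp_rw [sq]
  · intro j _ hj
    have := (hi hj.symm).integral_mul_eq_mul_integral (hh i).aestronglyMeasurable
      (hh j).aestronglyMeasurable
    simp only [Pi.mul_apply] at this
    rw [this, h0, zero_mul]
  · simp

theorem integrable_truncSq {s : Ω → ℝ} (hs : MemLp s 2 P) (η : ℝ) :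
    Integrable (fun ω => truncSq η (s ω)) P := by
  refine hs.integrable_sq.mono
    ((measurable_truncSq η).comp_aemeasurable hs.aestronglyMeasurable.aemeasurable).aestronglyMeasurable
    (ae_of_all _ fun ω => ?_)
  rw [Real.norm_of_nonneg (truncSq_nonneg _ _), Real.norm_of_nonneg (sq_nonneg _)]
  exact truncSq_le _ _

theorem integral_cexp_sum {ι : Type*} [Fintype ι] {s : ι → Ω → ℝ}
    (hm : ∀ i, AEMeasurable (s i) P) (hi : iIndepFun s P) :
    ∫ ω, Complex.exp ((∑ i, s i ω : ℝ) * Complex.I) ∂P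
      = ∏ i, ∫ ω, Complex.exp (s i ω * Complex.I) ∂P := by
  have h := congrFun (hi.charFun_map_fun_sum_eq_prod hm) 1
  have e : ∀ t : Ω → ℝ, AEMeasurable t P →
      charFun (P.map t) 1 = ∫ ω, Complex.exp (t ω * Complex.I) ∂P := fun t ht => by
    rw [charFun_apply_real, integral_map ht (by fun_prop)]
    simp
  rw [e _ (by fun_prop), Finset.prod_apply] at h
  rw [h]
  exact Finset.prod_congr rfl fun i _ => e _ (hm i)

variable [IsProbabilityMeasure P]

theorem integral_sq_le_add_truncSq {s : Ω → ℝ} (hs : MemLp s 2 P) (η : ℝ) :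
    ∫ ω, s ω ^ 2 ∂P ≤ η ^ 2 + ∫ ω, truncSq η (s ω) ∂P := by
  have h1 : ∫ ω, s ω ^ 2 ∂P ≤ ∫ ω, (η ^ 2 + truncSq η (s ω)) ∂P :=
    integral_mono hs.integrable_sq ((integrable_const _).add (integrable_truncSq hs η)) fun ω => by
      have := sq_sub_truncSq_le (η := η) (s ω); simp only; linarith
  rwa [integral_add (integrable_const _) (integrable_truncSq hs η), integral_const, probReal_univ,
    one_smul] at h1

theorem norm_integral_cexp_sub_le {s : Ω → ℝ} (hs : MemLp s 2 P) (h0 : ∫ ω, s ω ∂P = 0)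
    {η : ℝ} (hη : 0 ≤ η) (hη1 : η ≤ 1) :
    ‖∫ ω, Complex.exp (s ω * Complex.I) ∂P - ((1 - (∫ ω, s ω ^ 2 ∂P) / 2 : ℝ) : ℂ)‖
      ≤ η * ∫ ω, s ω ^ 2 ∂P + 3 * ∫ ω, truncSq η (s ω) ∂P := by
  have hm : AEMeasurable s P := hs.aestronglyMeasurable.aemeasurable
  have hs1 : Integrable s P := hs.integrable (by norm_num)
  have i1 : Integrable (fun ω => Complex.exp (s ω * Complex.I)) P :=
    Integrable.of_bound (by fun_prop) 1 (ae_of_all _ fun ω => by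
      rw [Complex.norm_exp_ofReal_mul_I])
  have i2 : Integrable (fun ω => (s ω : ℂ) * Complex.I) P := hs1.ofReal.mul_const _
  have i3 : Integrable (fun ω => (s ω : ℂ) ^ 2 / 2) P := by
    have := (hs.integrable_sq.ofReal (𝕜 := ℂ)).div_const 2
    simpa using this
  have i4 : Integrable (fun ω => (1 : ℂ) + s ω * Complex.I) P := (integrable_const _).add i2
  have e1 : ∫ ω, ((1 : ℂ) + s ω * Complex.I - (s ω : ℂ) ^ 2 / 2) ∂P
      = ((1 - (∫ ω, s ω ^ 2 ∂P) / 2 : ℝ) : ℂ) := by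
    rw [integral_sub i4 i3, integral_add (integrable_const _) i2, integral_mul_const,
      integral_complex_ofReal, h0, integral_div]
    have : ∫ ω, (s ω : ℂ) ^ 2 ∂P = ((∫ ω, s ω ^ 2 ∂P : ℝ) : ℂ) := by
      rw [← integral_complex_ofReal]
      simp
    rw [this]
    simp
  have i5 : Integrable (fun ω => (1 : ℂ) + s ω * Complex.I - (s ω : ℂ) ^ 2 / 2) P := i4.sub i3
  rw [← e1, ← integral_sub i1 i5]
  refine (norm_integral_le_integral_norm _).trans ?_
  rw [← integral_const_mul, ← integral_const_mul, ← integral_add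
    (hs.integrable_sq.const_mul _) ((integrable_truncSq hs η).const_mul _)]
  exact integral_mono (i1.sub i5).norm
    ((hs.integrable_sq.const_mul _).add ((integrable_truncSq hs η).const_mul _))
    fun ω => norm_cexp_sub_quadratic_le hη hη1 (s ω)

theorem norm_integral_cexp_le_one (s : Ω → ℝ) :
    ‖∫ ω, Complex.exp (s ω * Complex.I) ∂P‖ ≤ 1 := by
  refine (norm_integral_le_integral_norm _).trans ?_
  simp [Complex.norm_exp_ofReal_mul_I]

/-- Quantitative Lindeberg estimate for the characteristic function of a sum of independent
centred variables. -/
theorem norm_integral_cexp_sum_sub_le {ι : Type*} [Fintype ι] {s : ι → Ω → ℝ}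
    (hs : ∀ i, MemLp (s i) 2 P) (hi : iIndepFun s P) (h0 : ∀ i, ∫ ω, s i ω ∂P = 0)
    {η : ℝ} (hη : 0 ≤ η) (hη1 : η ≤ 1) :
    ‖∫ ω, Complex.exp ((∑ i, s i ω : ℝ) * Complex.I) ∂P
        - (Real.exp (-(∑ i, ∫ ω, s i ω ^ 2 ∂P) / 2) : ℂ)‖
      ≤ η * (∑ i, ∫ ω, s i ω ^ 2 ∂P) + 3 * ∑ i, ∫ ω, truncSq η (s i ω) ∂P
        + (η ^ 2 + ∑ i, ∫ ω, truncSq η (s i ω) ∂P) * ∑ i, ∫ ω, s i ω ^ 2 ∂P := by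
  set σ : ι → ℝ := fun i => ∫ ω, s i ω ^ 2 ∂P with hσ
  set T : ι → ℝ := fun i => ∫ ω, truncSq η (s i ω) ∂P with hT
  have hσ0 : ∀ i, 0 ≤ σ i := fun i => integral_nonneg fun ω => sq_nonneg _
  have hT0 : ∀ i, 0 ≤ T i := fun i => integral_nonneg fun ω => truncSq_nonneg _ _
  have hσT : ∀ i, σ i ≤ η ^ 2 + ∑ j, T j := fun i =>
    (integral_sq_le_add_truncSq (hs i) η).trans
      (add_le_add le_rfl (Finset.single_le_sum (fun j _ => hT0 j) (Finset.mem_univ i)))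
  rw [integral_cexp_sum (fun i => (hs i).aestronglyMeasurable.aemeasurable) hi]
  have e1 : ((Real.exp (-(∑ i, σ i) / 2) : ℝ) : ℂ) = ∏ i, ((Real.exp (-(σ i / 2)) : ℝ) : ℂ) := by
    rw [← Complex.ofReal_prod, ← Real.exp_sum, Finset.sum_neg_distrib, ← Finset.sum_div, neg_div]
  rw [e1]
  refine (norm_prod_sub_prod_le _ (fun i => norm_integral_cexp_le_one _) fun i => ?_).trans ?_
  · rw [Complex.norm_real, Real.norm_of_nonneg (Real.exp_nonneg _)]
    exact Real.exp_le_one_iff.mpr (by have := hσ0 i; linarith)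
  · rw [Finset.mul_sum, Finset.mul_sum, Finset.mul_sum, ← Finset.sum_add_distrib,
      ← Finset.sum_add_distrib]
    refine Finset.sum_le_sum fun i _ => ?_
    have h1 := norm_integral_cexp_sub_le (hs i) (h0 i) hη hη1
    have h2 := abs_exp_neg_sub_le (u := σ i / 2) (by have := hσ0 i; linarith)
    have h3 : ‖((1 - σ i / 2 : ℝ) : ℂ) - ((Real.exp (-(σ i / 2)) : ℝ) : ℂ)‖ ≤ (σ i / 2) ^ 2 := by
      rw [← Complex.ofReal_sub, Complex.norm_real, Real.norm_eq_abs, abs_sub_comm]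
      exact h2
    have h4 : (σ i / 2) ^ 2 ≤ (η ^ 2 + ∑ j, T j) * σ i := by
      have := mul_le_mul_of_nonneg_right (hσT i) (hσ0 i)
      nlinarith [sq_nonneg (σ i)]
    have h5 := norm_sub_le_norm_sub_add_norm_sub (∫ ω, Complex.exp (s i ω * Complex.I) ∂P)
      ((1 - σ i / 2 : ℝ) : ℂ) ((Real.exp (-(σ i / 2)) : ℝ) : ℂ)
    linarith

/-- Quantitative law of large numbers for the squares of independent variables. -/
theorem integral_abs_sum_sq_sub_le {ι : Type*} [Fintype ι] {s : ι → Ω → ℝ}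
    (hs : ∀ i, MemLp (s i) 2 P) (hi : iIndepFun s P) {η : ℝ} (hη : 0 < η) :
    ∫ ω, |∑ i, s i ω ^ 2 - ∑ i, ∫ ω, s i ω ^ 2 ∂P| ∂P
      ≤ η * (1 + ∑ i, ∫ ω, s i ω ^ 2 ∂P) + 2 * ∑ i, ∫ ω, truncSq η (s i ω) ∂P := by
  have hm : ∀ i, AEMeasurable (s i) P := fun i => (hs i).aestronglyMeasurable.aemeasurable
  have hmeas : Measurable fun r : ℝ => r ^ 2 - truncSq η r :=
    (measurable_id.pow_const 2).sub (measurable_truncSq η)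
  have hb : ∀ i ω, |s i ω ^ 2 - truncSq η (s i ω)| ≤ η ^ 2 := fun i ω => by
    rw [abs_of_nonneg (sub_nonneg.mpr (truncSq_le _ _))]
    exact sq_sub_truncSq_le _
  set m : ι → ℝ := fun i => ∫ ω, (s i ω ^ 2 - truncSq η (s i ω)) ∂P with hmdef
  have hi2 : ∀ i, Integrable (fun ω => s i ω ^ 2) P := fun i => (hs i).integrable_sq
  have hiT : ∀ i, Integrable (fun ω => truncSq η (s i ω)) P := fun i => integrable_truncSq (hs i) η
  have hm' : ∀ i, m i = ∫ ω, s i ω ^ 2 ∂P - ∫ ω, truncSq η (s i ω) ∂P := fun i =>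
    integral_sub (hi2 i) (hiT i)
  set ζ : ι → Ω → ℝ := fun i ω => (s i ω ^ 2 - truncSq η (s i ω)) - m i with hζ
  have hζm : ∀ i, MemLp (fun ω => s i ω ^ 2 - truncSq η (s i ω)) 2 P := fun i =>
    MemLp.of_bound (hmeas.comp_aemeasurable (hm i)).aestronglyMeasurable (η ^ 2)
      (ae_of_all _ fun ω => hb i ω)
  have hζ2 : ∀ i, MemLp (ζ i) 2 P := fun i => (hζm i).sub (memLp_const _)
  have hζ0 : ∀ i, ∫ ω, ζ i ω ∂P = 0 := fun i => by
    simp only [hζ]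
    rw [integral_sub ((hζm i).integrable (by norm_num)) (integrable_const _)]
    simp [hmdef]
  have hζi : Pairwise fun i j => IndepFun (ζ i) (ζ j) P := fun i j hij =>
    (hi.indepFun hij).comp (φ := fun r => (r ^ 2 - truncSq η r) - m i)
      (ψ := fun r => (r ^ 2 - truncSq η r) - m j) (hmeas.sub_const _) (hmeas.sub_const _)
  have hvar : ∫ ω, (∑ i, ζ i ω) ^ 2 ∂P ≤ η ^ 2 * ∑ i, ∫ ω, s i ω ^ 2 ∂P := by
    rw [integral_sq_sum_of_indep hζ2 hζi hζ0, Finset.mul_sum]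
    refine Finset.sum_le_sum fun i _ => ?_
    have h1 : ∫ ω, ζ i ω ^ 2 ∂P = Var[fun ω => s i ω ^ 2 - truncSq η (s i ω); P] :=
      (variance_eq_integral (hζm i).aestronglyMeasurable.aemeasurable).symm
    rw [h1]
    refine (variance_le_expectation_sq (hζm i).aestronglyMeasurable).trans ?_
    rw [← integral_const_mul]
    refine integral_mono (hζm i).integrable_sq ((hi2 i).const_mul _) fun ω => ?_
    have h2 := hb i ω
    have h3 := truncSq_le η (s i ω)
    have h4 := truncSq_nonneg η (s i ω)
    simp only [Pi.pow_apply]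
    rw [abs_of_nonneg (sub_nonneg.mpr h3)] at h2
    nlinarith [sub_nonneg.mpr h3]
  have hζs : MemLp (fun ω => ∑ i, ζ i ω) 2 P := memLp_finsetSum _ fun i _ => hζ2 i
  have hpt : ∀ ω, |∑ i, s i ω ^ 2 - ∑ i, ∫ ω, s i ω ^ 2 ∂P|
      ≤ (η + η⁻¹ * (∑ i, ζ i ω) ^ 2) + (∑ i, truncSq η (s i ω)
        + ∑ i, ∫ ω, truncSq η (s i ω) ∂P) := by
    intro ω
    have h1 : ∑ i, s i ω ^ 2 - ∑ i, ∫ ω, s i ω ^ 2 ∂P = ∑ i, ζ i ω + (∑ i, truncSq η (s i ω)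
        - ∑ i, ∫ ω, truncSq η (s i ω) ∂P) := by
      simp only [hζ, hm', Finset.sum_sub_distrib]
      ring
    have h2 : |∑ i, ζ i ω| ≤ η + η⁻¹ * (∑ i, ζ i ω) ^ 2 := by
      rw [← sq_abs, inv_mul_eq_div, ← sub_le_iff_le_add', le_div_iff₀ hη]
      nlinarith [sq_nonneg (|∑ i, ζ i ω| - η), abs_nonneg (∑ i, ζ i ω)]
    have h3 : 0 ≤ ∑ i, truncSq η (s i ω) := Finset.sum_nonneg fun i _ => truncSq_nonneg _ _
    have h4 : 0 ≤ ∑ i, ∫ ω, truncSq η (s i ω) ∂P :=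
      Finset.sum_nonneg fun i _ => integral_nonneg fun ω => truncSq_nonneg _ _
    rw [h1]
    refine (abs_add_le _ _).trans (add_le_add h2 ((abs_sub _ _).trans (le_of_eq ?_)))
    rw [abs_of_nonneg h3, abs_of_nonneg h4]
  have iT : Integrable (fun ω => ∑ i, truncSq η (s i ω)) P := integrable_finsetSum _ fun i _ => hiT i
  have i1 : Integrable (fun ω => η + η⁻¹ * (∑ i, ζ i ω) ^ 2) P :=
    (integrable_const _).add (hζs.integrable_sq.const_mul _)
  have i2 : Integrable (fun ω => ∑ i, truncSq η (s i ω) + ∑ i, ∫ ω, truncSq η (s i ω) ∂P) P :=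
    iT.add (integrable_const _)
  refine (integral_mono_of_nonneg (ae_of_all _ fun ω => abs_nonneg _) (i1.add i2)
    (ae_of_all _ hpt)).trans ?_
  simp only [Pi.add_apply]
  rw [integral_add i1 i2, integral_add (integrable_const _) (hζs.integrable_sq.const_mul _),
    integral_add iT (integrable_const _), integral_const_mul, integral_finsetSum _ fun i _ => hiT i]
  simp only [integral_const, probReal_univ, one_smul]
  have := mul_le_mul_of_nonneg_left hvar (inv_nonneg.mpr hη.le)
  have h5 : η⁻¹ * (η ^ 2 * ∑ i, ∫ ω, s i ω ^ 2 ∂P) = η * ∑ i, ∫ ω, s i ω ^ 2 ∂P := by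
    field_simp
  linarith

end Moments

section Arrays

variable {Ω : ℕ → Type*} [∀ n, MeasurableSpace (Ω n)]

/-- A triangular array of row-wise independent centred variables satisfying Lindeberg's condition,
with asymptotic row variance `v`. -/
structure LindebergArray (P : ∀ n, Measure (Ω n)) {N : ℕ → ℕ} (s : ∀ n, Fin (N n) → Ω n → ℝ)
    (v : ℝ) : Prop where
  memLp : ∀ᶠ n in atTop, ∀ i, MemLp (s n i) 2 (P n)
  indep : ∀ᶠ n in atTop, iIndepFun (s n) (P n)
  mean : ∀ᶠ n in atTop, ∀ i, ∫ ω, s n i ω ∂P n = 0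
  var : Tendsto (fun n => ∑ i, ∫ ω, s n i ω ^ 2 ∂P n) atTop (𝓝 v)
  lindeberg : ∀ η > 0, Tendsto (fun n => ∑ i, ∫ ω, truncSq η (s n i ω) ∂P n) atTop (𝓝 0)

variable {P : ∀ n, Measure (Ω n)} {N : ℕ → ℕ} {s : ∀ n, Fin (N n) → Ω n → ℝ} {v : ℝ}

theorem tendsto_zero_of_forall_le {α : Type*} {l : Filter α} {f : α → ℝ} (h0 : ∀ a, 0 ≤ f a)
    {c : ℝ → ℝ} (hc : Tendsto c (𝓝[>] 0) (𝓝 0))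
    (h : ∀ η > 0, η ≤ 1 → ∃ g : α → ℝ, Tendsto g l (𝓝 (c η)) ∧ ∀ᶠ a in l, f a ≤ g a) :
    Tendsto f l (𝓝 0) := by
  refine tendsto_order.mpr ⟨fun a ha => Eventually.of_forall fun x => ha.trans_le (h0 x),
    fun ε hε => ?_⟩
  have h1 : ∀ᶠ η in 𝓝[>] (0 : ℝ), c η < ε := hc.eventually_lt_const hε
  have h2 : ∀ᶠ η in 𝓝[>] (0 : ℝ), η ∈ Set.Ioc (0 : ℝ) 1 := Ioc_mem_nhdsGT zero_lt_one
  obtain ⟨η, h3, h4⟩ := (h1.and h2).exists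
  obtain ⟨g, hg, hfg⟩ := h η h4.1 h4.2
  filter_upwards [hg.eventually_lt_const h3, hfg] with a h5 h6 using h6.trans_lt h5

theorem LindebergArray.integrable_sum_truncSq (h : LindebergArray P s v) (η : ℝ) :
    ∀ᶠ n in atTop, Integrable (fun ω => ∑ i, truncSq η (s n i ω)) (P n) := by
  filter_upwards [h.memLp] with n hn
  exact integrable_finsetSum _ fun i _ => integrable_truncSq (hn i) η

theorem LindebergArray.tendsto_sum_truncSq (h : LindebergArray P s v) {η : ℝ} (hη : 0 < η) :
    Tendsto (fun q : Σ n, Ω n => ∑ i, truncSq η (s q.1 i q.2)) (probFilter P) (𝓝 0) := by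
  refine tendsto_probFilter_of_integral (f := fun n ω => ∑ i, truncSq η (s n i ω))
    (Eventually.of_forall fun n ω => Finset.sum_nonneg fun i _ => truncSq_nonneg _ _)
    (h.integrable_sum_truncSq η) ((h.lindeberg η hη).congr' ?_)
  filter_upwards [h.memLp] with n hn
  exact (integral_finsetSum _ fun i _ => integrable_truncSq (hn i) η).symm

theorem LindebergArray.tendsto_norm (h : LindebergArray P s v) :
    Tendsto (fun q : Σ n, Ω n => ‖fun i => s q.1 i q.2‖) (probFilter P) (𝓝 0) := by
  refine tendsto_order.mpr ⟨fun a ha => Eventually.of_forall fun x => ha.trans_le (norm_nonneg _),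
    fun ε hε => ?_⟩
  filter_upwards [(h.tendsto_sum_truncSq (half_pos hε)).eventually_lt_const (sq_pos_of_pos hε)]
    with q hq
  refine (pi_norm_lt_iff hε).mpr fun i => ?_
  have h1 := (Finset.single_le_sum (f := fun i => truncSq (ε / 2) (s q.1 i q.2))
    (fun j _ => truncSq_nonneg _ _) (Finset.mem_univ i)).trans_lt hq
  rw [Real.norm_eq_abs]
  by_contra hc
  rw [not_lt] at hc
  simp only [truncSq] at h1
  rw [if_pos (by linarith), ← sq_abs] at h1
  have := pow_le_pow_left₀ hε.le hc 2
  linarith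

theorem LindebergArray.nonneg (h : LindebergArray P s v) : 0 ≤ v :=
  ge_of_tendsto' h.var fun _ => Finset.sum_nonneg fun _ _ => integral_nonneg fun _ => sq_nonneg _

theorem LindebergArray.integral_sum_sq (h : LindebergArray P s v) :
    ∀ᶠ n in atTop, ∫ ω, (∑ i, s n i ω) ^ 2 ∂P n = ∑ i, ∫ ω, s n i ω ^ 2 ∂P n := by
  filter_upwards [h.memLp, h.indep, h.mean] with n h1 h2 h3
  exact integral_sq_sum_of_indep h1 (fun i j hij => h2.indepFun hij) h3

/-- The row sums of a Lindeberg array are tight. -/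
theorem LindebergArray.tight (h : LindebergArray P s v) {ε : ENNReal} (hε : 0 < ε) :
    ∃ K : ℝ, ∀ᶠ n in atTop, P n {ω | ¬ |∑ i, s n i ω| ≤ K} ≤ ε := by
  have hv := h.nonneg
  obtain ⟨k, hk⟩ : ∃ k : ℝ, 0 < k ∧ ENNReal.ofReal ((v + 1) / k ^ 2) ≤ ε := by
    have h1 : Tendsto (fun k : ℝ => ENNReal.ofReal ((v + 1) / k ^ 2)) atTop (𝓝 0) := by
      rw [← ENNReal.ofReal_zero]
      exact (ENNReal.continuous_ofReal.tendsto _).comp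
        (tendsto_const_nhds.div_atTop (tendsto_pow_atTop two_ne_zero))
    exact ((eventually_gt_atTop 0).and (h1.eventually_le_const hε)).exists
  refine ⟨k, ?_⟩
  filter_upwards [h.memLp, h.integral_sum_sq, h.var.eventually_le_const (lt_add_one v)]
    with n h1 h2 h3
  have hs : MemLp (fun ω => ∑ i, s n i ω) 2 (P n) := memLp_finsetSum _ fun i _ => h1 i
  have h4 : ENNReal.ofReal (k ^ 2) ≠ 0 := by
    simpa using hk.1.ne'
  have h5 := meas_ge_le_lintegral_div
    (hs.integrable_sq.aestronglyMeasurable.aemeasurable.ennreal_ofReal) h4 ENNReal.ofReal_ne_top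
  rw [← ofReal_integral_eq_lintegral_ofReal hs.integrable_sq (ae_of_all _ fun ω => sq_nonneg _), h2,
    ← ENNReal.ofReal_div_of_pos (pow_pos hk.1 2)] at h5
  refine (measure_mono ?_).trans (h5.trans ((ENNReal.ofReal_le_ofReal ?_).trans hk.2))
  · intro ω hω
    rw [Set.mem_ofPred_eq, not_le] at hω
    refine ENNReal.ofReal_le_ofReal ?_
    rw [← sq_abs (∑ i, s n i ω)]
    exact pow_le_pow_left₀ hk.1.le hω.le 2
  · exact div_le_div_of_nonneg_right h3 (sq_nonneg _)

variable [∀ n, IsProbabilityMeasure (P n)]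

/-- **Lindeberg's central limit theorem**, in terms of characteristic functions. -/
theorem LindebergArray.tendsto_integral_cexp (h : LindebergArray P s v) :
    Tendsto (fun n => ∫ ω, Complex.exp ((∑ i, s n i ω : ℝ) * Complex.I) ∂P n) atTop
      (𝓝 (Real.exp (-v / 2) : ℂ)) := by
  have h1 : Tendsto (fun n => (Real.exp (-(∑ i, ∫ ω, s n i ω ^ 2 ∂P n) / 2) : ℂ)) atTop
      (𝓝 (Real.exp (-v / 2) : ℂ)) :=
    (Complex.continuous_ofReal.tendsto _).comp
      ((Real.continuous_exp.tendsto _).comp (h.var.neg.div_const 2))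
  have h2 : Tendsto (fun n => ‖∫ ω, Complex.exp ((∑ i, s n i ω : ℝ) * Complex.I) ∂P n
      - (Real.exp (-(∑ i, ∫ ω, s n i ω ^ 2 ∂P n) / 2) : ℂ)‖) atTop (𝓝 0) := by
    refine tendsto_zero_of_forall_le (fun _ => norm_nonneg _) (c := fun η => η * v + η ^ 2 * v)
      ?_ fun η hη hη1 => ⟨fun n => η * (∑ i, ∫ ω, s n i ω ^ 2 ∂P n) + 3 * ∑ i, ∫ ω, truncSq η (s n i ω) ∂P n
        + (η ^ 2 + ∑ i, ∫ ω, truncSq η (s n i ω) ∂P n) * ∑ i, ∫ ω, s n i ω ^ 2 ∂P n, ?_, ?_⟩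
    · have : Continuous fun η : ℝ => η * v + η ^ 2 * v := by fun_prop
      have := this.tendsto 0
      simp only [ne_eq, OfNat.ofNat_ne_zero, not_false_eq_true, zero_pow, zero_mul, add_zero] at this
      exact this.mono_left nhdsWithin_le_nhds
    · have hl := h.lindeberg η hη
      have := ((h.var.const_mul η).add (hl.const_mul 3)).add ((hl.const_add (η ^ 2)).mul h.var)
      simpa using this
    · filter_upwards [h.memLp, h.indep, h.mean] with n h3 h4 h5
      exact norm_integral_cexp_sum_sub_le h3 h4 h5 hη.le hη1
  have h3 := (tendsto_zero_iff_norm_tendsto_zero.mpr h2).add h1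
  simpa using h3

/-- Law of large numbers for the squares of a Lindeberg array. -/
theorem LindebergArray.tendsto_sum_sq (h : LindebergArray P s v) :
    Tendsto (fun q : Σ n, Ω n => ∑ i, s q.1 i q.2 ^ 2) (probFilter P) (𝓝 v) := by
  have h2 : Tendsto (fun n => ∫ ω, |∑ i, s n i ω ^ 2 - ∑ i, ∫ ω, s n i ω ^ 2 ∂P n| ∂P n) atTop
      (𝓝 0) := by
    refine tendsto_zero_of_forall_le (fun _ => integral_nonneg fun _ => abs_nonneg _)
      (c := fun η => η * (1 + v)) ?_ fun η hη _ =>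
      ⟨fun n => η * (1 + ∑ i, ∫ ω, s n i ω ^ 2 ∂P n)
        + 2 * ∑ i, ∫ ω, truncSq η (s n i ω) ∂P n, ?_, ?_⟩
    · have : Continuous fun η : ℝ => η * (1 + v) := by fun_prop
      have := this.tendsto 0
      simp only [zero_mul] at this
      exact this.mono_left nhdsWithin_le_nhds
    · have := ((h.var.const_add 1).const_mul η).add ((h.lindeberg η hη).const_mul 2)
      simpa using this
    · filter_upwards [h.memLp, h.indep] with n h3 h4
      exact integral_abs_sum_sq_sub_le h3 h4 hη
  have h3 := tendsto_probFilter_of_integral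
    (f := fun n ω => |∑ i, s n i ω ^ 2 - ∑ i, ∫ ω, s n i ω ^ 2 ∂P n|)
    (Eventually.of_forall fun n ω => abs_nonneg _) (by
      filter_upwards [h.memLp] with n hn
      exact ((integrable_finsetSum _ fun i _ => (hn i).integrable_sq).sub
        (integrable_const _)).abs) h2
  have h4 := ((tendsto_zero_iff_abs_tendsto_zero _).mpr h3).add (h.var.comp tendsto_fst_probFilter)
  simpa using h4

end Arrays

section ChiSquare

variable {Ω : ℕ → Type*} [∀ n, MeasurableSpace (Ω n)] {P : ∀ n, Measure (Ω n)}
  [∀ n, IsProbabilityMeasure (P n)]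

/-- If the joint characteristic functions of `(a, b)` converge to that of a standard normal
vector, then `a² + b²` is asymptotically chi-square with two degrees of freedom. -/
theorem tendstoInDistribution_sq_add_sq {a b : ∀ n, Ω n → ℝ} (ha : ∀ n, AEMeasurable (a n) (P n))
    (hb : ∀ n, AEMeasurable (b n) (P n))
    (h : ∀ t₀ t₁ : ℝ, Tendsto
      (fun n => ∫ ω, Complex.exp ((t₀ * a n ω + t₁ * b n ω : ℝ) * Complex.I) ∂P n) atTop
      (𝓝 (Real.exp (-(t₀ ^ 2 + t₁ ^ 2) / 2) : ℂ))) :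
    TendstoInDistribution (fun n ω => a n ω ^ 2 + b n ω ^ 2) atTop (fun r : ℝ => r) P
      (chiSquare 2) := by
  let V : ∀ n, Ω n → EuclideanSpace ℝ (Fin 2) := fun n ω => WithLp.toLp 2 ![a n ω, b n ω]
  have hV : ∀ n, AEMeasurable (V n) (P n) := fun n => by
    refine (PiLp.continuous_toLp 2 _).measurable.comp_aemeasurable (aemeasurable_pi_lambda _ ?_)
    rw [Fin.forall_fin_two]
    exact ⟨ha n, hb n⟩
  let g : EuclideanSpace ℝ (Fin 2) → ℝ := fun z => ∑ i, z i ^ 2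
  have hg : Continuous g := by fun_prop
  have hL : Measurable (WithLp.toLp 2 : (Fin 2 → ℝ) → EuclideanSpace ℝ (Fin 2)) :=
    (PiLp.continuous_toLp 2 _).measurable
  have hconv : TendstoInDistribution V atTop (WithLp.toLp 2) P
      (Measure.pi (fun _ : Fin 2 => gaussianReal 0 1)) := by
    refine ⟨hV, hL.aemeasurable, ProbabilityMeasure.tendsto_of_tendsto_charFun fun t => ?_⟩
    simp only [ProbabilityMeasure.coe_mk]
    rw [charFun_pi]
    convert h (t 0) (t 1) using 2 with n
    · rw [charFun_apply, integral_map (hV n) (by fun_prop)]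
      refine integral_congr_ae (ae_of_all _ fun ω => ?_)
      simp only [V, PiLp.inner_apply, Fin.sum_univ_two]
      simp [mul_comm]
    · simp only [charFun_gaussianReal, Fin.prod_univ_two]
      rw [← Complex.exp_add, Complex.ofReal_exp]
      congr 1
      push_cast
      ring
  have h2 := hconv.continuous_comp hg
  refine (tendstoInDistribution_iff (X := fun n ω => a n ω ^ 2 + b n ω ^ 2)
    (fun n => ((ha n).pow_const 2).add ((hb n).pow_const 2)) aemeasurable_id').mpr fun f => ?_
  have h3 := (tendstoInDistribution_iff h2.forall_aemeasurable h2.aemeasurable_limit).mp h2 f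
  have h4 : ∫ r, f r ∂chiSquare 2 = ∫ z, f ((g ∘ WithLp.toLp 2) z)
      ∂Measure.pi (fun _ : Fin 2 => gaussianReal 0 1) := by
    rw [chiSquare, integral_map (Finset.measurable_fun_sum _ fun i _ =>
      (measurable_pi_apply i).pow_const 2).aemeasurable f.continuous.measurable.aestronglyMeasurable]
    rfl
  rw [h4]
  refine h3.congr fun n => ?_
  simp [g, V, Fin.sum_univ_two]

end ChiSquare

section Limit

theorem tendsto_sum_mul_of_sq {α : Type*} {G : Filter α} {N : α → ℕ} {f g : ∀ q, Fin (N q) → ℝ}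
    {c : ℝ} (hf : Tendsto (fun q => ∑ i, f q i ^ 2) G (𝓝 c))
    (hg : Tendsto (fun q => ∑ i, g q i ^ 2) G (𝓝 0)) :
    Tendsto (fun q => ∑ i, f q i * g q i) G (𝓝 0) := by
  have h := (hf.mul hg).sqrt
  rw [mul_zero, Real.sqrt_zero] at h
  refine squeeze_zero_norm (fun q => ?_) h
  exact Real.abs_le_sqrt (Finset.sum_mul_sq_le_sq_mul_sq _ _ _)

theorem tendsto_norm_of_sum_sq {α : Type*} {G : Filter α} {N : α → ℕ} {f : ∀ q, Fin (N q) → ℝ}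
    (hf : Tendsto (fun q => ∑ i, f q i ^ 2) G (𝓝 0)) : Tendsto (fun q => ‖f q‖) G (𝓝 0) := by
  have h := hf.sqrt
  rw [Real.sqrt_zero] at h
  refine squeeze_zero (fun q => norm_nonneg _) (fun q => ?_) h
  refine (pi_norm_le_iff_of_nonneg (Real.sqrt_nonneg _)).mpr fun i => Real.abs_le_sqrt ?_
  exact Finset.single_le_sum (f := fun i => f q i ^ 2) (fun j _ => sq_nonneg _) (Finset.mem_univ i)

variable {Ω : ℕ → Type*} [∀ n, MeasurableSpace (Ω n)] {P : ∀ n, Measure (Ω n)}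
  {N : ℕ → ℕ}

theorem tight_of_tendsto_sub {f g : ∀ n, Ω n → ℝ}
    (hf : ∀ ε : ENNReal, 0 < ε → ∃ K : ℝ, ∀ᶠ n in atTop, P n {ω | ¬ |f n ω| ≤ K} ≤ ε)
    (hg : Tendsto (fun q : Σ n, Ω n => g q.1 q.2 - f q.1 q.2) (probFilter P) (𝓝 0)) :
    ∀ ε : ENNReal, 0 < ε → ∃ K : ℝ, ∀ᶠ n in atTop, P n {ω | ¬ |g n ω| ≤ K} ≤ ε := by
  intro ε hε
  obtain ⟨K, hK⟩ := hf (ε / 2) (ENNReal.half_pos hε.ne')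
  refine ⟨K + 1, ?_⟩
  have h1 := (tendsto_probFilter_zero_iff (f := fun n ω => g n ω - f n ω)).mp hg 1 one_pos
  rw [ENNReal.tendsto_nhds_zero] at h1
  filter_upwards [hK, h1 (ε / 2) (ENNReal.half_pos hε.ne')] with n h2 h3
  refine (measure_mono ?_).trans ((measure_union_le _ _).trans
    ((add_le_add h2 h3).trans (ENNReal.add_halves ε).le))
  intro ω hω
  by_cases hb : |f n ω| ≤ K
  · refine Or.inr ?_
    rw [Set.mem_ofPred_eq] at hω ⊢
    by_contra hc
    have := abs_sub_abs_le_abs_sub (g n ω) (f n ω)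
    exact hω (by linarith)
  · exact Or.inl hb

/-- Limit law of the empirical likelihood ratio of an array that is an asymptotically negligible
perturbation of a bivariate Lindeberg array with asymptotic covariance the identity. -/
theorem tendstoInDistribution_negTwoLog_chiSquare [∀ n, IsProbabilityMeasure (P n)]
    {x y x' y' : ∀ n, Fin (N n) → Ω n → ℝ}
    {R : ∀ n, Ω n → Fin (N n) → Fin 2 → ℝ} (hN : Tendsto N atTop atTop)
    (hxm : ∀ n i, AEMeasurable (x n i) (P n)) (hym : ∀ n i, AEMeasurable (y n i) (P n))
    (hxy : ∀ t₀ t₁ : ℝ,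
      LindebergArray P (fun n i ω => t₀ * x n i ω + t₁ * y n i ω) (t₀ ^ 2 + t₁ ^ 2))
    (hx1 : Tendsto (fun q : Σ n, Ω n => ∑ i, x' q.1 i q.2 - ∑ i, x q.1 i q.2) (probFilter P) (𝓝 0))
    (hy1 : Tendsto (fun q : Σ n, Ω n => ∑ i, y' q.1 i q.2 - ∑ i, y q.1 i q.2) (probFilter P) (𝓝 0))
    (hx2 : Tendsto (fun q : Σ n, Ω n => ∑ i, (x' q.1 i q.2 - x q.1 i q.2) ^ 2)
      (probFilter P) (𝓝 0))
    (hy2 : Tendsto (fun q : Σ n, Ω n => ∑ i, (y' q.1 i q.2 - y q.1 i q.2) ^ 2)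
      (probFilter P) (𝓝 0))
    (hR : ∀ n, AEMeasurable (R n) (P n))
    (hRx : ∀ᶠ n in atTop, ∀ ω, elRatio (R n ω) = elRatio (fun i => ![x' n i ω, y' n i ω])) :
    TendstoInDistribution (fun n ω => negTwoLog (elRatio (R n ω))) atTop
      (fun r : ℝ => (r : EReal)) P (chiSquare 2) := by
  have Lx : LindebergArray P x 1 := by simpa using hxy 1 0
  have Ly : LindebergArray P y 1 := by simpa using hxy 0 1
  have Lxy : LindebergArray P (fun n i ω => x n i ω + y n i ω) 2 := by
    have := hxy 1 1
    norm_num at this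
    exact this
  have txx := Lx.tendsto_sum_sq
  have tyy := Ly.tendsto_sum_sq
  have txy : Tendsto (fun q : Σ n, Ω n => ∑ i, x q.1 i q.2 * y q.1 i q.2) (probFilter P) (𝓝 0) := by
    have := ((Lxy.tendsto_sum_sq.sub txx).sub tyy).div_const 2
    norm_num at this
    refine this.congr fun q => ?_
    rw [← Finset.sum_sub_distrib, ← Finset.sum_sub_distrib, Finset.sum_div]
    exact Finset.sum_congr rfl fun i _ => by ring
  have txx' : Tendsto (fun q : Σ n, Ω n => ∑ i, x' q.1 i q.2 ^ 2) (probFilter P) (𝓝 1) := by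
    have := (txx.add ((tendsto_sum_mul_of_sq txx hx2).const_mul 2)).add hx2
    norm_num at this
    refine this.congr fun q => ?_
    rw [Finset.mul_sum, ← Finset.sum_add_distrib, ← Finset.sum_add_distrib]
    exact Finset.sum_congr rfl fun i _ => by ring
  have tyy' : Tendsto (fun q : Σ n, Ω n => ∑ i, y' q.1 i q.2 ^ 2) (probFilter P) (𝓝 1) := by
    have := (tyy.add ((tendsto_sum_mul_of_sq tyy hy2).const_mul 2)).add hy2
    norm_num at this
    refine this.congr fun q => ?_
    rw [Finset.mul_sum, ← Finset.sum_add_distrib, ← Finset.sum_add_distrib]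
    exact Finset.sum_congr rfl fun i _ => by ring
  have txy' : Tendsto (fun q : Σ n, Ω n => ∑ i, x' q.1 i q.2 * y' q.1 i q.2)
      (probFilter P) (𝓝 0) := by
    have := (txy.add (tendsto_sum_mul_of_sq txx hy2)).add (tendsto_sum_mul_of_sq tyy' hx2)
    norm_num at this
    refine this.congr fun q => ?_
    rw [← Finset.sum_add_distrib, ← Finset.sum_add_distrib]
    exact Finset.sum_congr rfl fun i _ => by ring
  have tnx : Tendsto (fun q : Σ n, Ω n => ‖fun i => x' q.1 i q.2‖) (probFilter P) (𝓝 0) := by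
    have := Lx.tendsto_norm.add (tendsto_norm_of_sum_sq hx2)
    rw [add_zero] at this
    refine squeeze_zero (fun q => norm_nonneg _) (fun q => ?_) this
    refine le_trans (le_of_eq ?_) (norm_add_le _ _)
    congr 1
    ext i
    simp
  have tny : Tendsto (fun q : Σ n, Ω n => ‖fun i => y' q.1 i q.2‖) (probFilter P) (𝓝 0) := by
    have := Ly.tendsto_norm.add (tendsto_norm_of_sum_sq hy2)
    rw [add_zero] at this
    refine squeeze_zero (fun q => norm_nonneg _) (fun q => ?_) this
    refine le_trans (le_of_eq ?_) (norm_add_le _ _)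
    congr 1
    ext i
    simp
  have tightx : ∀ ε : ENNReal, 0 < ε → ∃ K : ℝ, ∀ᶠ n in atTop,
      P n {ω | ¬ |∑ i, x n i ω| ≤ K} ≤ ε := fun ε hε => Lx.tight hε
  have tighty : ∀ ε : ENNReal, 0 < ε → ∃ K : ℝ, ∀ᶠ n in atTop,
      P n {ω | ¬ |∑ i, y n i ω| ≤ K} ≤ ε := fun ε hε => Ly.tight hε
  have tightx' := tight_of_tendsto_sub (g := fun n ω => ∑ i, x' n i ω) tightx hx1
  have tighty' := tight_of_tendsto_sub (g := fun n ω => ∑ i, y' n i ω) tighty hy1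
  refine tendstoInDistribution_negTwoLog (x := fun n ω i => x' n i ω) (y := fun n ω i => y' n i ω)
    (Q := fun n ω => (∑ i, x n i ω) ^ 2 + (∑ i, y n i ω) ^ 2) hR hRx hN tnx tny txx' txy' tyy'
    ?_ ?_ ?_
  · intro ε hε
    obtain ⟨K₁, h1⟩ := tightx' (ε / 2) (ENNReal.half_pos hε.ne')
    obtain ⟨K₂, h2⟩ := tighty' (ε / 2) (ENNReal.half_pos hε.ne')
    refine ⟨max K₁ K₂, ?_⟩
    filter_upwards [h1, h2] with n h1 h2
    refine (measure_mono ?_).trans ((measure_union_le _ _).trans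
      ((add_le_add h1 h2).trans (ENNReal.add_halves ε).le))
    intro ω hω
    by_cases hb : |∑ i, x' n i ω| ≤ K₁
    · exact Or.inr fun hc => hω ⟨hb.trans (le_max_left _ _), hc.trans (le_max_right _ _)⟩
    · exact Or.inl hb
  · refine tendstoInDistribution_sq_add_sq (fun n => by fun_prop) (fun n => by fun_prop)
      fun t₀ t₁ => ?_
    refine (hxy t₀ t₁).tendsto_integral_cexp.congr fun n => ?_
    simp only [Finset.sum_add_distrib, Finset.mul_sum]
  · have hx3 := (tendsto_mul_of_tight (f := fun n ω => ∑ i, x n i ω)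
      (g := fun n ω => ∑ i, x' n i ω - ∑ i, x n i ω) tightx hx1).const_mul (-2)
    have hy3 := (tendsto_mul_of_tight (f := fun n ω => ∑ i, y n i ω)
      (g := fun n ω => ∑ i, y' n i ω - ∑ i, y n i ω) tighty hy1).const_mul (-2)
    have := ((hx3.add hy3).sub (hx1.pow 2)).sub (hy1.pow 2)
    norm_num at this
    refine this.congr fun q => ?_
    ring

end Limit

section Moments

set_option linter.unusedSectionVars false

variable {Ω : Type*} [MeasurableSpace Ω] {P : Measure Ω} {ι κ : Type*} [Fintype ι] [Fintype κ]
  [DecidableEq ι]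

/-- Independent centred random vectors with covariances `S` and fourth order covariances `C`. -/
structure IsCenteredSample (P : Measure Ω) (x : ι → Ω → κ → ℝ) (S : κ → κ → ℝ)
    (C : κ → κ → κ → κ → ℝ) : Prop where
  aemeasurable : ∀ i, AEMeasurable (x i) P
  indep : iIndepFun x P
  memLp_sq : ∀ i a, MemLp (fun ω => x i ω a ^ 2) 2 P
  mean : ∀ i a, ∫ ω, x i ω a ∂P = 0
  cov : ∀ i a b, ∫ ω, x i ω a * x i ω b ∂P = S a b
  cov₄ : ∀ i a b c d, ∫ ω, (x i ω a * x i ω b - S a b) * (x i ω c * x i ω d - S c d) ∂P = C a b c d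

/-- The centred product of coordinates of two sample points. -/
def centredProd (S : κ → κ → ℝ) (j k : ι) (a b : κ) (y : ι → κ → ℝ) : ℝ :=
  y j a * y k b - if j = k then S a b else 0

/-- The `(a, b)` entry of the centred quadratic form with coefficients `c`. -/
def quad (S : κ → κ → ℝ) (c : ι → ι → ℝ) (a b : κ) (y : ι → κ → ℝ) : ℝ :=
  ∑ j, ∑ k, c j k * centredProd S j k a b y

variable {x : ι → Ω → κ → ℝ} {S : κ → κ → ℝ} {C : κ → κ → κ → κ → ℝ}

theorem measurable_centredProd (S : κ → κ → ℝ) (j k : ι) (a b : κ) :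
    Measurable (centredProd S j k a b) := by
  unfold centredProd
  fun_prop

theorem measurable_quad (S : κ → κ → ℝ) (c : ι → ι → ℝ) (a b : κ) : Measurable (quad S c a b) := by
  unfold quad
  exact Finset.measurable_fun_sum _ fun j _ => Finset.measurable_fun_sum _ fun k _ =>
    (measurable_centredProd S j k a b).const_mul _

namespace IsCenteredSample

theorem aemeasurable_apply (h : IsCenteredSample P x S C) (i : ι) (a : κ) :
    AEMeasurable (fun ω => x i ω a) P :=
  (measurable_pi_apply a).comp_aemeasurable (h.aemeasurable i)

theorem memLp_mul (h : IsCenteredSample P x S C) (j k : ι) (a b : κ) :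
    MemLp (fun ω => x j ω a * x k ω b) 2 P := by
  refine ((h.memLp_sq j a).add (h.memLp_sq k b)).mono
    ((h.aemeasurable_apply j a).mul (h.aemeasurable_apply k b)).aestronglyMeasurable
    (ae_of_all _ fun ω => ?_)
  simp only [Pi.add_apply, Real.norm_eq_abs]
  rw [abs_of_nonneg (a := x j ω a ^ 2 + x k ω b ^ 2) (by positivity), abs_le]
  constructor <;> nlinarith [sq_nonneg (x j ω a + x k ω b), sq_nonneg (x j ω a - x k ω b),
    sq_nonneg (x j ω a), sq_nonneg (x k ω b)]

theorem isProbabilityMeasure (h : IsCenteredSample P x S C) : IsProbabilityMeasure P :=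
  h.indep.isProbabilityMeasure

theorem memLp_centredProd (h : IsCenteredSample P x S C) (j k : ι) (a b : κ) :
    MemLp (fun ω => centredProd S j k a b (fun i => x i ω)) 2 P := by
  have := h.isProbabilityMeasure
  exact (h.memLp_mul j k a b).sub (memLp_const _)

theorem memLp_quad (h : IsCenteredSample P x S C) (c : ι → ι → ℝ) (a b : κ) :
    MemLp (fun ω => quad S c a b (fun i => x i ω)) 2 P :=
  memLp_finsetSum _ fun j _ => memLp_finsetSum _ fun k _ => (h.memLp_centredProd j k a b).const_mul _

theorem integral_centredProd_self (h : IsCenteredSample P x S C) (j : ι) (a b : κ) :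
    ∫ ω, centredProd S j j a b (fun i => x i ω) ∂P = 0 := by
  have := h.isProbabilityMeasure
  simp only [centredProd, if_true]
  rw [integral_sub ((h.memLp_mul j j a b).integrable (by norm_num)) (integrable_const _), h.cov]
  simp

/-- A factor whose index occurs only once makes the expectation vanish. -/
theorem integral_eq_zero_of_isolated (h : IsCenteredSample P x S C) {j k l m : ι} (hjk : j ≠ k)
    (hjl : j ≠ l) (hjm : j ≠ m) (a b c d : κ) (r : ℝ) :
    ∫ ω, x j ω a * (x k ω b * (x l ω c * x m ω d - r)) ∂P = 0 := by
  have hd : Disjoint ({j} : Finset ι) {k, l, m} := by simp [hjk, hjl, hjm]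
  have hi := h.indep.indepFun_finset₀ {j} {k, l, m} hd h.aemeasurable
  have hi2 := hi.comp (φ := fun y : ({j} : Finset ι) → κ → ℝ => y ⟨j, by simp⟩ a)
    (ψ := fun y : ({k, l, m} : Finset ι) → κ → ℝ => y ⟨k, by simp⟩ b *
      (y ⟨l, by simp⟩ c * y ⟨m, by simp⟩ d - r)) (by fun_prop) (by fun_prop)
  have := hi2.integral_mul_eq_mul_integral (h.aemeasurable_apply j a).aestronglyMeasurable
    (((h.aemeasurable_apply k b).mul (((h.aemeasurable_apply l c).mul
      (h.aemeasurable_apply m d)).sub_const r)).aestronglyMeasurable)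
  have h2 : ∫ ω, x j ω a ∂P = 0 := h.mean j a
  simp only [Pi.mul_apply, Function.comp_apply] at this
  rw [this, h2, zero_mul]

theorem integral_mul_of_ne (h : IsCenteredSample P x S C) {j k : ι} (hjk : j ≠ k) (a b c d : κ) :
    ∫ ω, (x j ω a * x j ω b) * (x k ω c * x k ω d) ∂P = S a b * S c d := by
  have hi := (h.indep.indepFun hjk).comp (φ := fun y : κ → ℝ => y a * y b)
    (ψ := fun y : κ → ℝ => y c * y d) (by fun_prop) (by fun_prop)
  have := hi.integral_mul_eq_mul_integral
    ((h.aemeasurable_apply j a).mul (h.aemeasurable_apply j b)).aestronglyMeasurable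
    ((h.aemeasurable_apply k c).mul (h.aemeasurable_apply k d)).aestronglyMeasurable
  simp only [Pi.mul_apply, Function.comp_apply] at this
  rw [this, h.cov, h.cov]

theorem integral_centredProd_mul (h : IsCenteredSample P x S C) (j k l m : ι) (a b c d : κ) :
    ∫ ω, centredProd S j k a b (fun i => x i ω) * centredProd S l m c d (fun i => x i ω) ∂P =
      if j = k then (if l = j ∧ m = j then C a b c d else 0)
      else ((if l = j ∧ m = k then S a c * S b d else 0)
        + (if l = k ∧ m = j then S a d * S b c else 0)) := by
  have := h.isProbabilityMeasure
  unfold centredProd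
  by_cases hjk : j = k
  · subst hjk
    rw [if_pos rfl, if_pos rfl]
    by_cases hlm : l = m
    · subst hlm
      by_cases hlj : l = j
      · subst hlj
        simp [h.cov₄]
      · rw [if_pos (rfl : l = l), if_neg (fun e : l = j ∧ l = j => hlj e.1)]
        have hi := (h.indep.indepFun (Ne.symm hlj)).comp (φ := fun y : κ → ℝ => y a * y b - S a b)
          (ψ := fun y : κ → ℝ => y c * y d - S c d) (by fun_prop) (by fun_prop)
        have e := hi.integral_mul_eq_mul_integral
          (((h.aemeasurable_apply j a).mul (h.aemeasurable_apply j b)).sub_const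
            _).aestronglyMeasurable
          (((h.aemeasurable_apply l c).mul (h.aemeasurable_apply l d)).sub_const
            _).aestronglyMeasurable
        have e0 := h.integral_centredProd_self j a b
        simp only [centredProd, if_true] at e0
        simp only [Pi.mul_apply, Function.comp_apply] at e
        rw [e, e0, zero_mul]
    · rw [if_neg hlm, if_neg (by rintro ⟨rfl, rfl⟩; exact hlm rfl)]
      by_cases hlj : l = j
      · subst hlj
        refine Eq.trans ?_ (h.integral_eq_zero_of_isolated (Ne.symm hlm) (Ne.symm hlm) (Ne.symm hlm) d c a b
          (S a b))
        exact integral_congr_ae (ae_of_all _ fun ω => by simp only; ring)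
      · refine Eq.trans ?_ (h.integral_eq_zero_of_isolated hlm hlj hlj c d a b (S a b))
        exact integral_congr_ae (ae_of_all _ fun ω => by simp only; ring)
  · rw [if_neg hjk, if_neg hjk]
    by_cases h1 : l = j ∧ m = k
    · obtain ⟨rfl, rfl⟩ := h1
      rw [if_neg hjk, if_pos ⟨rfl, rfl⟩, if_neg (by tauto), add_zero, ← h.integral_mul_of_ne hjk]
      exact integral_congr_ae (ae_of_all _ fun ω => by simp only; ring)
    · rw [if_neg h1, zero_add]
      by_cases h2 : l = k ∧ m = j
      · obtain ⟨rfl, rfl⟩ := h2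
        rw [if_neg (Ne.symm hjk), if_pos ⟨rfl, rfl⟩, ← h.integral_mul_of_ne hjk]
        exact integral_congr_ae (ae_of_all _ fun ω => by simp only; ring)
      · rw [if_neg h2]
        by_cases h3 : j ≠ l ∧ j ≠ m
        · refine Eq.trans ?_ (h.integral_eq_zero_of_isolated hjk h3.1 h3.2 a b c d (if l = m then S c d else 0))
          exact integral_congr_ae (ae_of_all _ fun ω => by simp only; ring)
        · by_cases hlm : l = m
          · subst hlm
            have hjl : j = l := by tauto
            subst hjl
            refine Eq.trans ?_ (h.integral_eq_zero_of_isolated (Ne.symm hjk) (Ne.symm hjk) (Ne.symm hjk) b a c d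
              (if j = j then S c d else 0))
            exact integral_congr_ae (ae_of_all _ fun ω => by simp only; ring)
          · rw [if_neg hlm]
            by_cases hjl : j = l
            · subst hjl
              have hmk : m ≠ k := fun e => h1 ⟨rfl, e⟩
              refine Eq.trans ?_ (h.integral_eq_zero_of_isolated (Ne.symm hlm) (Ne.symm hlm) hmk d c a b 0)
              exact integral_congr_ae (ae_of_all _ fun ω => by simp only; ring)
            · have hjm : j = m := by tauto
              subst hjm
              have hlk : l ≠ k := fun e => h2 ⟨e, rfl⟩
              refine Eq.trans ?_ (h.integral_eq_zero_of_isolated hlm (Ne.symm hjl) hlk c d a b 0)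
              exact integral_congr_ae (ae_of_all _ fun ω => by simp only; ring)

end IsCenteredSample

/-- The inner product of the diagonals of two coefficient matrices. -/
def diagInner (c d : ι → ι → ℝ) : ℝ := ∑ j, c j j * d j j

/-- The inner product of the off-diagonal parts of two coefficient matrices. -/
def offInner (c d : ι → ι → ℝ) : ℝ := ∑ j, ∑ k, if j = k then 0 else c j k * d j k

theorem IsCenteredSample.integral_quad_mul (h : IsCenteredSample P x S C) (c d : ι → ι → ℝ)
    (hd : ∀ j k, d j k = d k j) (a b a' b' : κ) :
    ∫ ω, quad S c a b (fun i => x i ω) * quad S d a' b' (fun i => x i ω) ∂P =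
      diagInner c d * C a b a' b' + offInner c d * (S a a' * S b b' + S a b' * S b a') := by
  have hint : ∀ j k l m, Integrable (fun ω => c j k * centredProd S j k a b (fun i => x i ω) *
      (d l m * centredProd S l m a' b' (fun i => x i ω))) P := fun j k l m =>
    ((h.memLp_centredProd j k a b).const_mul (c j k)).integrable_mul
      ((h.memLp_centredProd l m a' b').const_mul (d l m))
  unfold quad
  simp_rw [Finset.sum_mul_sum]
  rw [integral_finsetSum _ fun j _ => integrable_finsetSum _ fun l _ =>
    integrable_finsetSum _ fun k _ => integrable_finsetSum _ fun m _ => hint j k l m]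
  have e1 : ∀ j, ∫ ω, ∑ l, ∑ k, ∑ m, c j k * centredProd S j k a b (fun i => x i ω) *
      (d l m * centredProd S l m a' b' (fun i => x i ω)) ∂P
      = ∑ l, ∑ k, ∑ m, c j k * d l m * (if j = k then (if l = j ∧ m = j then C a b a' b' else 0)
      else ((if l = j ∧ m = k then S a a' * S b b' else 0)
        + (if l = k ∧ m = j then S a b' * S b a' else 0))) := by
    intro j
    rw [integral_finsetSum _ fun l _ =>
      integrable_finsetSum _ fun k _ => integrable_finsetSum _ fun m _ => hint j k l m]
    refine Finset.sum_congr rfl fun l _ => ?_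
    rw [integral_finsetSum _ fun k _ => integrable_finsetSum _ fun m _ => hint j k l m]
    refine Finset.sum_congr rfl fun k _ => ?_
    rw [integral_finsetSum _ fun m _ => hint j k l m]
    refine Finset.sum_congr rfl fun m _ => ?_
    rw [← h.integral_centredProd_mul, ← integral_const_mul]
    exact integral_congr_ae (ae_of_all _ fun ω => by simp only; ring)
  simp_rw [e1]
  have e2 : ∀ j, ∑ l, ∑ k, ∑ m, c j k * d l m *
      (if j = k then (if l = j ∧ m = j then C a b a' b' else 0)
      else ((if l = j ∧ m = k then S a a' * S b b' else 0)
        + (if l = k ∧ m = j then S a b' * S b a' else 0)))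
      = c j j * d j j * C a b a' b' + ∑ k, (if j = k then 0 else c j k * d j k)
        * (S a a' * S b b' + S a b' * S b a') := by
    intro j
    rw [Finset.sum_comm]
    have e3 : ∀ k, ∑ l, ∑ m, c j k * d l m *
      (if j = k then (if l = j ∧ m = j then C a b a' b' else 0)
      else ((if l = j ∧ m = k then S a a' * S b b' else 0)
        + (if l = k ∧ m = j then S a b' * S b a' else 0)))
        = (if j = k then c j j * d j j * C a b a' b' else 0) +
          (if j = k then 0 else c j k * d j k) * (S a a' * S b b' + S a b' * S b a') := by
      intro k
      by_cases hjk : j = k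
      · subst hjk
        simp [ite_and]
      · simp only [if_neg hjk, mul_add, Finset.sum_add_distrib]
        simp [ite_and]
        exact Or.inl (Or.inl (hd k j))
    simp_rw [e3]
    rw [Finset.sum_add_distrib]
    simp
  simp_rw [e2]
  rw [Finset.sum_add_distrib, ← Finset.sum_mul, diagInner, offInner]
  simp_rw [← Finset.sum_mul]

theorem IsCenteredSample.sum_covariance (h : IsCenteredSample P x S C) (c d : ι → ι → ℝ)
    (hd : ∀ j k, d j k = d k j) :
    ∫ ω, (∑ a, ∑ b, quad S c a b (fun i => x i ω)) * (∑ a, ∑ b, quad S d a b (fun i => x i ω)) ∂P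
      = diagInner c d * (∑ a, ∑ b, ∑ a', ∑ b', C a b a' b')
        + offInner c d * (2 * (∑ a, ∑ b, S a b) ^ 2) := by
  have hint : ∀ a b a' b', Integrable (fun ω => quad S c a b (fun i => x i ω)
      * quad S d a' b' (fun i => x i ω)) P := fun a b a' b' =>
    (h.memLp_quad c a b).integrable_mul (h.memLp_quad d a' b')
  have e : ∀ ω, (∑ a, ∑ b, quad S c a b (fun i => x i ω)) * (∑ a, ∑ b, quad S d a b (fun i => x i ω))
      = ∑ a, ∑ b, ∑ a', ∑ b', quad S c a b (fun i => x i ω) * quad S d a' b' (fun i => x i ω) := by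
    intro ω
    simp_rw [Finset.sum_mul, Finset.mul_sum]
  simp_rw [e]
  rw [integral_finsetSum _ fun a _ => integrable_finsetSum _ fun b _ => integrable_finsetSum _
    fun a' _ => integrable_finsetSum _ fun b' _ => hint a b a' b']
  have e1 : ∀ a, ∫ ω, ∑ b, ∑ a', ∑ b', quad S c a b (fun i => x i ω)
      * quad S d a' b' (fun i => x i ω) ∂P = ∑ b, ∑ a', ∑ b', (diagInner c d * C a b a' b'
        + offInner c d * (S a a' * S b b' + S a b' * S b a')) := by
    intro a
    rw [integral_finsetSum _ fun b _ => integrable_finsetSum _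
      fun a' _ => integrable_finsetSum _ fun b' _ => hint a b a' b']
    refine Finset.sum_congr rfl fun b _ => ?_
    rw [integral_finsetSum _ fun a' _ => integrable_finsetSum _ fun b' _ => hint a b a' b']
    refine Finset.sum_congr rfl fun a' _ => ?_
    rw [integral_finsetSum _ fun b' _ => hint a b a' b']
    exact Finset.sum_congr rfl fun b' _ => h.integral_quad_mul c d hd a b a' b'
  simp_rw [e1, Finset.sum_add_distrib, ← Finset.mul_sum, Finset.sum_add_distrib]
  have e2 : ∑ a, ∑ b, ∑ a', ∑ b', S a a' * S b b' = (∑ a, ∑ b, S a b) ^ 2 := by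
    rw [sq, Finset.sum_mul_sum]
    simp_rw [Finset.sum_mul_sum]
  have e3 : ∑ a, ∑ b, ∑ a', ∑ b', S a b' * S b a' = (∑ a, ∑ b, S a b) ^ 2 := by
    rw [← e2]
    exact Finset.sum_congr rfl fun a _ => Finset.sum_congr rfl fun b _ => Finset.sum_comm
  rw [e2, e3]
  ring

end Moments

section FourIndex

variable {κ : Type*} [Fintype κ]

/-- The Euclidean norm of a four-index array. -/
def norm₄ (f : κ → κ → κ → κ → ℝ) : ℝ := √(∑ a, ∑ b, ∑ a', ∑ b', f a b a' b' ^ 2)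

theorem norm₄_eq (f : κ → κ → κ → κ → ℝ) : norm₄ f =
    ‖(WithLp.toLp 2 fun q : κ × κ × κ × κ => f q.1 q.2.1 q.2.2.1 q.2.2.2 :
      EuclideanSpace ℝ (κ × κ × κ × κ))‖ := by
  rw [EuclideanSpace.norm_eq, norm₄]
  simp_rw [Fintype.sum_prod_type, Real.norm_eq_abs, sq_abs]

theorem norm₄_nonneg (f : κ → κ → κ → κ → ℝ) : 0 ≤ norm₄ f := Real.sqrt_nonneg _

theorem sq_norm₄ (f : κ → κ → κ → κ → ℝ) :
    norm₄ f ^ 2 = ∑ a, ∑ b, ∑ a', ∑ b', f a b a' b' ^ 2 :=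
  Real.sq_sqrt (Finset.sum_nonneg fun _ _ => Finset.sum_nonneg fun _ _ =>
    Finset.sum_nonneg fun _ _ => Finset.sum_nonneg fun _ _ => sq_nonneg _)

theorem norm₄_add_le (f g : κ → κ → κ → κ → ℝ) :
    norm₄ (fun a b a' b' => f a b a' b' + g a b a' b') ≤ norm₄ f + norm₄ g := by
  simp_rw [norm₄_eq]
  exact norm_add_le (E := EuclideanSpace ℝ (κ × κ × κ × κ))
    (WithLp.toLp 2 fun q => f q.1 q.2.1 q.2.2.1 q.2.2.2)
    (WithLp.toLp 2 fun q => g q.1 q.2.1 q.2.2.1 q.2.2.2)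

theorem norm₄_const_mul (r : ℝ) (f : κ → κ → κ → κ → ℝ) :
    norm₄ (fun a b a' b' => r * f a b a' b') = |r| * norm₄ f := by
  unfold norm₄
  simp_rw [mul_pow, ← Finset.mul_sum]
  rw [Real.sqrt_mul (sq_nonneg _), Real.sqrt_sq_eq_abs]

theorem norm₄_swap (f : κ → κ → κ → κ → ℝ) :
    norm₄ (fun a b a' b' => f b a b' a') = norm₄ f := by
  unfold norm₄
  congr 1
  rw [Finset.sum_comm]
  exact Finset.sum_congr rfl fun _ _ => Finset.sum_congr rfl fun _ _ => Finset.sum_comm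

theorem abs_sum₄_mul_le (f g : κ → κ → κ → κ → ℝ) :
    |∑ a, ∑ b, ∑ a', ∑ b', f a b a' b' * g a b a' b'| ≤ norm₄ f * norm₄ g := by
  have h := Finset.sum_mul_sq_le_sq_mul_sq (Finset.univ : Finset (κ × κ × κ × κ))
    (fun q => f q.1 q.2.1 q.2.2.1 q.2.2.2) (fun q => g q.1 q.2.1 q.2.2.1 q.2.2.2)
  simp_rw [Fintype.sum_prod_type] at h
  rw [norm₄, norm₄, ← Real.sqrt_mul (Finset.sum_nonneg fun _ _ => Finset.sum_nonneg fun _ _ =>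
    Finset.sum_nonneg fun _ _ => Finset.sum_nonneg fun _ _ => sq_nonneg _)]
  exact Real.abs_le_sqrt h

theorem norm₄_mul (S T : κ → κ → ℝ) :
    norm₄ (fun a b a' b' => S a a' * T b b')
      = √(∑ a, ∑ b, S a b ^ 2) * √(∑ a, ∑ b, T a b ^ 2) := by
  rw [norm₄, ← Real.sqrt_mul (Finset.sum_nonneg fun _ _ => Finset.sum_nonneg fun _ _ => sq_nonneg _)]
  congr 1
  simp_rw [mul_pow]
  rw [Finset.sum_mul_sum]
  simp_rw [Finset.sum_mul_sum]

theorem norm₄_pairings_le (S : κ → κ → ℝ) :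
    norm₄ (fun a b a' b' => S a a' * S b b' + S a b' * S b a') ≤ 2 * ∑ a, ∑ b, S a b ^ 2 := by
  have h0 : 0 ≤ ∑ a, ∑ b, S a b ^ 2 :=
    Finset.sum_nonneg fun _ _ => Finset.sum_nonneg fun _ _ => sq_nonneg _
  have h1 : norm₄ (fun a b a' b' => S a b' * S b a') = norm₄ fun a b a' b' => S a a' * S b b' := by
    unfold norm₄
    congr 1
    exact Finset.sum_congr rfl fun _ _ => Finset.sum_congr rfl fun _ _ => Finset.sum_comm
  have h2 := norm₄_add_le (fun a b a' b' => S a a' * S b b') (fun a b a' b' => S a b' * S b a')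
  rw [h1, norm₄_mul, Real.mul_self_sqrt h0] at h2
  linarith

end FourIndex

section TwoSample

set_option linter.unusedSectionVars false

variable {Ω : Type*} [MeasurableSpace Ω] {P : Measure Ω} {ι κ : Type*} [Fintype ι] [Fintype κ]
  [DecidableEq ι]

/-- Two independent samples with the same second and fourth order covariances. -/
structure IsTwoSample (P : Measure Ω) (x z : ι → Ω → κ → ℝ) (S : κ → κ → ℝ)
    (C : κ → κ → κ → κ → ℝ) : Prop where
  left : IsCenteredSample P x S C
  right : IsCenteredSample P z S C
  indepFun : IndepFun (fun ω i => x i ω) (fun ω i => z i ω) P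

/-- The trace of the product of two centred quadratic forms. -/
def traceForm (S : κ → κ → ℝ) (c d : ι → ι → ℝ) (y y' : ι → κ → ℝ) : ℝ :=
  ∑ a, ∑ b, quad S c a b y * quad S d b a y'

/-- The sum of the entries of a centred quadratic form. -/
def sumForm (S : κ → κ → ℝ) (c : ι → ι → ℝ) (y : ι → κ → ℝ) : ℝ := ∑ a, ∑ b, quad S c a b y

/-- The bound on the covariance of two quadratic forms, in terms of a fourth order
quantity `σ` and a second order quantity `τ`. -/
def covBound (σ τ : ℝ) (c d : ι → ι → ℝ) : ℝ := |diagInner c d| * σ + |offInner c d| * (2 * τ)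

theorem covBound_nonneg {σ τ : ℝ} (hσ : 0 ≤ σ) (hτ : 0 ≤ τ) (c d : ι → ι → ℝ) :
    0 ≤ covBound σ τ c d := by unfold covBound; positivity

theorem norm₄_cov_le (S : κ → κ → ℝ) (C : κ → κ → κ → κ → ℝ) (c d : ι → ι → ℝ) :
    norm₄ (fun a b a' b' => diagInner c d * C a b a' b'
        + offInner c d * (S a a' * S b b' + S a b' * S b a'))
      ≤ covBound (norm₄ C) (∑ a, ∑ b, S a b ^ 2) c d := by
  refine (norm₄_add_le _ _).trans ?_
  rw [norm₄_const_mul, norm₄_const_mul]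
  exact add_le_add le_rfl (mul_le_mul_of_nonneg_left (norm₄_pairings_le S) (abs_nonneg _))

theorem memLp_mul_of_indepFun {f g : Ω → ℝ} (hf : MemLp f 2 P) (hg : MemLp g 2 P)
    (h : IndepFun f g P) : MemLp (fun ω => f ω * g ω) 2 P := by
  refine (memLp_two_iff_integrable_sq (hf.aestronglyMeasurable.mul hg.aestronglyMeasurable)).mpr ?_
  refine ((h.comp (φ := fun r => r ^ 2) (ψ := fun r => r ^ 2) (by fun_prop)
    (by fun_prop)).integrable_mul hf.integrable_sq hg.integrable_sq).congr
    (ae_of_all _ fun ω => ?_)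
  simp only [Pi.mul_apply, Function.comp_apply, mul_pow]

variable {x z : ι → Ω → κ → ℝ} {S : κ → κ → ℝ} {C : κ → κ → κ → κ → ℝ}

namespace IsTwoSample

theorem indepFun_comp (h : IsTwoSample P x z S C) {f g : (ι → κ → ℝ) → ℝ} (hf : Measurable f)
    (hg : Measurable g) : IndepFun (fun ω => f (fun i => x i ω)) (fun ω => g (fun i => z i ω)) P :=
  h.indepFun.comp hf hg

theorem memLp_quad_mul (h : IsTwoSample P x z S C) (c d : ι → ι → ℝ) (a b a' b' : κ) :
    MemLp (fun ω => quad S c a b (fun i => x i ω) * quad S d a' b' (fun i => z i ω)) 2 P :=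
  memLp_mul_of_indepFun (h.left.memLp_quad c a b) (h.right.memLp_quad d a' b')
    (h.indepFun_comp (measurable_quad _ _ _ _) (measurable_quad _ _ _ _))

theorem memLp_traceForm (h : IsTwoSample P x z S C) (c d : ι → ι → ℝ) :
    MemLp (fun ω => traceForm S c d (fun i => x i ω) (fun i => z i ω)) 2 P :=
  memLp_finsetSum _ fun a _ => memLp_finsetSum _ fun b _ => h.memLp_quad_mul c d a b b a

theorem integral_traceForm_mul (h : IsTwoSample P x z S C) (c d c' d' : ι → ι → ℝ)
    (hc' : ∀ j k, c' j k = c' k j) (hd' : ∀ j k, d' j k = d' k j) :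
    ∫ ω, traceForm S c d (fun i => x i ω) (fun i => z i ω)
        * traceForm S c' d' (fun i => x i ω) (fun i => z i ω) ∂P
      = ∑ a, ∑ b, ∑ a', ∑ b',
        (diagInner c c' * C a b a' b' + offInner c c' * (S a a' * S b b' + S a b' * S b a'))
        * (diagInner d d' * C b a b' a' + offInner d d' * (S b b' * S a a' + S b a' * S a b')) := by
  have hint : ∀ a b a' b', Integrable (fun ω =>
      (quad S c a b (fun i => x i ω) * quad S d b a (fun i => z i ω))
      * (quad S c' a' b' (fun i => x i ω) * quad S d' b' a' (fun i => z i ω))) P :=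
    fun a b a' b' => (h.memLp_quad_mul c d a b b a).integrable_mul (h.memLp_quad_mul c' d' a' b' b' a')
  have hval : ∀ a b a' b', ∫ ω, (quad S c a b (fun i => x i ω) * quad S d b a (fun i => z i ω))
      * (quad S c' a' b' (fun i => x i ω) * quad S d' b' a' (fun i => z i ω)) ∂P =
      (diagInner c c' * C a b a' b' + offInner c c' * (S a a' * S b b' + S a b' * S b a'))
        * (diagInner d d' * C b a b' a' + offInner d d' * (S b b' * S a a' + S b a' * S a b')) := by
    intro a b a' b'
    rw [← h.left.integral_quad_mul c c' hc', ← h.right.integral_quad_mul d d' hd']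
    have hi := h.indepFun_comp
      ((measurable_quad S c a b).mul (measurable_quad S c' a' b'))
      ((measurable_quad S d b a).mul (measurable_quad S d' b' a'))
    have e := hi.integral_mul_eq_mul_integral
      ((h.left.memLp_quad c a b).aestronglyMeasurable.mul
        (h.left.memLp_quad c' a' b').aestronglyMeasurable)
      ((h.right.memLp_quad d b a).aestronglyMeasurable.mul
        (h.right.memLp_quad d' b' a').aestronglyMeasurable)
    simp only [Pi.mul_apply] at e
    rw [← e]
    exact integral_congr_ae (ae_of_all _ fun ω => by simp only; ring)
  have e : ∀ ω, traceForm S c d (fun i => x i ω) (fun i => z i ω)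
        * traceForm S c' d' (fun i => x i ω) (fun i => z i ω)
      = ∑ a, ∑ b, ∑ a', ∑ b', (quad S c a b (fun i => x i ω) * quad S d b a (fun i => z i ω))
      * (quad S c' a' b' (fun i => x i ω) * quad S d' b' a' (fun i => z i ω)) := by
    intro ω
    unfold traceForm
    simp_rw [Finset.sum_mul, Finset.mul_sum]
  simp_rw [e]
  rw [integral_finsetSum _ fun a _ => integrable_finsetSum _ fun b _ => integrable_finsetSum _
    fun a' _ => integrable_finsetSum _ fun b' _ => hint a b a' b']
  refine Finset.sum_congr rfl fun a _ => ?_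
  rw [integral_finsetSum _ fun b _ => integrable_finsetSum _
      fun a' _ => integrable_finsetSum _ fun b' _ => hint a b a' b']
  refine Finset.sum_congr rfl fun b _ => ?_
  rw [integral_finsetSum _ fun a' _ => integrable_finsetSum _ fun b' _ => hint a b a' b']
  refine Finset.sum_congr rfl fun a' _ => ?_
  rw [integral_finsetSum _ fun b' _ => hint a b a' b']
  exact Finset.sum_congr rfl fun b' _ => hval a b a' b'

theorem abs_integral_traceForm_mul_le (h : IsTwoSample P x z S C) (c d c' d' : ι → ι → ℝ)
    (hc' : ∀ j k, c' j k = c' k j) (hd' : ∀ j k, d' j k = d' k j) :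
    |∫ ω, traceForm S c d (fun i => x i ω) (fun i => z i ω)
        * traceForm S c' d' (fun i => x i ω) (fun i => z i ω) ∂P|
      ≤ covBound (norm₄ C) (∑ a, ∑ b, S a b ^ 2) c c'
        * covBound (norm₄ C) (∑ a, ∑ b, S a b ^ 2) d d' := by
  rw [h.integral_traceForm_mul c d c' d' hc' hd']
  refine (abs_sum₄_mul_le (fun a b a' b' => diagInner c c' * C a b a' b'
    + offInner c c' * (S a a' * S b b' + S a b' * S b a')) (fun a b a' b' =>
    diagInner d d' * C b a b' a' + offInner d d' * (S b b' * S a a' + S b a' * S a b'))).trans ?_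
  rw [norm₄_swap fun a b a' b' => diagInner d d' * C a b a' b'
    + offInner d d' * (S a a' * S b b' + S a b' * S b a')]
  exact mul_le_mul (norm₄_cov_le S C c c') (norm₄_cov_le S C d d') (norm₄_nonneg _)
    (covBound_nonneg (norm₄_nonneg _)
      (Finset.sum_nonneg fun _ _ => Finset.sum_nonneg fun _ _ => sq_nonneg _) _ _)

end IsTwoSample

theorem IsCenteredSample.memLp_sumForm (h : IsCenteredSample P x S C) (c : ι → ι → ℝ) :
    MemLp (fun ω => sumForm S c (fun i => x i ω)) 2 P :=
  memLp_finsetSum _ fun a _ => memLp_finsetSum _ fun b _ => h.memLp_quad c a b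

theorem IsCenteredSample.abs_integral_sumForm_mul_le (h : IsCenteredSample P x S C)
    (hC : 0 ≤ ∑ a, ∑ b, ∑ a', ∑ b', C a b a' b') (c d : ι → ι → ℝ) (hd : ∀ j k, d j k = d k j) :
    |∫ ω, sumForm S c (fun i => x i ω) * sumForm S d (fun i => x i ω) ∂P|
      ≤ covBound (∑ a, ∑ b, ∑ a', ∑ b', C a b a' b') ((∑ a, ∑ b, S a b) ^ 2) c d := by
  unfold sumForm
  rw [h.sum_covariance c d hd, covBound]
  refine (abs_add_le _ _).trans (le_of_eq ?_)
  rw [abs_mul, abs_mul, abs_of_nonneg hC, abs_of_nonneg (a := 2 * _) (by positivity)]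

end TwoSample

section Coefficients

variable {N : ℕ}

/-- The coefficients of the product of the deviations of the `i`-th observation from the mean. -/
def devCoef (N : ℕ) (i j : Fin N) : ℝ := (if j = i then 1 else 0) - 1 / N

/-- The coefficients of the outer product of the `i`-th observation. -/
def selCoef (i j k : Fin N) : ℝ := (if j = i then 1 else 0) * (if k = i then 1 else 0)

/-- The coefficients of the difference between the outer product of the `i`-th observation centred
at the sample mean, and the one centred at the mean. -/
def diffCoef (i j k : Fin N) : ℝ := devCoef N i j * devCoef N i k - selCoef i j k

theorem selCoef_symm (i j k : Fin N) : selCoef i j k = selCoef i k j := mul_comm _ _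

theorem diffCoef_symm (i j k : Fin N) : diffCoef i j k = diffCoef i k j := by
  unfold diffCoef; rw [mul_comm, selCoef_symm]

theorem sum_indicator_mul_indicator (i i' : Fin N) (α β α' β' : ℝ) :
    ∑ j, ((if j = i then α else 0) + β) * ((if j = i' then α' else 0) + β')
      = (if i = i' then α * α' else 0) + α * β' + β * α' + N * (β * β') := by
  have e : ∀ j, ((if j = i then α else 0) + β) * ((if j = i' then α' else 0) + β')
      = (if j = i then (if i = i' then α * α' else 0) + α * β' else 0)
        + (if j = i' then β * α' else 0) + β * β' := by
    intro j
    by_cases h : j = i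
    · subst h
      by_cases h' : j = i'
      · simp only [h', if_true]; ring
      · simp only [h', if_true, if_false]; ring
    · by_cases h' : j = i'
      · rw [if_neg h, if_neg h, if_pos h', if_pos h']; ring
      · rw [if_neg h, if_neg h, if_neg h', if_neg h']; ring
  simp_rw [e, Finset.sum_add_distrib]
  simp

theorem diagInner_selCoef (i i' : Fin N) :
    diagInner (selCoef i) (selCoef i') = if i = i' then 1 else 0 := by
  have h := sum_indicator_mul_indicator i i' 1 0 1 0
  simp only [add_zero, mul_zero, mul_one] at h
  rw [← h, diagInner]
  refine Finset.sum_congr rfl fun j _ => ?_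
  unfold selCoef
  split_ifs <;> simp

theorem offInner_selCoef (i i' : Fin N) : offInner (selCoef i) (selCoef i') = 0 := by
  unfold offInner selCoef
  refine Finset.sum_eq_zero fun j _ => Finset.sum_eq_zero fun k _ => ?_
  split_ifs with h1 <;> simp_all

theorem diagInner_diffCoef (i i' : Fin N) : diagInner (diffCoef i) (diffCoef i')
    = (if i = i' then 4 / (N : ℝ) ^ 2 else 0) - 3 / (N : ℝ) ^ 3 := by
  have hN : (N : ℝ) ≠ 0 := by
    have := i.pos
    positivity
  have e : ∀ l j : Fin N, diffCoef l j j = (if j = l then -2 / (N : ℝ) else 0) + 1 / (N : ℝ) ^ 2 := by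
    intro l j
    unfold diffCoef devCoef selCoef
    split_ifs <;> field_simp <;> ring
  unfold diagInner
  simp_rw [e]
  rw [sum_indicator_mul_indicator]
  split_ifs <;> field_simp <;> ring

theorem sum_diffCoef_mul (i i' : Fin N) : ∑ j, ∑ k, diffCoef i j k * diffCoef i' j k
    = if i = i' then 2 / (N : ℝ) - 1 / (N : ℝ) ^ 2 else - 1 / (N : ℝ) ^ 2 := by
  have hN : (N : ℝ) ≠ 0 := by
    have := i.pos
    positivity
  have key : ∑ j, ∑ k, diffCoef i j k * diffCoef i' j k
      = (∑ j, devCoef N i j * devCoef N i' j) ^ 2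
        - (∑ j, devCoef N i j * (if j = i' then 1 else 0)) ^ 2
        - (∑ j, (if j = i then 1 else 0) * devCoef N i' j) ^ 2
        + (∑ j, (if j = i then 1 else 0) * (if j = i' then 1 else 0)) ^ 2 := by
    simp_rw [sq, Finset.sum_mul_sum, ← Finset.sum_sub_distrib, ← Finset.sum_add_distrib]
    refine Finset.sum_congr rfl fun j _ => Finset.sum_congr rfl fun k _ => ?_
    unfold diffCoef selCoef
    ring
  have h1 := sum_indicator_mul_indicator i i' 1 (-(1 / (N : ℝ))) 1 (-(1 / (N : ℝ)))
  have h2 := sum_indicator_mul_indicator i i' 1 (-(1 / (N : ℝ))) 1 0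
  have h3 := sum_indicator_mul_indicator i i' 1 0 1 (-(1 / (N : ℝ)))
  have h4 := sum_indicator_mul_indicator i i' 1 0 1 0
  simp only [add_zero, ← sub_eq_add_neg] at h1 h2 h3 h4
  rw [key]
  unfold devCoef
  rw [h1, h2, h3, h4]
  split_ifs <;> field_simp <;> ring

theorem sum_mul_eq_diagInner_add_offInner {ι : Type*} [Fintype ι] [DecidableEq ι]
    (c d : ι → ι → ℝ) : ∑ j, ∑ k, c j k * d j k = diagInner c d + offInner c d := by
  unfold diagInner offInner
  rw [← Finset.sum_add_distrib]
  refine Finset.sum_congr rfl fun j _ => ?_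
  have : ∀ k, c j k * d j k = (if j = k then c j j * d j j else 0)
      + (if j = k then 0 else c j k * d j k) := by
    intro k
    split_ifs with h
    · subst h; simp
    · simp
  rw [Finset.sum_congr rfl fun k _ => this k, Finset.sum_add_distrib]
  simp

theorem offInner_diffCoef (i i' : Fin N) : offInner (diffCoef i) (diffCoef i')
    = (if i = i' then 2 / (N : ℝ) - 4 / (N : ℝ) ^ 2 else 0) - 1 / (N : ℝ) ^ 2
      + 3 / (N : ℝ) ^ 3 := by
  have h := sum_mul_eq_diagInner_add_offInner (diffCoef i) (diffCoef i')
  rw [sum_diffCoef_mul, diagInner_diffCoef] at h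
  split_ifs at h ⊢ <;> linear_combination -h

theorem covBound_selCoef (σ τ : ℝ) (i i' : Fin N) :
    covBound σ τ (selCoef i) (selCoef i') = if i = i' then σ else 0 := by
  rw [covBound, diagInner_selCoef, offInner_selCoef]
  split_ifs <;> simp

/-- The differences of coefficients have small inner products. -/
theorem covBound_diffCoef_le {σ τ : ℝ} (hσ : 0 ≤ σ) (hτ : 0 ≤ τ) (i i' : Fin N) :
    covBound σ τ (diffCoef i) (diffCoef i')
      ≤ if i = i' then 20 * (σ / N + τ) / N else 8 * (σ / N + τ) / (N : ℝ) ^ 2 := by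
  have hN1 : (1 : ℝ) ≤ N := by exact_mod_cast i.pos
  have hr0 : 0 ≤ (N : ℝ)⁻¹ := by positivity
  have hr1 : (N : ℝ)⁻¹ ≤ 1 := inv_le_one_of_one_le₀ hN1
  unfold covBound
  rw [diagInner_diffCoef, offInner_diffCoef]
  simp only [div_eq_mul_inv, ← inv_pow]
  set r := (N : ℝ)⁻¹
  have h3 : r ^ 3 ≤ r ^ 2 := pow_le_pow_of_le_one hr0 hr1 (by norm_num)
  have h2 : r ^ 2 ≤ r := by nlinarith
  have h30 : 0 ≤ r ^ 3 := by positivity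
  have h20 : 0 ≤ r ^ 2 := by positivity
  split_ifs
  · have a1 : |4 * r ^ 2 - 3 * r ^ 3| ≤ 7 * r ^ 2 := by rw [abs_le]; constructor <;> linarith
    have a2 : |2 * r - 4 * r ^ 2 - 1 * r ^ 2 + 3 * r ^ 3| ≤ 10 * r := by
      rw [abs_le]; constructor <;> linarith
    have b1 := mul_le_mul_of_nonneg_right a1 hσ
    have b2 := mul_le_mul_of_nonneg_right a2 (by positivity : 0 ≤ 2 * τ)
    nlinarith [mul_nonneg h20 hσ]
  · have a1 : |0 - 3 * r ^ 3| ≤ 8 * r ^ 3 := by rw [abs_le]; constructor <;> linarith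
    have a2 : |0 - 1 * r ^ 2 + 3 * r ^ 3| ≤ 4 * r ^ 2 := by
      rw [abs_le]; constructor <;> linarith
    have b1 := mul_le_mul_of_nonneg_right a1 hσ
    have b2 := mul_le_mul_of_nonneg_right a2 (by positivity : 0 ≤ 2 * τ)
    nlinarith

end Coefficients

section SecondMoments

variable {Ω : Type*} [MeasurableSpace Ω] {P : Measure Ω} {N : ℕ}

theorem integral_sq_sum_le_of_abs_le {h : Fin N → Ω → ℝ} (hh : ∀ i, MemLp (h i) 2 P) {α β : ℝ}
    (hβ : 0 ≤ β) (H : ∀ i j, |∫ ω, h i ω * h j ω ∂P| ≤ if i = j then α else β) :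
    ∫ ω, (∑ i, h i ω) ^ 2 ∂P ≤ N * α + N ^ 2 * β := by
  have hint : ∀ i j, Integrable (fun ω => h i ω * h j ω) P := fun i j =>
    (hh i).integrable_mul (hh j)
  have e : ∀ ω, (∑ i, h i ω) ^ 2 = ∑ i, ∑ j, h i ω * h j ω := fun ω => by
    rw [sq, Finset.sum_mul_sum]
  simp_rw [e]
  rw [integral_finsetSum _ fun i _ => integrable_finsetSum _ fun j _ => hint i j]
  have : ∀ i, ∫ ω, ∑ j, h i ω * h j ω ∂P ≤ α + N * β := by
    intro i
    rw [integral_finsetSum _ fun j _ => hint i j]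
    calc ∑ j, ∫ ω, h i ω * h j ω ∂P ≤ ∑ j, ((if i = j then α else 0) + β) := by
          refine Finset.sum_le_sum fun j _ => (le_abs_self _).trans ((H i j).trans ?_)
          split_ifs <;> linarith
      _ = α + N * β := by simp [Finset.sum_add_distrib]
  calc ∑ i, ∫ ω, ∑ j, h i ω * h j ω ∂P ≤ ∑ i : Fin N, (α + N * β) :=
        Finset.sum_le_sum fun i _ => this i
    _ = _ := by simp; ring

theorem sum_integral_sq_le_of_abs_le {h : Fin N → Ω → ℝ} {α β : ℝ}
    (H : ∀ i j, |∫ ω, h i ω * h j ω ∂P| ≤ if i = j then α else β) :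
    ∑ i, ∫ ω, h i ω ^ 2 ∂P ≤ N * α := by
  calc ∑ i, ∫ ω, h i ω ^ 2 ∂P ≤ ∑ i : Fin N, α := by
        refine Finset.sum_le_sum fun i _ => ?_
        have := (le_abs_self _).trans (H i i)
        simpa [sq] using this
    _ = _ := by simp

/-- `B` bounds both the second moment of the sum and the sum of the second moments of a family. -/
structure SecondMomentBound (P : Measure Ω) (h : Fin N → Ω → ℝ) (B : ℝ) : Prop where
  memLp : ∀ i, MemLp (h i) 2 P
  integral_sq_sum_le : ∫ ω, (∑ i, h i ω) ^ 2 ∂P ≤ B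
  integral_sum_sq_le : ∫ ω, ∑ i, h i ω ^ 2 ∂P ≤ B

namespace SecondMomentBound

theorem of_abs_le {h : Fin N → Ω → ℝ} (hh : ∀ i, MemLp (h i) 2 P) {α β B : ℝ}
    (hβ : 0 ≤ β) (H : ∀ i j, |∫ ω, h i ω * h j ω ∂P| ≤ if i = j then α else β)
    (hB : N * α + N ^ 2 * β ≤ B) : SecondMomentBound P h B where
  memLp := hh
  integral_sq_sum_le := (integral_sq_sum_le_of_abs_le hh hβ H).trans hB
  integral_sum_sq_le := by
    rw [integral_finsetSum _ fun i _ => (hh i).integrable_sq]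
    refine (sum_integral_sq_le_of_abs_le H).trans ?_
    have : 0 ≤ (N : ℝ) ^ 2 * β := by positivity
    linarith

theorem memLp_sum {h : Fin N → Ω → ℝ} {B : ℝ} (H : SecondMomentBound P h B) :
    MemLp (fun ω => ∑ i, h i ω) 2 P := memLp_finsetSum _ fun i _ => H.memLp i

theorem integrable_sum_sq {h : Fin N → Ω → ℝ} {B : ℝ} (H : SecondMomentBound P h B) :
    Integrable (fun ω => ∑ i, h i ω ^ 2) P := integrable_finsetSum _ fun i _ => (H.memLp i).integrable_sq

theorem add {h h' : Fin N → Ω → ℝ} {B B' : ℝ} (H : SecondMomentBound P h B)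
    (H' : SecondMomentBound P h' B') :
    SecondMomentBound P (fun i ω => h i ω + h' i ω) (2 * (B + B')) where
  memLp i := (H.memLp i).add (H'.memLp i)
  integral_sq_sum_le := by
    have : ∫ ω, (∑ i, (h i ω + h' i ω)) ^ 2 ∂P
        ≤ ∫ ω, 2 * ((∑ i, h i ω) ^ 2 + (∑ i, h' i ω) ^ 2) ∂P := by
      refine integral_mono (memLp_finsetSum _ fun i _ => (H.memLp i).add (H'.memLp i)).integrable_sq
        ((H.memLp_sum.integrable_sq.add H'.memLp_sum.integrable_sq).const_mul 2) fun ω => ?_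
      simp only [Finset.sum_add_distrib]
      nlinarith [sq_nonneg (∑ i, h i ω - ∑ i, h' i ω)]
    rw [integral_const_mul, integral_add H.memLp_sum.integrable_sq H'.memLp_sum.integrable_sq] at this
    linarith [H.integral_sq_sum_le, H'.integral_sq_sum_le]
  integral_sum_sq_le := by
    have : ∫ ω, ∑ i, (h i ω + h' i ω) ^ 2 ∂P
        ≤ ∫ ω, 2 * (∑ i, h i ω ^ 2 + ∑ i, h' i ω ^ 2) ∂P := by
      refine integral_mono (integrable_finsetSum _ fun i _ =>
        ((H.memLp i).add (H'.memLp i)).integrable_sq)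
        ((H.integrable_sum_sq.add H'.integrable_sum_sq).const_mul 2) fun ω => ?_
      simp only
      rw [← Finset.sum_add_distrib, Finset.mul_sum]
      exact Finset.sum_le_sum fun i _ => by nlinarith [sq_nonneg (h i ω - h' i ω)]
    rw [integral_const_mul, integral_add H.integrable_sum_sq H'.integrable_sum_sq] at this
    linarith [H.integral_sum_sq_le, H'.integral_sum_sq_le]

end SecondMomentBound

variable {κ : Type*} [Fintype κ] {x z : Fin N → Ω → κ → ℝ} {S : κ → κ → ℝ}
  {C : κ → κ → κ → κ → ℝ}

theorem IsTwoSample.secondMomentBound_traceForm (h : IsTwoSample P x z S C) {σ τ : ℝ}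
    (hσ : σ = norm₄ C) (hτ : τ = ∑ a, ∑ b, S a b ^ 2) (hN : 0 < N) :
    SecondMomentBound P (fun i ω =>
        (traceForm S (selCoef i) (diffCoef i) (fun i => x i ω) (fun i => z i ω)
        + traceForm S (diffCoef i) (selCoef i) (fun i => x i ω) (fun i => z i ω))
        + traceForm S (diffCoef i) (diffCoef i) (fun i => x i ω) (fun i => z i ω))
      (2 * (2 * (20 * σ * (σ / N + τ) + 20 * σ * (σ / N + τ)) + 464 * (σ / N + τ) ^ 2 / N)) := by
  have hN1 : (1 : ℝ) ≤ N := by exact_mod_cast hN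
  have hN0 : (N : ℝ) ≠ 0 := by positivity
  have hσ0 : 0 ≤ σ := hσ ▸ norm₄_nonneg _
  have hτ0 : 0 ≤ τ := hτ ▸ Finset.sum_nonneg fun _ _ => Finset.sum_nonneg fun _ _ => sq_nonneg _
  have hB := fun i i' : Fin N => covBound_diffCoef_le hσ0 hτ0 i i'
  have hB0 := fun i i' : Fin N => covBound_nonneg hσ0 hτ0 (diffCoef i) (diffCoef i')
  have ht := fun c d c' d' hc hd => hσ ▸ hτ ▸ h.abs_integral_traceForm_mul_le c d c' d' hc hd
  set ρ := σ / N + τ with hρ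
  have hρ0 : 0 ≤ ρ := by positivity
  refine ((SecondMomentBound.of_abs_le (α := σ * (20 * ρ / N)) (β := 0)
    (fun i => h.memLp_traceForm _ _) le_rfl (fun i j => ?_) (le_of_eq ?_)).add
    (SecondMomentBound.of_abs_le (α := σ * (20 * ρ / N)) (β := 0)
    (fun i => h.memLp_traceForm _ _) le_rfl (fun i j => ?_) (le_of_eq ?_))).add
    (SecondMomentBound.of_abs_le (α := (20 * ρ / N) ^ 2) (β := (8 * ρ / (N : ℝ) ^ 2) ^ 2)
    (fun i => h.memLp_traceForm _ _) (by positivity) (fun i j => ?_) ?_)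
  · refine (ht _ _ _ _ (selCoef_symm _) (diffCoef_symm _)).trans ?_
    rw [covBound_selCoef]
    have := hB i j
    split_ifs at this ⊢
    · exact mul_le_mul_of_nonneg_left this hσ0
    · simp
  · field_simp
    ring
  · refine (ht _ _ _ _ (diffCoef_symm _) (selCoef_symm _)).trans ?_
    rw [covBound_selCoef, mul_comm]
    have := hB i j
    split_ifs at this ⊢
    · exact mul_le_mul_of_nonneg_left this hσ0
    · simp
  · field_simp
    ring
  · refine (ht _ _ _ _ (diffCoef_symm _) (diffCoef_symm _)).trans ?_
    rw [← sq]
    have := hB i j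
    split_ifs at this ⊢
    · exact pow_le_pow_left₀ (hB0 i j) this 2
    · exact pow_le_pow_left₀ (hB0 i j) this 2
  · have e : N * (20 * ρ / N) ^ 2 + (N : ℝ) ^ 2 * (8 * ρ / (N : ℝ) ^ 2) ^ 2
        = (400 + 64 * (1 / (N : ℝ))) * (ρ ^ 2 / N) := by
      field_simp
      ring
    have h1 : 1 / (N : ℝ) ≤ 1 := by rw [div_le_one (by positivity)]; exact hN1
    rw [e, mul_div_assoc]
    exact mul_le_mul_of_nonneg_right (by linarith) (by positivity)

theorem IsTwoSample.secondMomentBound_sumForm (h : IsTwoSample P x z S C) {k τ : ℝ}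
    (hk : k = ∑ a, ∑ b, ∑ a', ∑ b', C a b a' b') (hk0 : 0 ≤ k) (hτ : τ = (∑ a, ∑ b, S a b) ^ 2)
    (hN : 0 < N) :
    SecondMomentBound P (fun i ω =>
        sumForm S (diffCoef i) (fun i => x i ω) + sumForm S (diffCoef i) (fun i => z i ω))
      (2 * (28 * (k / N + τ) + 28 * (k / N + τ))) := by
  have hN0 : (N : ℝ) ≠ 0 := by positivity
  have hτ0 : 0 ≤ τ := hτ ▸ sq_nonneg _
  have hB := fun i i' : Fin N => covBound_diffCoef_le hk0 hτ0 i i'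
  have aux : ∀ {y : Fin N → Ω → κ → ℝ}, IsCenteredSample P y S C →
      SecondMomentBound P (fun i ω => sumForm S (diffCoef i) (fun i => y i ω))
        (28 * (k / N + τ)) := by
    intro y hy
    refine SecondMomentBound.of_abs_le (α := 20 * (k / N + τ) / N)
      (β := 8 * (k / N + τ) / (N : ℝ) ^ 2) (fun i => hy.memLp_sumForm _) (by positivity)
      (fun i j => ?_) (le_of_eq ?_)
    · refine le_trans ?_ (hB i j)
      have := hy.abs_integral_sumForm_mul_le (hk ▸ hk0) (diffCoef i) (diffCoef j) (diffCoef_symm _)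
      rwa [← hk, ← hτ] at this
    · field_simp
      ring
  exact (aux h.left).add (aux h.right)

end SecondMoments

section Identities

variable {N p : ℕ} (S : Matrix (Fin p) (Fin p) ℝ)

theorem quad_add {ι κ : Type*} [Fintype ι] [DecidableEq ι] (S : κ → κ → ℝ) (c d : ι → ι → ℝ)
    (a b : κ) (y : ι → κ → ℝ) :
    quad S (fun j k => c j k + d j k) a b y = quad S c a b y + quad S d a b y := by
  unfold quad
  simp_rw [add_mul, Finset.sum_add_distrib]

theorem quad_mul_mul {ι κ : Type*} [Fintype ι] [DecidableEq ι] (S : κ → κ → ℝ) (g : ι → ℝ)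
    (a b : κ) (y : ι → κ → ℝ) :
    quad S (fun j k => g j * g k) a b y
      = (∑ j, g j * y j a) * (∑ j, g j * y j b) - (∑ j, g j * g j) * S a b := by
  unfold quad centredProd
  rw [Finset.sum_mul_sum, Finset.sum_mul, ← Finset.sum_sub_distrib]
  refine Finset.sum_congr rfl fun j _ => ?_
  simp_rw [mul_sub, Finset.sum_sub_distrib]
  simp only [mul_ite, mul_zero, Finset.sum_ite_eq, Finset.mem_univ, if_true]
  congr 1
  exact Finset.sum_congr rfl fun k _ => by ring

theorem quad_selCoef {κ : Type*} (S : κ → κ → ℝ) (i : Fin N) (a b : κ) (y : Fin N → κ → ℝ) :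
    quad S (selCoef i) a b y = y i a * y i b - S a b := by
  have := quad_mul_mul S (fun j => if j = i then 1 else 0) a b y
  refine Eq.trans this ?_
  simp

theorem quad_devCoef {κ : Type*} (S : κ → κ → ℝ) (i : Fin N) (a b : κ) (y : Fin N → κ → ℝ) :
    quad S (fun j k => devCoef N i j * devCoef N i k) a b y
      = (y i a - 1 / N * ∑ j, y j a) * (y i b - 1 / N * ∑ j, y j b) - (N - 1) / N * S a b := by
  have hN : (N : ℝ) ≠ 0 := by
    have := i.pos
    positivity
  have e1 : ∀ a, ∑ j, devCoef N i j * y j a = y i a - 1 / N * ∑ j, y j a := by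
    intro a
    unfold devCoef
    simp_rw [sub_mul, Finset.sum_sub_distrib, ← Finset.mul_sum]
    simp
  have e2 : ∑ j, devCoef N i j * devCoef N i j = (N - 1) / N := by
    have := sum_indicator_mul_indicator i i 1 (-(1 / (N : ℝ))) 1 (-(1 / (N : ℝ)))
    simp only [← sub_eq_add_neg, if_true] at this
    unfold devCoef
    rw [this]
    field_simp
    ring
  rw [quad_mul_mul, e1, e1, e2]

theorem quad_devCoef_eq {κ : Type*} (S : κ → κ → ℝ) (i : Fin N) (a b : κ) (y : Fin N → κ → ℝ) :
    quad S (fun j k => devCoef N i j * devCoef N i k) a b y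
      = quad S (selCoef i) a b y + quad S (diffCoef i) a b y := by
  rw [← quad_add]
  unfold diffCoef
  simp

variable (u : Fin p → ℝ) (x : ℕ → Fin p → ℝ)

theorem oneForm_eq_sum (A : Matrix (Fin p) (Fin p) ℝ) : oneForm A = ∑ a, ∑ b, A a b := by
  simp [oneForm, dotProduct, mulVec]

theorem e_eq_traceForm (i : Fin N) : e N u S x i = traceForm S (selCoef i) (selCoef i)
    (fun j : Fin N => x j - u) (fun j : Fin N => x (j + N) - u) := by
  have hq : ∀ a b y, quad S (selCoef i) a b y = y i a * y i b - S a b := quad_selCoef S i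
  simp only [e, traceForm, hq, trace, diag_apply, Matrix.mul_apply, Matrix.sub_apply, outer,
    vecMulVec_apply]

theorem v_eq_sumForm (i : Fin N) : v N u S x i = sumForm S (selCoef i) (fun j : Fin N => x j - u)
    + sumForm S (selCoef i) (fun j : Fin N => x (j + N) - u) := by
  have hq : ∀ a b y, quad S (selCoef i) a b y = y i a * y i b - S a b := quad_selCoef S i
  simp only [v, sumForm, hq, oneForm_eq_sum, Matrix.sub_apply, Matrix.add_apply, outer,
    vecMulVec_apply, Matrix.smul_apply, smul_eq_mul, ← Finset.sum_add_distrib]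
  exact Finset.sum_congr rfl fun a _ => Finset.sum_congr rfl fun b _ => by ring

theorem sub_mean₁_apply (i : Fin N) (a : Fin p) : (x i - mean₁ N x) a
    = (x i - u) a - 1 / N * ∑ j : Fin N, (x j - u) a := by
  have hN : (N : ℝ) ≠ 0 := by
    have := i.pos
    positivity
  simp only [mean₁, Pi.sub_apply, Pi.smul_apply, Finset.sum_apply, smul_eq_mul, Finset.sum_sub_distrib,
    Finset.sum_const, Finset.card_univ, Fintype.card_fin, nsmul_eq_mul,
    Fin.sum_univ_eq_sum_range (fun j => x j a) N]
  field_simp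
  ring

theorem sub_mean₂_apply (i : Fin N) (a : Fin p) : (x (i + N) - mean₂ N x) a
    = (x (i + N) - u) a - 1 / N * ∑ j : Fin N, (x (j + N) - u) a := by
  have hN : (N : ℝ) ≠ 0 := by
    have := i.pos
    positivity
  simp only [mean₂, Pi.sub_apply, Pi.smul_apply, Finset.sum_apply, smul_eq_mul, Finset.sum_sub_distrib,
    Finset.sum_const, Finset.card_univ, Fintype.card_fin, nsmul_eq_mul,
    Fin.sum_univ_eq_sum_range (fun j => x (j + N) a) N]
  field_simp
  ring

theorem outer_mean₁_sub (i : Fin N) (a b : Fin p) :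
    (outer (x i) (mean₁ N x) - (((N : ℝ) - 1) / N) • S) a b
      = quad S (selCoef i) a b (fun j : Fin N => x j - u)
        + quad S (diffCoef i) a b (fun j : Fin N => x j - u) := by
  refine Eq.trans ?_ ((quad_devCoef S i a b _).symm.trans (quad_devCoef_eq S i a b _))
  rw [Matrix.sub_apply, outer, Matrix.smul_apply, smul_eq_mul, vecMulVec_apply]
  simp only [sub_mean₁_apply u x]

theorem outer_mean₂_sub (i : Fin N) (a b : Fin p) :
    (outer (x (i + N)) (mean₂ N x) - (((N : ℝ) - 1) / N) • S) a b
      = quad S (selCoef i) a b (fun j : Fin N => x (j + N) - u)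
        + quad S (diffCoef i) a b (fun j : Fin N => x (j + N) - u) := by
  refine Eq.trans ?_ ((quad_devCoef S i a b _).symm.trans (quad_devCoef_eq S i a b _))
  rw [Matrix.sub_apply, outer, Matrix.smul_apply, smul_eq_mul, vecMulVec_apply]
  simp only [sub_mean₂_apply u x]

theorem eStar_sub_e (i : Fin N) : eStar N S x i - e N u S x i =
    (traceForm S (selCoef i) (diffCoef i) (fun j : Fin N => x j - u) (fun j : Fin N => x (j + N) - u)
    + traceForm S (diffCoef i) (selCoef i) (fun j : Fin N => x j - u) (fun j : Fin N => x (j + N) - u))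
    + traceForm S (diffCoef i) (diffCoef i) (fun j : Fin N => x j - u)
      (fun j : Fin N => x (j + N) - u) := by
  rw [e_eq_traceForm]
  unfold eStar
  simp only [trace, diag_apply, Matrix.mul_apply, outer_mean₁_sub S u x, outer_mean₂_sub S u x, traceForm,
    ← Finset.sum_add_distrib, ← Finset.sum_sub_distrib]
  exact Finset.sum_congr rfl fun a _ => Finset.sum_congr rfl fun b _ => by ring

theorem vStar_sub_v (i : Fin N) : vStar N S x i - v N u S x i =
    sumForm S (diffCoef i) (fun j : Fin N => x j - u)
    + sumForm S (diffCoef i) (fun j : Fin N => x (j + N) - u) := by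
  have h : vStar N S x i = oneForm ((outer (x i) (mean₁ N x) - (((N : ℝ) - 1) / N) • S)
      + (outer (x (i + N)) (mean₂ N x) - (((N : ℝ) - 1) / N) • S)) := by
    unfold vStar
    congr 1
    have : (2 * ((N : ℝ) - 1) / N) = ((N : ℝ) - 1) / N + ((N : ℝ) - 1) / N := by ring
    rw [this, add_smul]
    abel
  rw [h, v_eq_sumForm, oneForm_eq_sum]
  simp only [Matrix.add_apply, outer_mean₁_sub S u x, outer_mean₂_sub S u x, sumForm,
    ← Finset.sum_add_distrib, ← Finset.sum_sub_distrib]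
  exact Finset.sum_congr rfl fun a _ => Finset.sum_congr rfl fun b _ => by ring

end Identities

section MainMoments

set_option linter.unusedSectionVars false

variable {Ω : Type*} [MeasurableSpace Ω] {P : Measure Ω} {N : ℕ} {κ : Type*} [Fintype κ]
  {x z : Fin N → Ω → κ → ℝ} {S : κ → κ → ℝ} {C : κ → κ → κ → κ → ℝ}

theorem IsCenteredSample.integral_quad (h : IsCenteredSample P x S C) (i : Fin N) (a b : κ) :
    ∫ ω, quad S (selCoef i) a b (fun i => x i ω) ∂P = 0 := by
  have := h.integral_centredProd_self i a b
  simp_rw [quad_selCoef]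
  simpa [centredProd] using this

theorem IsCenteredSample.cov_symm (h : IsCenteredSample P x S C) (i : Fin N) (a b : κ) :
    S a b = S b a := by
  rw [← h.cov i, ← h.cov i]
  exact integral_congr_ae (ae_of_all _ fun ω => mul_comm _ _)

theorem IsCenteredSample.cov₄_swap (h : IsCenteredSample P x S C) (i : Fin N) (a b a' b' : κ) :
    C b a b' a' = C a b a' b' := by
  rw [← h.cov₄ i, ← h.cov₄ i, h.cov_symm i a b, h.cov_symm i a' b']
  exact integral_congr_ae (ae_of_all _ fun ω => by simp only; ring)

namespace IsTwoSample

theorem integral_traceForm_sq (h : IsTwoSample P x z S C) (i : Fin N) :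
    ∫ ω, traceForm S (selCoef i) (selCoef i) (fun i => x i ω) (fun i => z i ω) ^ 2 ∂P
      = norm₄ C ^ 2 := by
  simp_rw [sq (traceForm _ _ _ _ _)]
  rw [h.integral_traceForm_mul _ _ _ _ (selCoef_symm i) (selCoef_symm i), sq_norm₄,
    diagInner_selCoef, offInner_selCoef]
  refine Finset.sum_congr rfl fun a _ => Finset.sum_congr rfl fun b _ => Finset.sum_congr rfl
    fun a' _ => Finset.sum_congr rfl fun b' _ => ?_
  rw [h.left.cov₄_swap i a b a' b']
  simp [sq]

theorem integral_traceForm (h : IsTwoSample P x z S C) (i : Fin N) :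
    ∫ ω, traceForm S (selCoef i) (selCoef i) (fun i => x i ω) (fun i => z i ω) ∂P = 0 := by
  have := h.left.isProbabilityMeasure
  unfold traceForm
  have hi : ∀ a b, Integrable (fun ω => quad S (selCoef i) a b (fun i => x i ω)
      * quad S (selCoef i) b a (fun i => z i ω)) P := fun a b =>
    (h.memLp_quad_mul (selCoef i) (selCoef i) a b b a).integrable (by norm_num)
  rw [integral_finsetSum _ fun a _ => integrable_finsetSum _ fun b _ => hi a b]
  refine Finset.sum_eq_zero fun a _ => ?_
  rw [integral_finsetSum _ fun b _ => hi a b]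
  refine Finset.sum_eq_zero fun b _ => ?_
  have e := (h.indepFun_comp (measurable_quad S (selCoef i) a b)
    (measurable_quad S (selCoef i) b a)).integral_mul_eq_mul_integral
    (h.left.memLp_quad _ a b).aestronglyMeasurable (h.right.memLp_quad _ b a).aestronglyMeasurable
  simp only [Pi.mul_apply] at e
  rw [e, h.left.integral_quad, zero_mul]

end IsTwoSample

theorem IsCenteredSample.integral_sumForm (h : IsCenteredSample P x S C) (i : Fin N) :
    ∫ ω, sumForm S (selCoef i) (fun i => x i ω) ∂P = 0 := by
  have := h.isProbabilityMeasure
  have hi : ∀ a b, Integrable (fun ω => quad S (selCoef i) a b (fun i => x i ω)) P := fun a b =>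
    (h.memLp_quad (selCoef i) a b).integrable (by norm_num)
  unfold sumForm
  rw [integral_finsetSum _ fun a _ => integrable_finsetSum _ fun b _ => hi a b]
  refine Finset.sum_eq_zero fun a _ => ?_
  rw [integral_finsetSum _ fun b _ => hi a b]
  exact Finset.sum_eq_zero fun b _ => h.integral_quad i a b

theorem IsCenteredSample.integral_sumForm_sq (h : IsCenteredSample P x S C) (i : Fin N) :
    ∫ ω, sumForm S (selCoef i) (fun i => x i ω) ^ 2 ∂P = ∑ a, ∑ b, ∑ a', ∑ b', C a b a' b' := by
  have := h.sum_covariance (selCoef i) (selCoef i) (selCoef_symm i)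
  rw [diagInner_selCoef, offInner_selCoef] at this
  simp_rw [sq (sumForm _ _ _)]
  unfold sumForm
  rw [this]
  simp

theorem measurable_sumForm {ι : Type*} [Fintype ι] [DecidableEq ι] (c : ι → ι → ℝ) :
    Measurable (sumForm S c) := by
  unfold sumForm
  exact Finset.measurable_fun_sum _ fun a _ => Finset.measurable_fun_sum _ fun b _ =>
    measurable_quad S c a b

namespace IsTwoSample

theorem symm (h : IsTwoSample P x z S C) : IsTwoSample P z x S C :=
  ⟨h.right, h.left, h.indepFun.symm⟩

theorem integral_sumForm_add_sq (h : IsTwoSample P x z S C) (i : Fin N) :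
    ∫ ω, (sumForm S (selCoef i) (fun i => x i ω) + sumForm S (selCoef i) (fun i => z i ω)) ^ 2 ∂P
      = 2 * ∑ a, ∑ b, ∑ a', ∑ b', C a b a' b' := by
  have hx := h.left.memLp_sumForm (selCoef i)
  have hz := h.right.memLp_sumForm (selCoef i)
  have e : ∫ ω, sumForm S (selCoef i) (fun i => x i ω) * sumForm S (selCoef i) (fun i => z i ω) ∂P = 0 := by
    have e := (h.indepFun_comp (measurable_sumForm (S := S) (selCoef i))
      (measurable_sumForm (S := S) (selCoef i))).integral_mul_eq_mul_integral
      hx.aestronglyMeasurable hz.aestronglyMeasurable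
    simp only [Pi.mul_apply] at e
    rw [e, h.left.integral_sumForm, zero_mul]
  have hxz : Integrable (fun ω => sumForm S (selCoef i) (fun i => x i ω)
      * sumForm S (selCoef i) (fun i => z i ω)) P := hx.integrable_mul hz
  have h1 : Integrable (fun ω => sumForm S (selCoef i) (fun i => x i ω) ^ 2
      + 2 * (sumForm S (selCoef i) (fun i => x i ω) * sumForm S (selCoef i) (fun i => z i ω))) P :=
    hx.integrable_sq.add (hxz.const_mul 2)
  simp_rw [add_sq, mul_assoc]
  rw [integral_add h1 hz.integrable_sq,
    integral_add hx.integrable_sq (hxz.const_mul 2), integral_const_mul, e,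
    h.left.integral_sumForm_sq, h.right.integral_sumForm_sq]
  ring

theorem integral_traceForm_mul_sumForm (h : IsTwoSample P x z S C) (i : Fin N) :
    ∫ ω, traceForm S (selCoef i) (selCoef i) (fun i => x i ω) (fun i => z i ω)
      * sumForm S (selCoef i) (fun i => x i ω) ∂P = 0 := by
  have hs := h.left.memLp_sumForm (selCoef i)
  have hi : ∀ a b, Integrable (fun ω => quad S (selCoef i) a b (fun i => x i ω)
      * quad S (selCoef i) b a (fun i => z i ω) * sumForm S (selCoef i) (fun i => x i ω)) P :=
    fun a b => (h.memLp_quad_mul (selCoef i) (selCoef i) a b b a).integrable_mul hs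
  unfold traceForm
  simp_rw [Finset.sum_mul]
  rw [integral_finsetSum _ fun a _ => integrable_finsetSum _ fun b _ => hi a b]
  refine Finset.sum_eq_zero fun a _ => ?_
  rw [integral_finsetSum _ fun b _ => hi a b]
  refine Finset.sum_eq_zero fun b _ => ?_
  have e := (h.indepFun_comp ((measurable_quad S (selCoef i) a b).mul
    (measurable_sumForm (S := S) (selCoef i)))
    (measurable_quad S (selCoef i) b a)).integral_mul_eq_mul_integral
    ((h.left.memLp_quad _ a b).aestronglyMeasurable.mul hs.aestronglyMeasurable)
    (h.right.memLp_quad _ b a).aestronglyMeasurable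
  simp only [Pi.mul_apply, h.right.integral_quad, mul_zero] at e
  rw [← e]
  exact integral_congr_ae (ae_of_all _ fun ω => by simp only; ring)

theorem traceForm_comm {κ ι : Type*} [Fintype κ] [Fintype ι] [DecidableEq ι] (S : κ → κ → ℝ)
    (c d : ι → ι → ℝ) (y y' : ι → κ → ℝ) : traceForm S c d y y' = traceForm S d c y' y := by
  unfold traceForm
  rw [Finset.sum_comm]
  exact Finset.sum_congr rfl fun _ _ => Finset.sum_congr rfl fun _ _ => mul_comm _ _

theorem integral_traceForm_mul_sumForm_add (h : IsTwoSample P x z S C) (i : Fin N) :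
    ∫ ω, traceForm S (selCoef i) (selCoef i) (fun i => x i ω) (fun i => z i ω)
      * (sumForm S (selCoef i) (fun i => x i ω) + sumForm S (selCoef i) (fun i => z i ω)) ∂P = 0 := by
  have h1 := h.integral_traceForm_mul_sumForm i
  have h2 := h.symm.integral_traceForm_mul_sumForm i
  simp_rw [traceForm_comm S (selCoef i) (selCoef i) (fun i => z i _)] at h2
  have ht := h.memLp_traceForm (selCoef i) (selCoef i)
  simp_rw [mul_add]
  refine (integral_add (ht.integrable_mul (h.left.memLp_sumForm (selCoef i)))
    (ht.integrable_mul (h.right.memLp_sumForm (selCoef i)))).trans ?_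
  simp only [Pi.mul_apply]
  rw [h1, h2, add_zero]

theorem memLp_sumForm_add (h : IsTwoSample P x z S C) (c : Fin N → Fin N → ℝ) :
    MemLp (fun ω => sumForm S c (fun i => x i ω) + sumForm S c (fun i => z i ω)) 2 P :=
  (h.left.memLp_sumForm c).add (h.right.memLp_sumForm c)

theorem integral_sumForm_add (h : IsTwoSample P x z S C) (i : Fin N) :
    ∫ ω, (sumForm S (selCoef i) (fun i => x i ω) + sumForm S (selCoef i) (fun i => z i ω)) ∂P = 0 := by
  have := h.left.isProbabilityMeasure
  rw [integral_add ((h.left.memLp_sumForm _).integrable (by norm_num))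
    ((h.right.memLp_sumForm _).integrable (by norm_num)), h.left.integral_sumForm,
    h.right.integral_sumForm, add_zero]

end IsTwoSample

end MainMoments

/-- If `⟨Φ s, Φ t⟩` is square integrable for independent copies `Φ s`, `Φ t` of a random vector of
a finite-dimensional space, then so are all linear functionals of `Φ s`. -/
theorem memLp_inner_of_memLp_prod {E : Type*} [NormedAddCommGroup E] [InnerProductSpace ℝ E]
    [FiniteDimensional ℝ E] {α : Type*} [MeasurableSpace α] {ν : Measure α} [SFinite ν]
    {Φ : α → E} (hΦ : ∀ w, Measurable fun s => inner ℝ w (Φ s))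
    (h : MemLp (fun q : α × α => inner ℝ (Φ q.2) (Φ q.1)) 2 (ν.prod ν)) (w : E) :
    MemLp (fun s => inner ℝ w (Φ s)) 2 ν := by
  let U : Submodule ℝ E :=
    { carrier := {w | MemLp (fun s => inner ℝ w (Φ s)) 2 ν}
      add_mem' := fun {a b} ha hb => by
        simp only [Set.mem_ofPred_eq, inner_add_left] at *
        exact ha.add hb
      zero_mem' := by simp
      smul_mem' := fun c a ha => by
        simp only [Set.mem_ofPred_eq, real_inner_smul_left] at *
        exact ha.const_mul c }
  have hU : ∀ᵐ t ∂ν, Φ t ∈ U := by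
    filter_upwards [h.integrable_sq.prod_left_ae] with t ht
    exact (memLp_two_iff_integrable_sq (hΦ (Φ t)).aestronglyMeasurable).mpr ht
  have hP : MemLp (fun s => inner ℝ (U.starProjection w) (Φ s)) 2 ν := U.starProjection_apply_mem w
  refine (memLp_congr_ae ?_).mp hP
  filter_upwards [hU] with t ht
  have := U.starProjection_inner_eq_zero w (Φ t) ht
  rw [inner_sub_left] at this
  linarith

theorem iIndepFun_prodMk {Ω ι α β : Type*} [Fintype ι] [MeasurableSpace Ω] [MeasurableSpace α]
    [MeasurableSpace β] {P : Measure Ω} {x : ι → Ω → α} {z : ι → Ω → β} (hx : iIndepFun x P)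
    (hz : iIndepFun z P) (hxm : ∀ i, AEMeasurable (x i) P) (hzm : ∀ i, AEMeasurable (z i) P)
    (h : IndepFun (fun ω i => x i ω) (fun ω i => z i ω) P) :
    iIndepFun (fun i ω => (x i ω, z i ω)) P := by
  have := hx.isProbabilityMeasure
  have hm : ∀ i, AEMeasurable (fun ω => (x i ω, z i ω)) P := fun i => (hxm i).prodMk (hzm i)
  have hxp := aemeasurable_pi_lambda (fun ω i => x i ω) hxm
  have hzp := aemeasurable_pi_lambda (fun ω i => z i ω) hzm
  rw [iIndepFun_iff_map_fun_eq_pi_map hm]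
  have hpx : ∀ i, IsProbabilityMeasure (P.map (x i)) := fun i => Measure.isProbabilityMeasure_map (hxm i)
  have hpz : ∀ i, IsProbabilityMeasure (P.map (z i)) := fun i => Measure.isProbabilityMeasure_map (hzm i)
  have hpair : ∀ i, P.map (fun ω => (x i ω, z i ω)) = (P.map (x i)).prod (P.map (z i)) := fun i =>
    (indepFun_iff_map_prod_eq_prod_map_map (hxm i) (hzm i)).mp
      (h.comp (φ := fun y : ι → α => y i) (ψ := fun y : ι → β => y i) (measurable_pi_apply i)
        (measurable_pi_apply i))
  simp_rw [hpair]
  have e := (indepFun_iff_map_prod_eq_prod_map_map hxp hzp).mp h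
  rw [hx.map_fun_eq_pi_map hxm, hz.map_fun_eq_pi_map hzm,
    ← (measurePreserving_arrowProdEquivProdArrow α β ι (fun i => P.map (x i))
      (fun i => P.map (z i))).map_eq] at e
  refine (MeasurableEquiv.arrowProdEquivProdArrow α β ι).map_measurableEquiv_injective ?_
  rw [← e, AEMeasurable.map_map_of_aemeasurable (MeasurableEquiv.measurable _).aemeasurable
    (aemeasurable_pi_lambda _ hm)]
  rfl

section Sample

variable {Ω : Type*} [MeasurableSpace Ω] {P : Measure Ω} {n p N : ℕ}
  {X : ℕ → Ω → Fin p → ℝ} {u : Fin p → ℝ} {S : Matrix (Fin p) (Fin p) ℝ}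

namespace IsSample

theorem isProbabilityMeasure (h : IsSample P n p X u S) : IsProbabilityMeasure P :=
  h.indep.isProbabilityMeasure

theorem indepFun_blocks (h : IsSample P n p X u S) (hN : 2 * N ≤ n) :
    IndepFun (fun ω (i : Fin N) => X i ω) (fun ω (i : Fin N) => X (i + N) ω) P := by
  have hl : ∀ i : Fin N, (i : ℕ) < n := fun i => by omega
  have hr : ∀ i : Fin N, (i : ℕ) + N < n := fun i => by omega
  let A : Finset (Fin n) := Finset.univ.image fun i : Fin N => ⟨i, hl i⟩
  let B : Finset (Fin n) := Finset.univ.image fun i : Fin N => ⟨i + N, hr i⟩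
  have hd : Disjoint A B := by
    rw [Finset.disjoint_left]
    intro j hj hj'
    simp only [A, B, Finset.mem_image, Finset.mem_univ, true_and] at hj hj'
    obtain ⟨i, rfl⟩ := hj
    obtain ⟨k, hk⟩ := hj'
    have := congrArg Fin.val hk
    simp only at this
    omega
  have hi := h.indep.indepFun_finset₀ A B hd fun i => h.aemeasurable i i.2
  exact hi.comp
    (φ := fun y (i : Fin N) => y ⟨⟨i, hl i⟩, Finset.mem_image_of_mem _ (Finset.mem_univ i)⟩)
    (ψ := fun y (i : Fin N) => y ⟨⟨i + N, hr i⟩,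
      Finset.mem_image_of_mem (fun i : Fin N => (⟨i + N, hr i⟩ : Fin n)) (Finset.mem_univ i)⟩)
    (by fun_prop) (by fun_prop)

theorem iIndepFun_pairs (h : IsSample P n p X u S) (hN : 2 * N ≤ n) :
    iIndepFun (fun (i : Fin N) ω => (X i ω, X (i + N) ω)) P := by
  have hl : ∀ i : Fin N, (i : ℕ) < n := fun i => by omega
  have hr : ∀ i : Fin N, (i : ℕ) + N < n := fun i => by omega
  refine iIndepFun_prodMk (x := fun (i : Fin N) ω => X i ω) (z := fun (i : Fin N) ω => X (i + N) ω)
    (h.indep.precomp (g := fun i : Fin N => (⟨i, hl i⟩ : Fin n)) ?_)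
    (h.indep.precomp (g := fun i : Fin N => (⟨i + N, hr i⟩ : Fin n)) ?_)
    (fun i => h.aemeasurable _ (hl i)) (fun i => h.aemeasurable _ (hr i)) (h.indepFun_blocks hN)
  · intro i j hij
    have := congrArg Fin.val hij
    simp only at this
    omega
  · intro i j hij
    have := congrArg Fin.val hij
    simp only at this
    omega

theorem indepFun_of_ne (h : IsSample P n p X u S) {i j : ℕ} (hi : i < n) (hj : j < n) (hij : i ≠ j) :
    IndepFun (X i) (X j) P :=
  h.indep.indepFun (i := ⟨i, hi⟩) (j := ⟨j, hj⟩) fun e => hij (congrArg Fin.val e)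

theorem identDistrib_pairs (h : IsSample P n p X u S) (hN : 2 * N ≤ n) (i j : Fin N) :
    IdentDistrib (fun ω => (X i ω, X (i + N) ω)) (fun ω => (X j ω, X (j + N) ω)) P P := by
  have := h.isProbabilityMeasure
  have hp := i.pos
  exact (h.identDistrib _ (by omega) _ (by omega)).prodMk (h.identDistrib _ (by omega) _ (by omega))
    (h.indepFun_of_ne (by omega) (by omega) (by omega))
    (h.indepFun_of_ne (by omega) (by omega) (by omega))

theorem integral_sub (h : IsSample P n p X u S) {i : ℕ} (hi : i < n) (a : Fin p) :
    ∫ ω, (X i ω - u) a ∂P = 0 := by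
  have := h.isProbabilityMeasure
  simp only [Pi.sub_apply]
  rw [MeasureTheory.integral_sub ((h.memLp_two i hi a).integrable (by norm_num))
    (integrable_const _), h.mean i hi a]
  simp

theorem integral_sub_mul_sub (h : IsSample P n p X u S) {i : ℕ} (hi : i < n) (a b : Fin p) :
    ∫ ω, (X i ω - u) a * (X i ω - u) b ∂P = S a b := by
  have := h.cov i hi a b
  rwa [covariance, h.mean i hi a, h.mean i hi b] at this

theorem cov_symm (h : IsSample P n p X u S) (hn : 0 < n) (a b : Fin p) : S a b = S b a := by
  rw [← h.integral_sub_mul_sub hn, ← h.integral_sub_mul_sub hn]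
  simp_rw [mul_comm]

theorem memLp_sq_sub (h : IsSample P n p X u S) (hN : 2 * N ≤ n) (hN0 : 0 < N)
    (he : MemLp (fun ω => e N u S (fun i => X i ω) 0) 2 P) {i : ℕ} (hi : i < n) (a : Fin p) :
    MemLp (fun ω => (X i ω - u) a ^ 2) 2 P := by
  have := h.isProbabilityMeasure
  have h0 : 0 < n := by omega
  have hNn : 0 + N < n := by omega
  let Φ : (Fin p → ℝ) → EuclideanSpace ℝ (Fin p × Fin p) := fun s =>
    WithLp.toLp 2 fun q => (s - u) q.1 * (s - u) q.2 - S q.1 q.2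
  have hin : ∀ w s, inner ℝ w (Φ s) = ∑ q : Fin p × Fin p, ((s - u) q.1 * (s - u) q.2 - S q.1 q.2) * w q :=
    fun w s => by
      rw [PiLp.inner_apply]
      rfl
  have hΦ : ∀ w, Measurable fun s => inner ℝ w (Φ s) := by
    intro w
    simp_rw [hin]
    simp only [Pi.sub_apply]
    fun_prop
  have hlaw : P.map (fun ω => (X 0 ω, X (0 + N) ω)) = (P.map (X 0)).prod (P.map (X 0)) := by
    rw [(indepFun_iff_map_prod_eq_prod_map_map (h.aemeasurable 0 h0) (h.aemeasurable _ hNn)).mp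
      (h.indepFun_of_ne h0 hNn (by omega)), (h.identDistrib 0 h0 _ hNn).map_eq]
  have hpair : AEMeasurable (fun ω => (X 0 ω, X (0 + N) ω)) P :=
    (h.aemeasurable 0 h0).prodMk (h.aemeasurable _ hNn)
  have hprod : MemLp (fun q : (Fin p → ℝ) × (Fin p → ℝ) => inner ℝ (Φ q.2) (Φ q.1)) 2
      ((P.map (X 0)).prod (P.map (X 0))) := by
    rw [← hlaw, memLp_map_measure_iff _ hpair]
    · refine (memLp_congr_ae (ae_of_all _ fun ω => ?_)).mp he
      simp only [Function.comp_apply, hin, e, trace, diag_apply, Matrix.mul_apply, Matrix.sub_apply,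
        outer, vecMulVec_apply, Fintype.sum_prod_type, Φ]
      refine Finset.sum_congr rfl fun b _ => Finset.sum_congr rfl fun c _ => ?_
      rw [h.cov_symm h0 c b]
      ring
    · refine Measurable.aestronglyMeasurable ?_
      simp_rw [hin]
      simp only [Φ, Pi.sub_apply]
      fun_prop
  have hX0 := memLp_inner_of_memLp_prod hΦ hprod (EuclideanSpace.single (a, a) 1)
  have hXi : MemLp (fun s => inner ℝ (EuclideanSpace.single (a, a) (1 : ℝ)) (Φ s)) 2 (P.map (X i)) := by
    rwa [(h.identDistrib i hi 0 h0).map_eq]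
  have := (hXi.comp_of_map (h.aemeasurable i hi)).add (memLp_const (S a a))
  refine (memLp_congr_ae (ae_of_all _ fun ω => ?_)).mp this
  simp only [Pi.add_apply, Function.comp_apply, EuclideanSpace.inner_single_left, Φ]
  simp [sq]

theorem isCenteredSample (h : IsSample P n p X u S)
    (hsq : ∀ i < n, ∀ a, MemLp (fun ω => (X i ω - u) a ^ 2) 2 P) (hn : 0 < n) {φ : Fin N → ℕ}
    (hφ : ∀ i, φ i < n) (hinj : Function.Injective φ) :
    IsCenteredSample P (fun i ω => X (φ i) ω - u) S fun a b c d =>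
      ∫ ω, ((X 0 ω - u) a * (X 0 ω - u) b - S a b) * ((X 0 ω - u) c * (X 0 ω - u) d - S c d) ∂P where
  aemeasurable i := (h.aemeasurable _ (hφ i)).sub_const u
  indep := (h.indep.precomp (g := fun i => (⟨φ i, hφ i⟩ : Fin n)) fun i j hij =>
    hinj (congrArg Fin.val hij)).comp (fun _ y => y - u) fun _ => measurable_id.sub_const u
  memLp_sq i a := hsq _ (hφ i) a
  mean i a := h.integral_sub (hφ i) a
  cov i a b := h.integral_sub_mul_sub (hφ i) a b
  cov₄ i a b c d := by
    have hm : Measurable fun s : Fin p → ℝ =>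
        ((s - u) a * (s - u) b - S a b) * ((s - u) c * (s - u) d - S c d) := by
      simp only [Pi.sub_apply]
      fun_prop
    exact ((h.identDistrib _ (hφ i) 0 hn).comp hm).integral_eq

theorem exists_isTwoSample (h : IsSample P n p X u S) (hN : 2 * N ≤ n) (hN0 : 0 < N)
    (he : MemLp (fun ω => e N u S (fun i => X i ω) 0) 2 P) :
    ∃ C, IsTwoSample P (fun (i : Fin N) ω => X i ω - u) (fun (i : Fin N) ω => X (i + N) ω - u) S C :=
  ⟨_, h.isCenteredSample (fun _ hi a => h.memLp_sq_sub hN hN0 he hi a) (by omega)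
      (fun i => by omega) Fin.val_injective,
    h.isCenteredSample (fun _ hi a => h.memLp_sq_sub hN hN0 he hi a) (by omega)
      (φ := fun i => i + N) (fun i => by omega) (fun i j hij => by simp only at hij; omega),
    (h.indepFun_blocks hN).comp (φ := fun (y : Fin N → Fin p → ℝ) i => y i - u)
      (ψ := fun (y : Fin N → Fin p → ℝ) i => y i - u) (by fun_prop) (by fun_prop)⟩

end IsSample

end Sample

/-- An independent sample of uncorrelated centred pairs with variances `A` and `B`. -/
structure IsUncorrelatedSample {Ω : Type*} [MeasurableSpace Ω] (P : Measure Ω) {N : ℕ}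
    (f g : Fin N → Ω → ℝ) (A B : ℝ) : Prop where
  memLp_left : ∀ i, MemLp (f i) 2 P
  memLp_right : ∀ i, MemLp (g i) 2 P
  indep : iIndepFun (fun i ω => (f i ω, g i ω)) P
  mean_left : ∀ i, ∫ ω, f i ω ∂P = 0
  mean_right : ∀ i, ∫ ω, g i ω ∂P = 0
  var_left : ∀ i, ∫ ω, f i ω ^ 2 ∂P = A
  var_right : ∀ i, ∫ ω, g i ω ^ 2 ∂P = B
  uncorrelated : ∀ i, ∫ ω, f i ω * g i ω ∂P = 0

section Pairs

variable {Ω : Type*} [MeasurableSpace Ω] {P : Measure Ω} {N : ℕ} {f g : Fin N → Ω → ℝ} {A B : ℝ}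

namespace IsUncorrelatedSample

theorem isProbabilityMeasure (h : IsUncorrelatedSample P f g A B) : IsProbabilityMeasure P :=
  h.indep.isProbabilityMeasure

theorem memLp_combination (h : IsUncorrelatedSample P f g A B) (a b : ℝ) (i : Fin N) :
    MemLp (fun ω => a * f i ω + b * g i ω) 2 P :=
  ((h.memLp_left i).const_mul a).add ((h.memLp_right i).const_mul b)

theorem integral_combination (h : IsUncorrelatedSample P f g A B) (a b : ℝ) (i : Fin N) :
    ∫ ω, (a * f i ω + b * g i ω) ∂P = 0 := by
  have := h.isProbabilityMeasure
  rw [integral_add (((h.memLp_left i).integrable (by norm_num)).const_mul a)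
    (((h.memLp_right i).integrable (by norm_num)).const_mul b), integral_const_mul,
    integral_const_mul, h.mean_left, h.mean_right]
  simp

theorem integral_combination_sq (h : IsUncorrelatedSample P f g A B) (a b : ℝ) (i : Fin N) :
    ∫ ω, (a * f i ω + b * g i ω) ^ 2 ∂P = a ^ 2 * A + b ^ 2 * B := by
  have e : ∀ ω, (a * f i ω + b * g i ω) ^ 2
      = (a ^ 2 * f i ω ^ 2 + b ^ 2 * g i ω ^ 2) + 2 * a * b * (f i ω * g i ω) := fun ω => by ring
  have h1 := (h.memLp_left i).integrable_sq.const_mul (a ^ 2)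
  have h2 := (h.memLp_right i).integrable_sq.const_mul (b ^ 2)
  have h3 : Integrable (fun ω => f i ω * g i ω) P := (h.memLp_left i).integrable_mul (h.memLp_right i)
  have h12 : Integrable (fun ω => a ^ 2 * f i ω ^ 2 + b ^ 2 * g i ω ^ 2) P := h1.add h2
  simp_rw [e]
  rw [integral_add h12 (h3.const_mul _), integral_add h1 h2, integral_const_mul, integral_const_mul,
    integral_const_mul, h.var_left, h.var_right, h.uncorrelated]
  ring

theorem indep_combination (h : IsUncorrelatedSample P f g A B) (a b : ℝ) :
    iIndepFun (fun i ω => a * f i ω + b * g i ω) P :=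
  h.indep.comp (fun _ q => a * q.1 + b * q.2) fun _ => by fun_prop

end IsUncorrelatedSample

end Pairs

section Arrays

variable {Ω : ℕ → Type*} [∀ n, MeasurableSpace (Ω n)] {P : ∀ n, Measure (Ω n)}
  {N : ℕ → ℕ}

/-- Lyapunov's condition implies Lindeberg's condition. -/
theorem tendsto_sum_integral_truncSq [∀ n, IsProbabilityMeasure (P n)] (hN : Tendsto N atTop atTop) {δ : ℝ} (hδ : 0 < δ)
    {f : ∀ n, Fin (N n) → Ω n → ℝ} {f₁ : ∀ n, Ω n → ℝ}
    (hid : ∀ᶠ n in atTop, ∀ i, IdentDistrib (f n i) (f₁ n) (P n) (P n))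
    (hm : ∀ᶠ n in atTop, MemLp (f₁ n) (ENNReal.ofReal (2 + δ)) (P n))
    (hpos : ∀ᶠ n in atTop, 0 < ∫ ω, f₁ n ω ^ 2 ∂P n)
    (hratio : (fun n => (∫ ω, |f₁ n ω| ^ (2 + δ) ∂P n) / (∫ ω, f₁ n ω ^ 2 ∂P n) ^ ((2 + δ) / 2))
      =o[atTop] fun n => (N n : ℝ) ^ (δ / 2))
    (c : ℝ) {η : ℝ} (hη : 0 < η) :
    Tendsto (fun n => ∑ i, ∫ ω, truncSq η
      (c * ((√(∫ ω, f₁ n ω ^ 2 ∂P n) * √(N n))⁻¹ * f n i ω)) ∂P n) atTop (𝓝 0) := by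
  have h0 := (hratio.tendsto_div_nhds_zero).const_mul (η ^ (-δ) * |c| ^ (2 + δ))
  rw [mul_zero] at h0
  refine tendsto_of_tendsto_of_tendsto_of_le_of_le' tendsto_const_nhds h0
    (Eventually.of_forall fun n => Finset.sum_nonneg fun i _ =>
      integral_nonneg fun ω => truncSq_nonneg _ _) ?_
  filter_upwards [hid, hm, hpos, hN.eventually_gt_atTop 0] with n hid hm hpos hN
  have hN' : (0 : ℝ) < N n := by exact_mod_cast hN
  set A := ∫ ω, f₁ n ω ^ 2 ∂P n
  set r := (√A * √(N n))⁻¹ with hr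
  have hr0 : 0 < r := by positivity
  have h2δ : 0 < 2 + δ := by linarith
  have hint : Integrable (fun ω => |f₁ n ω| ^ (2 + δ)) (P n) := by
    have := hm.integrable_norm_rpow (by simpa using h2δ) ENNReal.ofReal_ne_top
    simpa [ENNReal.toReal_ofReal h2δ.le, Real.norm_eq_abs] using this
  have hm2 : MemLp (f₁ n) 2 (P n) := hm.mono_exponent (by
    rw [show (2 : ENNReal) = ENNReal.ofReal 2 by simp]
    exact ENNReal.ofReal_le_ofReal (by linarith))
  have hle : ∀ i, ∫ ω, truncSq η (c * (r * f n i ω)) ∂P n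
      ≤ η ^ (-δ) * |c| ^ (2 + δ) * r ^ (2 + δ) * ∫ ω, |f₁ n ω| ^ (2 + δ) ∂P n := by
    intro i
    have hmeas : Measurable fun s => truncSq η (c * (r * s)) :=
      (measurable_truncSq η).comp (by fun_prop)
    have e := ((hid i).comp hmeas).integral_eq
    simp only [Function.comp_apply] at e
    rw [e, ← integral_const_mul]
    have hi : Integrable (fun ω => truncSq η (c * (r * f₁ n ω))) (P n) :=
      integrable_truncSq ((hm2.const_mul r).const_mul c) η
    refine integral_mono hi (hint.const_mul _) fun ω => ?_
    refine (truncSq_le_rpow hη hδ.le _).trans (le_of_eq ?_)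
    rw [abs_mul, abs_mul, Real.mul_rpow (abs_nonneg _) (by positivity),
      Real.mul_rpow (abs_nonneg _) (abs_nonneg _), abs_of_pos hr0]
    ring
  refine (Finset.sum_le_sum fun i _ => hle i).trans (le_of_eq ?_)
  rw [Finset.sum_const, Finset.card_univ, Fintype.card_fin, nsmul_eq_mul]
  have e1 : r ^ (2 + δ) = (A ^ ((2 + δ) / 2))⁻¹ * ((N n : ℝ) ^ (δ / 2))⁻¹ * (N n : ℝ)⁻¹ := by
    rw [hr, ← Real.sqrt_mul hpos.le, Real.inv_rpow (Real.sqrt_nonneg _), Real.sqrt_eq_rpow,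
      ← Real.rpow_mul (by positivity), Real.mul_rpow hpos.le hN'.le,
      show 1 / 2 * (2 + δ) = (2 + δ) / 2 by ring, mul_inv, mul_assoc]
    congr 1
    rw [← mul_inv, show (2 + δ) / 2 = δ / 2 + 1 by ring, Real.rpow_add hN', Real.rpow_one]
  rw [e1]
  field_simp

theorem lindebergArray_combination (hN : Tendsto N atTop atTop)
    {f g : ∀ n, Fin (N n) → Ω n → ℝ} {A B : ℕ → ℝ}
    (h : ∀ᶠ n in atTop, IsUncorrelatedSample (P n) (f n) (g n) (A n) (B n))
    (hA : ∀ᶠ n in atTop, 0 < A n) (hB : ∀ᶠ n in atTop, 0 < B n)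
    (hf : ∀ (c : ℝ) {η : ℝ}, 0 < η → Tendsto (fun n => ∑ i, ∫ ω, truncSq η
      (c * ((√(A n) * √(N n))⁻¹ * f n i ω)) ∂P n) atTop (𝓝 0))
    (hg : ∀ (c : ℝ) {η : ℝ}, 0 < η → Tendsto (fun n => ∑ i, ∫ ω, truncSq η
      (c * ((√(B n) * √(N n))⁻¹ * g n i ω)) ∂P n) atTop (𝓝 0)) (t₀ t₁ : ℝ) :
    LindebergArray P (fun n i ω => t₀ * ((√(A n) * √(N n))⁻¹ * f n i ω)
      + t₁ * ((√(B n) * √(N n))⁻¹ * g n i ω)) (t₀ ^ 2 + t₁ ^ 2) := by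
  simp_rw [← mul_assoc]
  refine ⟨?_, ?_, ?_, ?_, ?_⟩
  · filter_upwards [h] with n h
    exact fun i => h.memLp_combination _ _ i
  · filter_upwards [h] with n h
    exact h.indep_combination _ _
  · filter_upwards [h] with n h
    exact fun i => h.integral_combination _ _ i
  · refine tendsto_const_nhds.congr' ?_
    filter_upwards [h, hA, hB, hN.eventually_gt_atTop 0] with n h hA hB hN
    have hN' : (N n : ℝ) ≠ 0 := by positivity
    simp_rw [h.integral_combination_sq]
    rw [Finset.sum_const, Finset.card_univ, Fintype.card_fin, nsmul_eq_mul]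
    simp only [mul_pow, inv_pow]
    rw [Real.sq_sqrt hA.le, Real.sq_sqrt hB.le, Real.sq_sqrt (Nat.cast_nonneg _)]
    field_simp
  · intro η hη
    have hlim := ((hf t₀ (half_pos hη)).add (hg t₁ (half_pos hη))).const_mul 4
    rw [add_zero, mul_zero] at hlim
    refine tendsto_of_tendsto_of_tendsto_of_le_of_le' tendsto_const_nhds hlim
      (Eventually.of_forall fun n => Finset.sum_nonneg fun i _ =>
        integral_nonneg fun ω => truncSq_nonneg _ _) ?_
    filter_upwards [h] with n h
    rw [← Finset.sum_add_distrib, Finset.mul_sum]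
    refine Finset.sum_le_sum fun i _ => ?_
    have h1 : MemLp (fun ω => t₀ * ((√(A n) * √(N n))⁻¹ * f n i ω)) 2 (P n) :=
      ((h.memLp_left i).const_mul _).const_mul _
    have h2 : MemLp (fun ω => t₁ * ((√(B n) * √(N n))⁻¹ * g n i ω)) 2 (P n) :=
      ((h.memLp_right i).const_mul _).const_mul _
    rw [← integral_add (integrable_truncSq h1 _) (integrable_truncSq h2 _), ← integral_const_mul]
    refine integral_mono (integrable_truncSq (h.memLp_combination _ _ i) _)
      (((integrable_truncSq h1 _).add (integrable_truncSq h2 _)).const_mul 4) fun ω => ?_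
    simp only [mul_assoc]
    exact truncSq_add_le _ _ _

/-- Differences with small second moments are negligible after normalization. -/
theorem tendsto_probFilter_of_secondMomentBound {d : ∀ n, Fin (N n) → Ω n → ℝ} {B r : ℕ → ℝ}
    (h : ∀ᶠ n in atTop, SecondMomentBound (P n) (d n) (B n))
    (hB : Tendsto (fun n => r n ^ 2 * B n) atTop (𝓝 0)) :
    Tendsto (fun q : Σ n, Ω n => ∑ i, r q.1 * d q.1 i q.2) (probFilter P) (𝓝 0) ∧
    Tendsto (fun q : Σ n, Ω n => ∑ i, (r q.1 * d q.1 i q.2) ^ 2) (probFilter P) (𝓝 0) := by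
  constructor
  · refine tendsto_probFilter_of_integral_sq (f := fun n ω => ∑ i, r n * d n i ω) ?_ ?_
    · filter_upwards [h] with n h
      exact memLp_finsetSum _ fun i _ => (h.memLp i).const_mul _
    · refine tendsto_of_tendsto_of_tendsto_of_le_of_le' tendsto_const_nhds hB
        (Eventually.of_forall fun n => integral_nonneg fun ω => sq_nonneg _) ?_
      filter_upwards [h] with n h
      simp_rw [← Finset.mul_sum, mul_pow]
      rw [integral_const_mul]
      exact mul_le_mul_of_nonneg_left h.integral_sq_sum_le (sq_nonneg _)
  · refine tendsto_probFilter_of_integral (f := fun n ω => ∑ i, (r n * d n i ω) ^ 2) ?_ ?_ ?_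
    · exact Eventually.of_forall fun n ω => Finset.sum_nonneg fun i _ => sq_nonneg _
    · filter_upwards [h] with n h
      exact integrable_finsetSum _ fun i _ => ((h.memLp i).const_mul _).integrable_sq
    · refine tendsto_of_tendsto_of_tendsto_of_le_of_le' tendsto_const_nhds hB
        (Eventually.of_forall fun n => integral_nonneg fun ω =>
          Finset.sum_nonneg fun i _ => sq_nonneg _) ?_
      filter_upwards [h] with n h
      simp_rw [mul_pow, ← Finset.mul_sum]
      rw [integral_const_mul]
      exact mul_le_mul_of_nonneg_left h.integral_sum_sq_le (sq_nonneg _)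

end Arrays

section Sample

variable {Ω : Type*} [MeasurableSpace Ω] {P : Measure Ω} {n p N : ℕ}
  {X : ℕ → Ω → Fin p → ℝ} {u : Fin p → ℝ} {S : Matrix (Fin p) (Fin p) ℝ}

theorem measurable_trace_mul (u u' : Fin p → ℝ) (S : Matrix (Fin p) (Fin p) ℝ) :
    Measurable fun q : (Fin p → ℝ) × (Fin p → ℝ) =>
      trace ((outer q.1 u - S) * (outer q.2 u' - S)) := by
  simp only [trace, diag_apply, Matrix.mul_apply, Matrix.sub_apply, outer, vecMulVec_apply, Pi.sub_apply]
  fun_prop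

theorem measurable_oneForm_add (u u' : Fin p → ℝ) (S : Matrix (Fin p) (Fin p) ℝ) :
    Measurable fun q : (Fin p → ℝ) × (Fin p → ℝ) => oneForm (outer q.1 u + outer q.2 u' - S) := by
  simp only [oneForm_eq_sum, Matrix.sub_apply, Matrix.add_apply, outer, vecMulVec_apply, Pi.sub_apply]
  fun_prop

namespace IsSample

theorem identDistrib_e (h : IsSample P n p X u S) (hN : 2 * N ≤ n) (i j : Fin N) :
    IdentDistrib (fun ω => e N u S (fun k => X k ω) i) (fun ω => e N u S (fun k => X k ω) j) P P :=
  (h.identDistrib_pairs hN i j).comp (measurable_trace_mul u u S)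

theorem identDistrib_v (h : IsSample P n p X u S) (hN : 2 * N ≤ n) (i j : Fin N) :
    IdentDistrib (fun ω => v N u S (fun k => X k ω) i) (fun ω => v N u S (fun k => X k ω) j) P P :=
  (h.identDistrib_pairs hN i j).comp (measurable_oneForm_add u u ((2 : ℝ) • S))

theorem indep_e_v (h : IsSample P n p X u S) (hN : 2 * N ≤ n) :
    iIndepFun (fun (i : Fin N) ω => (e N u S (fun k => X k ω) i, v N u S (fun k => X k ω) i)) P :=
  (h.iIndepFun_pairs hN).comp (fun _ q => (trace ((outer q.1 u - S) * (outer q.2 u - S)),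
    oneForm (outer q.1 u + outer q.2 u - (2 : ℝ) • S))) fun _ =>
      (measurable_trace_mul u u S).prodMk (measurable_oneForm_add u u ((2 : ℝ) • S))

theorem isUncorrelatedSample (h : IsSample P n p X u S) (hN : 2 * N ≤ n) (hN0 : 0 < N)
    (he : MemLp (fun ω => e N u S (fun i => X i ω) 0) 2 P) :
    IsUncorrelatedSample P (fun (i : Fin N) ω => e N u S (fun k => X k ω) i)
      (fun (i : Fin N) ω => v N u S (fun k => X k ω) i)
      (∫ ω, e N u S (fun i => X i ω) 0 ^ 2 ∂P) (∫ ω, v N u S (fun i => X i ω) 0 ^ 2 ∂P) := by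
  obtain ⟨C, hC⟩ := h.exists_isTwoSample hN hN0 he
  have e1 : ∀ i : Fin N, (fun ω => e N u S (fun k => X k ω) i) = _ :=
    fun i => funext fun ω => e_eq_traceForm S u (fun k => X k ω) i
  have e2 : ∀ i : Fin N, (fun ω => v N u S (fun k => X k ω) i) = _ :=
    fun i => funext fun ω => v_eq_sumForm S u (fun k => X k ω) i
  refine ⟨fun i => ?_, fun i => ?_, h.indep_e_v hN, fun i => ?_, fun i => ?_, fun i => ?_,
    fun i => ?_, fun i => ?_⟩
  · rw [e1]; exact hC.memLp_traceForm _ _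
  · rw [e2]; exact hC.memLp_sumForm_add _
  · rw [e1]; exact hC.integral_traceForm i
  · rw [e2]; exact hC.integral_sumForm_add i
  · exact ((h.identDistrib_e hN i ⟨0, hN0⟩).comp (measurable_id.pow_const 2)).integral_eq
  · exact ((h.identDistrib_v hN i ⟨0, hN0⟩).comp (measurable_id.pow_const 2)).integral_eq
  · simp_rw [e_eq_traceForm, v_eq_sumForm]
    exact hC.integral_traceForm_mul_sumForm_add i

theorem integral_e_sq (hN0 : 0 < N) {C : Fin p → Fin p → Fin p → Fin p → ℝ}
    (hC : IsTwoSample P (fun (i : Fin N) ω => X i ω - u) (fun (i : Fin N) ω => X (i + N) ω - u) S C) :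
    ∫ ω, e N u S (fun i => X i ω) 0 ^ 2 ∂P = norm₄ C ^ 2 := by
  rw [← hC.integral_traceForm_sq ⟨0, hN0⟩]
  exact integral_congr_ae (ae_of_all _ fun ω =>
    congrArg (· ^ 2) (e_eq_traceForm S u (fun k => X k ω) ⟨0, hN0⟩))

theorem integral_v_sq (hN0 : 0 < N) {C : Fin p → Fin p → Fin p → Fin p → ℝ}
    (hC : IsTwoSample P (fun (i : Fin N) ω => X i ω - u) (fun (i : Fin N) ω => X (i + N) ω - u) S C) :
    ∫ ω, v N u S (fun i => X i ω) 0 ^ 2 ∂P = 2 * ∑ a, ∑ b, ∑ a', ∑ b', C a b a' b' := by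
  rw [← hC.integral_sumForm_add_sq ⟨0, hN0⟩]
  exact integral_congr_ae (ae_of_all _ fun ω =>
    congrArg (· ^ 2) (v_eq_sumForm S u (fun k => X k ω) ⟨0, hN0⟩))

theorem integral_e_sq_pos (h : IsSample P n p X u S) (hN : 2 * N ≤ n) (hN0 : 0 < N)
    (he : MemLp (fun ω => e N u S (fun i => X i ω) 0) 2 P)
    (hv : 0 < ∫ ω, v N u S (fun i => X i ω) 0 ^ 2 ∂P) :
    0 < ∫ ω, e N u S (fun i => X i ω) 0 ^ 2 ∂P := by
  obtain ⟨C, hC⟩ := h.exists_isTwoSample hN hN0 he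
  rw [integral_v_sq hN0 hC] at hv
  rw [integral_e_sq hN0 hC]
  refine lt_of_le_of_ne (sq_nonneg _) fun h0 => hv.ne' ?_
  rw [sq_norm₄, eq_comm] at h0
  have hz : ∀ a b a' b', C a b a' b' = 0 := by
    have n1 : ∀ a b a', 0 ≤ ∑ b', C a b a' b' ^ 2 := fun _ _ _ => Finset.sum_nonneg fun _ _ => sq_nonneg _
    have n2 : ∀ a b, 0 ≤ ∑ a', ∑ b', C a b a' b' ^ 2 := fun _ _ => Finset.sum_nonneg fun _ _ => n1 _ _ _
    have n3 : ∀ a, 0 ≤ ∑ b, ∑ a', ∑ b', C a b a' b' ^ 2 := fun _ => Finset.sum_nonneg fun _ _ => n2 _ _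
    intro a b a' b'
    have h3 := (Finset.sum_eq_zero_iff_of_nonneg fun a _ => n3 a).mp h0 a (Finset.mem_univ _)
    have h4 := (Finset.sum_eq_zero_iff_of_nonneg fun b _ => n2 a b).mp h3 b (Finset.mem_univ _)
    have h5 := (Finset.sum_eq_zero_iff_of_nonneg fun a' _ => n1 a b a').mp h4 a' (Finset.mem_univ _)
    have h6 := (Finset.sum_eq_zero_iff_of_nonneg fun b' _ => sq_nonneg (C a b a' b')).mp h5 b'
      (Finset.mem_univ _)
    exact pow_eq_zero_iff (two_ne_zero) |>.mp h6
  simp [hz]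

theorem secondMomentBound_eStar (h : IsSample P n p X u S) (hN : 2 * N ≤ n) (hN0 : 0 < N)
    (he : MemLp (fun ω => e N u S (fun i => X i ω) 0) 2 P) {σ τ : ℝ}
    (hσ : σ = √(∫ ω, e N u S (fun i => X i ω) 0 ^ 2 ∂P)) (hτ : τ = trace (S * S)) :
    SecondMomentBound P (fun (i : Fin N) ω => eStar N S (fun k => X k ω) i - e N u S (fun k => X k ω) i)
      (2 * (2 * (20 * σ * (σ / N + τ) + 20 * σ * (σ / N + τ)) + 464 * (σ / N + τ) ^ 2 / N)) := by
  obtain ⟨C, hC⟩ := h.exists_isTwoSample hN hN0 he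
  rw [integral_e_sq hN0 hC, Real.sqrt_sq (norm₄_nonneg _)] at hσ
  simp_rw [eStar_sub_e S u _]
  refine hC.secondMomentBound_traceForm hσ ?_ hN0
  rw [hτ]
  simp only [trace, diag_apply, Matrix.mul_apply]
  refine Finset.sum_congr rfl fun a _ => Finset.sum_congr rfl fun b _ => ?_
  rw [h.cov_symm (by omega) b a, sq]

theorem secondMomentBound_vStar (h : IsSample P n p X u S) (hN : 2 * N ≤ n) (hN0 : 0 < N)
    (he : MemLp (fun ω => e N u S (fun i => X i ω) 0) 2 P) {k τ : ℝ}
    (hk : k = (∫ ω, v N u S (fun i => X i ω) 0 ^ 2 ∂P) / 2) (hτ : τ = (∑ a, ∑ b, S a b) ^ 2) :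
    SecondMomentBound P (fun (i : Fin N) ω => vStar N S (fun k => X k ω) i - v N u S (fun k => X k ω) i)
      (2 * (28 * (k / N + τ) + 28 * (k / N + τ))) := by
  obtain ⟨C, hC⟩ := h.exists_isTwoSample hN hN0 he
  simp_rw [vStar_sub_v S u _]
  refine hC.secondMomentBound_sumForm ?_ ?_ hτ hN0
  · rw [hk, integral_v_sq hN0 hC]
    ring
  · rw [hk]
    have : 0 ≤ ∫ ω, v N u S (fun i => X i ω) 0 ^ 2 ∂P := integral_nonneg fun ω => sq_nonneg _
    positivity

theorem aemeasurable_e_v (h : IsSample P n p X u S) (hN : 2 * N ≤ n) (i : Fin N) :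
    AEMeasurable (fun ω => e N u S (fun k => X k ω) i) P ∧
    AEMeasurable (fun ω => v N u S (fun k => X k ω) i) P :=
  ⟨(h.identDistrib_e hN i i).aemeasurable_fst, (h.identDistrib_v hN i i).aemeasurable_fst⟩

theorem aemeasurable_eStar_vStar (h : IsSample P n p X u S) (hN : 2 * N ≤ n) (i : Fin N) :
    AEMeasurable (fun ω => eStar N S (fun k => X k ω) i) P ∧
    AEMeasurable (fun ω => vStar N S (fun k => X k ω) i) P := by
  have h1 : AEMeasurable (fun ω => X i ω - mean₁ N fun k => X k ω) P := by
    refine (h.aemeasurable i (by omega)).sub ?_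
    have hs : AEMeasurable (fun ω => ∑ k ∈ Finset.range N, X k ω) P :=
      Finset.aemeasurable_fun_sum (Finset.range N) fun k hk => h.aemeasurable k
        (by have := Finset.mem_range.mp hk; omega)
    exact hs.const_smul (1 / (N : ℝ))
  have h2 : AEMeasurable (fun ω => X (i + N) ω - mean₂ N fun k => X k ω) P := by
    refine (h.aemeasurable _ (by omega)).sub ?_
    have hs : AEMeasurable (fun ω => ∑ k ∈ Finset.range N, X (k + N) ω) P :=
      Finset.aemeasurable_fun_sum (Finset.range N) fun k hk => h.aemeasurable (k + N)
        (by have := Finset.mem_range.mp hk; omega)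
    exact hs.const_smul (1 / (N : ℝ))
  have e0 : ∀ x m : Fin p → ℝ, outer x m = outer (x - m) 0 := fun x m => by simp [outer]
  constructor
  · have := (measurable_trace_mul 0 0 ((((N : ℝ) - 1) / N) • S)).comp_aemeasurable (h1.prodMk h2)
    unfold eStar
    simp_rw [e0 (X _ _)]
    exact this
  · have := (measurable_oneForm_add 0 0 ((2 * ((N : ℝ) - 1) / N) • S)).comp_aemeasurable
      (h1.prodMk h2)
    unfold vStar
    simp_rw [e0 (X _ _)]
    exact this

end IsSample

end Sample

theorem isLittleO_rpow_half {N : ℕ → ℕ} (hN : Tendsto N atTop atTop) {δ : ℝ} {f g : ℕ → ℝ}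
    (hf : ∀ n, 0 ≤ f n) (hfg : ∀ n, f n ≤ g n)
    (hg : g =o[atTop] fun n => (N n : ℝ) ^ ((δ + min 2 δ) / 4)) :
    f =o[atTop] fun n => (N n : ℝ) ^ (δ / 2) := by
  refine (IsBigO.of_bound 1 (Eventually.of_forall fun n => ?_)).trans_isLittleO
    (hg.trans_isBigO (IsBigO.of_bound 1 ?_))
  · rw [one_mul, Real.norm_of_nonneg (hf n), Real.norm_of_nonneg ((hf n).trans (hfg n))]
    exact hfg n
  · filter_upwards [hN.eventually_ge_atTop 1] with n hn
    rw [one_mul, Real.norm_of_nonneg (by positivity), Real.norm_of_nonneg (by positivity)]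
    exact Real.rpow_le_rpow_of_exponent_le (by exact_mod_cast hn) (by linarith [min_le_right 2 δ])

theorem tendsto_half : Tendsto (fun n : ℕ => n / 2) atTop atTop :=
  tendsto_atTop_atTop.mpr fun b => ⟨2 * b, fun n hn => by omega⟩

section Rates

variable {N : ℕ → ℕ} {A τ : ℕ → ℝ}

theorem tendsto_rate_traceForm (hN : Tendsto N atTop atTop) (hA : ∀ᶠ n in atTop, 0 < A n)
    (h : (fun n => τ n ^ 2) =o[atTop] fun n => (N n : ℝ) ^ 2 * A n) :
    Tendsto (fun n => ((√(A n) * √(N n))⁻¹) ^ 2 *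
      (2 * (2 * (20 * √(A n) * (√(A n) / N n + τ n) + 20 * √(A n) * (√(A n) / N n + τ n))
        + 464 * (√(A n) / N n + τ n) ^ 2 / N n))) atTop (𝓝 0) := by
  have h1 : Tendsto (fun n => τ n / (N n * √(A n))) atTop (𝓝 0) := by
    have := h.tendsto_div_nhds_zero.sqrt
    rw [Real.sqrt_zero] at this
    rw [tendsto_zero_iff_abs_tendsto_zero]
    refine this.congr' ?_
    filter_upwards [hA] with n hA
    rw [Function.comp_apply, ← Real.sqrt_sq_eq_abs, div_pow, mul_pow, Real.sq_sqrt hA.le]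
  have hNr : Tendsto (fun n => ((N n : ℝ))⁻¹) atTop (𝓝 0) :=
    tendsto_inv_atTop_zero.comp (tendsto_natCast_atTop_atTop.comp hN)
  have hq : Tendsto (fun n => ((N n : ℝ)⁻¹) ^ 2 + τ n / (N n * √(A n))) atTop (𝓝 0) := by
    simpa using (hNr.pow 2).add h1
  have := (hq.const_mul 160).add ((hq.pow 2).const_mul 928)
  norm_num at this
  refine this.congr' ?_
  filter_upwards [hA, hN.eventually_gt_atTop 0] with n hA hN
  have hs : 0 < √(A n) := Real.sqrt_pos.mpr hA
  have hN' : (0 : ℝ) < N n := by exact_mod_cast hN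
  rw [inv_pow, mul_pow, Real.sq_sqrt hN'.le]
  field_simp
  ring

theorem tendsto_rate_sumForm (hN : Tendsto N atTop atTop) (hA : ∀ᶠ n in atTop, 0 < A n)
    (h : τ =o[atTop] fun n => (N n : ℝ) * A n) :
    Tendsto (fun n => ((√(A n) * √(N n))⁻¹) ^ 2 *
      (2 * (28 * (A n / 2 / N n + τ n) + 28 * (A n / 2 / N n + τ n)))) atTop (𝓝 0) := by
  have hNr : Tendsto (fun n => ((N n : ℝ))⁻¹) atTop (𝓝 0) :=
    tendsto_inv_atTop_zero.comp (tendsto_natCast_atTop_atTop.comp hN)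
  have := ((hNr.pow 2).const_mul 56).add (h.tendsto_div_nhds_zero.const_mul 112)
  norm_num at this
  refine this.congr' ?_
  filter_upwards [hA, hN.eventually_gt_atTop 0] with n hA hN
  have hN' : (0 : ℝ) < N n := by exact_mod_cast hN
  rw [inv_pow, mul_pow, Real.sq_sqrt hN'.le, Real.sq_sqrt hA.le]
  field_simp
  ring

end Rates

theorem aemeasurable_pair {Ω : Type*} [MeasurableSpace Ω] {P : Measure Ω} {N : ℕ}
    {f g : Fin N → Ω → ℝ} (h : ∀ i, AEMeasurable (f i) P ∧ AEMeasurable (g i) P) :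
    AEMeasurable (fun ω i => ![f i ω, g i ω]) P := by
  refine aemeasurable_pi_lambda _ fun i => aemeasurable_pi_lambda _ fun k => ?_
  fin_cases k
  · exact (h i).1
  · exact (h i).2

end CovEL
end

theorem theorem1
    -- for every sample size `n`: a dimension, a probability space, and a sample of size `n`
    (p : ℕ → ℕ) {Ω : ℕ → Type*} [∀ n, MeasurableSpace (Ω n)]
    (P : ∀ n, Measure (Ω n)) [∀ n, IsProbabilityMeasure (P n)]
    (X : ∀ n, ℕ → Ω n → Fin (p n) → ℝ)
    (u : ∀ n, Fin (p n) → ℝ) (S S₀ : ∀ n, Matrix (Fin (p n)) (Fin (p n)) ℝ)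
    (hX : ∀ n, CovEL.IsSample (P n) n (p n) (X n) (u n) (S n))
    -- the half-sample size `N = [n/2]` and the first pair `(e₁(Σ), v₁(Σ))`
    (N : ℕ → ℕ) (hN : ∀ n, N n = n / 2)
    (e₁ v₁ : ∀ n, Ω n → ℝ)
    (he₁ : ∀ n, e₁ n = fun ω => CovEL.e (N n) (u n) (S n) (fun i => X n i ω) 0)
    (hv₁ : ∀ n, v₁ n = fun ω => CovEL.v (N n) (u n) (S n) (fun i => X n i ω) 0)
    -- moment conditions
    (δ : ℝ) (hδ : 0 < δ)
    (hv_pos : ∀ᶠ n in atTop, 0 < ∫ ω, v₁ n ω ^ 2 ∂(P n))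
    (he_fin : ∀ᶠ n in atTop, MemLp (e₁ n) (ENNReal.ofReal (2 + δ)) (P n))
    (hv_fin : ∀ᶠ n in atTop, MemLp (v₁ n) (ENNReal.ofReal (2 + δ)) (P n))
    (hratio : (fun n => max
        ((∫ ω, |e₁ n ω| ^ (2 + δ) ∂(P n)) / (∫ ω, e₁ n ω ^ 2 ∂(P n)) ^ ((2 + δ) / 2))
        ((∫ ω, |v₁ n ω| ^ (2 + δ) ∂(P n)) / (∫ ω, v₁ n ω ^ 2 ∂(P n)) ^ ((2 + δ) / 2)))
      =o[atTop] (fun n => (N n : ℝ) ^ ((δ + min 2 δ) / 4)))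
    -- the null hypothesis
    (H₀ : ∀ n, S n = S₀ n) :
    TendstoInDistribution
      (fun n ω => CovEL.negTwoLog (CovEL.L₁ (N n) (u n) (S₀ n) (fun i => X n i ω)))
      atTop (fun x : ℝ => (x : EReal)) P (CovEL.chiSquare 2) ∧
    ((fun n => (trace (S n * S n)) ^ 2)
        =o[atTop] (fun n => (N n : ℝ) ^ 2 * ∫ ω, e₁ n ω ^ 2 ∂(P n)) →
      (fun n => (∑ a, ∑ b, S n a b) ^ 2)
        =o[atTop] (fun n => (N n : ℝ) * ∫ ω, v₁ n ω ^ 2 ∂(P n)) →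
      TendstoInDistribution
        (fun n ω => CovEL.negTwoLog (CovEL.L₂ (N n) (S₀ n) (fun i => X n i ω)))
        atTop (fun x : ℝ => (x : EReal)) P (CovEL.chiSquare 2)) := by
  obtain rfl : N = fun n => n / 2 := funext hN
  obtain rfl : S = S₀ := funext H₀
  obtain rfl := funext he₁
  obtain rfl := funext hv₁
  have hNt : Tendsto (fun n : ℕ => n / 2) atTop atTop := CovEL.tendsto_half
  have h2N : ∀ n : ℕ, 2 * (n / 2) ≤ n := fun n => by omega
  have h2δ : (2 : ENNReal) ≤ ENNReal.ofReal (2 + δ) := by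
    rw [show (2 : ENNReal) = ENNReal.ofReal 2 by simp]
    exact ENNReal.ofReal_le_ofReal (by linarith)
  have hpos : ∀ᶠ n in atTop, 0 < n / 2 := hNt.eventually_gt_atTop 0
  have he2 : ∀ᶠ n in atTop, MemLp (fun ω => CovEL.e (n / 2) (u n) (S n) (fun i => X n i ω) 0) 2 (P n) :=
    he_fin.mono fun n h => h.mono_exponent h2δ
  let A : ℕ → ℝ := fun n => ∫ ω, CovEL.e (n / 2) (u n) (S n) (fun i => X n i ω) 0 ^ 2 ∂P n
  let B : ℕ → ℝ := fun n => ∫ ω, CovEL.v (n / 2) (u n) (S n) (fun i => X n i ω) 0 ^ 2 ∂P n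
  have hA : ∀ᶠ n in atTop, 0 < A n := by
    filter_upwards [hpos, he2, hv_pos] with n h0 he hv
    exact (hX n).integral_e_sq_pos (h2N n) h0 he hv
  have hB : ∀ᶠ n in atTop, 0 < B n := hv_pos
  have hU : ∀ᶠ n in atTop, CovEL.IsUncorrelatedSample (P n)
      (fun (i : Fin (n / 2)) ω => CovEL.e (n / 2) (u n) (S n) (fun k => X n k ω) i)
      (fun (i : Fin (n / 2)) ω => CovEL.v (n / 2) (u n) (S n) (fun k => X n k ω) i) (A n) (B n) := by
    filter_upwards [hpos, he2] with n h0 he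
    exact (hX n).isUncorrelatedSample (h2N n) h0 he
  have hratio_nonneg : ∀ {f : ∀ n, Ω n → ℝ} n,
      0 ≤ (∫ ω, |f n ω| ^ (2 + δ) ∂P n) / (∫ ω, f n ω ^ 2 ∂P n) ^ ((2 + δ) / 2) := fun n =>
    div_nonneg (integral_nonneg fun ω => by positivity)
      (Real.rpow_nonneg (integral_nonneg fun ω => sq_nonneg _) _)
  have hL := CovEL.lindebergArray_combination hNt hU hA hB
    (CovEL.tendsto_sum_integral_truncSq hNt hδ
      (f₁ := fun n ω => CovEL.e (n / 2) (u n) (S n) (fun i => X n i ω) 0)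
      (hpos.mono fun n h0 i => (hX n).identDistrib_e (h2N n) i ⟨0, h0⟩) he_fin hA
      (CovEL.isLittleO_rpow_half hNt hratio_nonneg (fun n => le_max_left _ _) hratio))
    (CovEL.tendsto_sum_integral_truncSq hNt hδ
      (f₁ := fun n ω => CovEL.v (n / 2) (u n) (S n) (fun i => X n i ω) 0)
      (hpos.mono fun n h0 i => (hX n).identDistrib_v (h2N n) i ⟨0, h0⟩) hv_fin hB
      (CovEL.isLittleO_rpow_half hNt hratio_nonneg (fun n => le_max_right _ _) hratio))
  have hscale : ∀ᶠ n in atTop, (√(A n) * √((n / 2 : ℕ) : ℝ))⁻¹ ≠ 0 ∧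
      (√(B n) * √((n / 2 : ℕ) : ℝ))⁻¹ ≠ 0 := by
    filter_upwards [hpos, hA, hB] with n h0 hA hB
    have : (0 : ℝ) < (n / 2 : ℕ) := by exact_mod_cast h0
    constructor <;> positivity
  have hxm : ∀ n (i : Fin (n / 2)), AEMeasurable (fun ω => (√(A n) * √((n / 2 : ℕ) : ℝ))⁻¹ *
      CovEL.e (n / 2) (u n) (S n) (fun k => X n k ω) i) (P n) := fun n i =>
    ((hX n).aemeasurable_e_v (h2N n) i).1.const_mul _
  have hym : ∀ n (i : Fin (n / 2)), AEMeasurable (fun ω => (√(B n) * √((n / 2 : ℕ) : ℝ))⁻¹ *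
      CovEL.v (n / 2) (u n) (S n) (fun k => X n k ω) i) (P n) := fun n i =>
    ((hX n).aemeasurable_e_v (h2N n) i).2.const_mul _
  constructor
  · refine CovEL.tendstoInDistribution_negTwoLog_chiSquare hNt hxm hym hL
      (x' := fun n (i : Fin (n / 2)) ω => (√(A n) * √((n / 2 : ℕ) : ℝ))⁻¹ *
        CovEL.e (n / 2) (u n) (S n) (fun k => X n k ω) i)
      (y' := fun n (i : Fin (n / 2)) ω => (√(B n) * √((n / 2 : ℕ) : ℝ))⁻¹ *
        CovEL.v (n / 2) (u n) (S n) (fun k => X n k ω) i) ?_ ?_ ?_ ?_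
      (fun n => CovEL.aemeasurable_pair fun i => (hX n).aemeasurable_e_v (h2N n) i) ?_
    · simpa using tendsto_const_nhds
    · simpa using tendsto_const_nhds
    · simpa using tendsto_const_nhds
    · simpa using tendsto_const_nhds
    · filter_upwards [hscale] with n hs ω
      exact (CovEL.elRatio_scale _ _ hs.1 hs.2).symm
  · intro hτ hs
    have he := CovEL.tendsto_probFilter_of_secondMomentBound
      (r := fun n => (√(A n) * √((n / 2 : ℕ) : ℝ))⁻¹)
      (by filter_upwards [hpos, he2] with n h0 he
          exact (hX n).secondMomentBound_eStar (h2N n) h0 he rfl rfl)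
      (CovEL.tendsto_rate_traceForm hNt hA hτ)
    have hv := CovEL.tendsto_probFilter_of_secondMomentBound
      (r := fun n => (√(B n) * √((n / 2 : ℕ) : ℝ))⁻¹)
      (by filter_upwards [hpos, he2] with n h0 he
          exact (hX n).secondMomentBound_vStar (h2N n) h0 he rfl rfl)
      (CovEL.tendsto_rate_sumForm hNt hB hs)
    simp_rw [mul_sub, Finset.sum_sub_distrib] at he hv
    refine CovEL.tendstoInDistribution_negTwoLog_chiSquare hNt hxm hym hL
      (x' := fun n (i : Fin (n / 2)) ω => (√(A n) * √((n / 2 : ℕ) : ℝ))⁻¹ *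
        CovEL.eStar (n / 2) (S n) (fun k => X n k ω) i)
      (y' := fun n (i : Fin (n / 2)) ω => (√(B n) * √((n / 2 : ℕ) : ℝ))⁻¹ *
        CovEL.vStar (n / 2) (S n) (fun k => X n k ω) i) he.1 hv.1 he.2 hv.2
      (fun n => CovEL.aemeasurable_pair fun i => (hX n).aemeasurable_eStar_vStar (h2N n) i) ?_
    filter_upwards [hscale] with n hs ω
    exact (CovEL.elRatio_scale _ _ hs.1 hs.2).symm
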